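/- Let $b\in\ell^\infty(\mathbb Z^+,\mathbb R)$ satisfy $|b(n)|\le\gamma a^{-\tau n}$ for all $n\ge1$, for some $\gamma>0$, $a>3$, $\tau>4$. For $-\pi/2<\beta<\pi/2$ and $\kappa\in\mathbb R$ let $H_\beta^\kappa=\triangle+\kappa b$ be the half-line Schrödinger operator on $\ell^2(\mathbb Z^+)$, $$(H_\beta^\kappa u)(n)=u(n+1)+u(n-1)+\kappa b(n)u(n),\quad n\ge1,\qquad u(0)\cos\beta+u(1)\sin\beta=0,$$ so that $\beta=0$ is the Dirichlet condition $u(0)=0$. Let $\delta_1$ be the first canonical basis vector. For $f\in C([-2,2])$ (complex-valued) the vector $f(H)\delta_1$ is understood with $f$ extended by zero outside $[-2,2]$, and $\mu_\psi$ denotes the spectral measure of $H$ and $\psi$. A self-adjoint operator $H$ is said to have purely absolutely continuous spectrum on $[-2,2]$ if $[-2,2]\subset\sigma_{\mathrm{ac}}(H)$ and, for every vector $\psi$, the restriction of $\mu_\psi$ to $[-2,2]$ is absolutely continuous with respect to Lebesgue measure. A measure $\mu$ is $\alpha$-Hölder continuous (Lipschitz, if $\alpha=1$) if there is $C>0$ with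 $\mu(I)\le C|I|^\alpha$ for every interval $I$ with $|I|<1$. Then there exists $\epsilon>0$, depending only on $b$, such that for every real $\kappa$ with $|\kappa|<\epsilon$ the following hold. 1. The operator $H=H_{\pi/4}^\kappa$ satisfies: (i) its spectrum is purely absolutely continuous on $[-2,2]$; and for each $\psi=f(H)\delta_1$ with $f\in C([-2,2])$: (ii) $\mu_\psi$ is $\frac12$-Hölder continuous; (iii) there exists $\gamma'>0$ such that for each $t>2$, $$\frac1t\int_0^t|\langle\psi,e^{-isH}\psi\rangle|^2\,ds\le\gamma'\,\frac{\log t}{t}.$$ 2. The operator $H=H_0^\kappa$ with Dirichlet boundary condition satisfies: (i) its spectrum is purely absolutely continuous on $[-2,2]$; and for each $\psi=f(H)\delta_1$ with $f\in C([-2,2])$: (ii) $\mu_\psi$ is Lipschitz continuous; (iii) there exists $\eta>0$ such that for each $t>0$, $$\frac1t\int_0^t|\langle\psi,e^{-isH}\psi\rangle|^2\,ds\le\frac{\eta}{t}.$$ -/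

import Mathlib

open MeasureTheory
open scoped InnerProductSpace CompactlySupported

noncomputable section

namespace HalfLine

section Spectral

variable {E : Type*} [NormedAddCommGroup E] [InnerProductSpace ℂ E] [CompleteSpace E]

/-- The positive functional `f ↦ ⟨ψ, f(T) ψ⟩` on `C_c(ℝ, ℝ)`, where `f(T)` is the continuous functional
calculus of the (self-adjoint) bounded operator `T`. -/
def spectralFunctional (T : E →L[ℂ] E) (ψ : E) : C_c(ℝ, ℝ) →ₚ[ℝ] ℝ :=
  PositiveLinearMap.mk₀
    { toFun := fun f => (⟪ψ, cfc (f : ℝ → ℝ) T ψ⟫_ℂ).re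
      map_add' := fun f g => by
        have h : cfc ((f + g : C_c(ℝ, ℝ)) : ℝ → ℝ) T = cfc (f : ℝ → ℝ) T + cfc (g : ℝ → ℝ) T :=
          cfc_add _ _ _ f.continuous.continuousOn g.continuous.continuousOn
        rw [h, add_apply, inner_add_right, Complex.add_re]
      map_smul' := fun c f => by
        have h : cfc ((c • f : C_c(ℝ, ℝ)) : ℝ → ℝ) T = c • cfc (f : ℝ → ℝ) T :=
          cfc_smul c _ _ f.continuous.continuousOn
        rw [h, smul_apply, inner_smul_right_eq_smul, Complex.smul_re]
        rfl }
    (fun f hf => by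
      have h : 0 ≤ cfc (f : ℝ → ℝ) T := cfc_nonneg fun x _ => hf x
      rw [ContinuousLinearMap.nonneg_iff_isPositive] at h
      exact (Complex.nonneg_iff.1 (h.inner_nonneg_right ψ)).1)

/-- The spectral measure `μ_ψ` of the bounded self-adjoint operator `T` at the vector `ψ`: the regular
Borel measure on `ℝ` with `∫ f dμ_ψ = ⟨ψ, f(T) ψ⟩` for all `f ∈ C_c(ℝ, ℝ)`. -/
def spectralMeasure (T : E →L[ℂ] E) (ψ : E) : Measure ℝ :=
  RealRMK.rieszMeasure (spectralFunctional T ψ)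

instance (T : E →L[ℂ] E) (ψ : E) : (spectralMeasure T ψ).Regular :=
  RealRMK.regular_rieszMeasure _

theorem integral_spectralMeasure (T : E →L[ℂ] E) (ψ : E) (f : C_c(ℝ, ℝ)) :
    ∫ x, f x ∂(spectralMeasure T ψ) = (⟪ψ, cfc (f : ℝ → ℝ) T ψ⟫_ℂ).re :=
  RealRMK.integral_rieszMeasure (spectralFunctional T ψ) f

theorem spectralMeasure_univ_le (T : E →L[ℂ] E) (ψ : E) :
    spectralMeasure T ψ Set.univ ≤ ENNReal.ofReal (‖ψ‖ ^ 2) := by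
  rw [Measure.Regular.innerRegular.measure_eq_iSup isOpen_univ]
  refine iSup₂_le fun K _ => iSup_le fun hK => ?_
  obtain ⟨f, hf1, -, hfc, hf⟩ := exists_continuous_one_zero_of_isCompact hK isClosed_empty
    (Set.disjoint_empty K)
  let F : C_c(ℝ, ℝ) := ⟨f, hfc⟩
  refine (RealRMK.rieszMeasure_le_of_eq_one (f := F) _ (fun x => (hf x).1)
    hK fun x hx => hf1 hx).trans (ENNReal.ofReal_le_ofReal ?_)
  have h : cfc (F : ℝ → ℝ) T ≤ 1 := cfc_le_one _ _ fun x _ => (hf x).2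
  rw [← sub_nonneg, ContinuousLinearMap.nonneg_iff_isPositive] at h
  have h2 := (Complex.nonneg_iff.1 (h.inner_nonneg_right ψ)).1
  rw [sub_apply, inner_sub_right, Complex.sub_re, sub_nonneg] at h2
  refine h2.trans (le_of_eq ?_)
  rw [one_apply_eq_self, inner_self_eq_norm_sq_to_K]
  norm_cast

instance (T : E →L[ℂ] E) (ψ : E) : IsFiniteMeasure (spectralMeasure T ψ) :=
  ⟨(spectralMeasure_univ_le T ψ).trans_lt ENNReal.ofReal_lt_top⟩

/-- A linear relation between the quadratic forms `⟨v_i, A v_i⟩`, valid for all self-adjoint `A`, is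
inherited by the spectral measures. -/
theorem spectral_combination (T : E →L[ℂ] E) {ι : Type} [Fintype ι] (c : ι → ℝ) (v : ι → E)
    (h : ∀ A : E →L[ℂ] E, IsSelfAdjoint A → ∑ i, c i * (⟪v i, A (v i)⟫_ℂ).re = 0)
    {g : ℝ → ℂ} (hg : Measurable g) {C : ℝ} (hC : ∀ x, ‖g x‖ ≤ C) :
    ∑ i, (c i : ℂ) * ∫ x, g x ∂(spectralMeasure T (v i)) = 0 := by
  let P : (ι → ℝ) → Measure ℝ := fun d => ∑ i, (d i).toNNReal • spectralMeasure T (v i)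
  have hint : ∀ i (d : ι → ℝ) {F : Type} [NormedAddCommGroup F] (k : ℝ → F) (C : ℝ),
      AEStronglyMeasurable k (spectralMeasure T (v i)) → (∀ x, ‖k x‖ ≤ C) →
      Integrable k ((d i).toNNReal • spectralMeasure T (v i)) := fun i d F _ k C hk hb =>
    (Integrable.of_bound hk C (Filter.Eventually.of_forall hb)).smul_measure_nnreal
  have hP : ∀ (d : ι → ℝ) {F : Type} [NormedAddCommGroup F] [NormedSpace ℝ F] (k : ℝ → F)
      (C : ℝ), StronglyMeasurable k → (∀ x, ‖k x‖ ≤ C) →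
      ∫ x, k x ∂(P d) = ∑ i, (max (d i) 0) • ∫ x, k x ∂(spectralMeasure T (v i)) := by
    intro d F _ _ k C hk hb
    rw [integral_finsetSum_measure fun i _ => hint i d k C hk.aestronglyMeasurable hb]
    refine Finset.sum_congr rfl fun i _ => ?_
    rw [integral_smul_nnreal_measure]
    rfl
  have hfin : ∀ d, IsFiniteMeasure (P d) := fun d => by
    refine ⟨?_⟩
    simp only [P, Measure.coe_finsetSum, Finset.sum_apply]
    exact ENNReal.sum_lt_top.2 fun i _ => measure_lt_top _ _
  have heq : P c = P (fun i => -c i) := by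
    have := hfin c
    have := hfin fun i => -c i
    refine Measure.ext_of_integral_eq_on_compactlySupported fun f => ?_
    obtain ⟨C, hC⟩ := f.hasCompactSupport.exists_bound_of_continuous f.continuous
    rw [hP _ f C f.continuous.stronglyMeasurable hC, hP _ f C f.continuous.stronglyMeasurable hC,
      ← sub_eq_zero, ← Finset.sum_sub_distrib]
    refine Eq.trans ?_ (h (cfc (f : ℝ → ℝ) T) (cfc_predicate _ _))
    refine Finset.sum_congr rfl fun i _ => ?_
    rw [integral_spectralMeasure, ← sub_smul, smul_eq_mul]
    congr 1
    rcases le_total (c i) 0 with hi | hi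
    · rw [max_eq_right hi, max_eq_left (by linarith)]; ring
    · rw [max_eq_left hi, max_eq_right (by linarith)]; ring
  have h2 := congrArg (fun μ : Measure ℝ => ∫ x, g x ∂μ) heq
  rw [hP _ g C hg.stronglyMeasurable hC, hP _ g C hg.stronglyMeasurable hC,
    ← sub_eq_zero, ← Finset.sum_sub_distrib] at h2
  refine Eq.trans ?_ h2
  refine Finset.sum_congr rfl fun i _ => ?_
  rw [← sub_smul, Complex.real_smul]
  congr 2
  rcases le_total (c i) 0 with hi | hi
  · rw [max_eq_right hi, max_eq_left (by linarith)]; ring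
  · rw [max_eq_left hi, max_eq_right (by linarith)]; ring

/-- Existence of `g(T)` for bounded Borel functions `g`. -/
theorem exists_borelCalculus (T : E →L[ℂ] E) {g : ℝ → ℂ} (hg : Measurable g) {C : ℝ}
    (hC : ∀ x, ‖g x‖ ≤ C) :
    ∃ S : E →L[ℂ] E, ∀ ψ, ⟪ψ, S ψ⟫_ℂ = ∫ x, g x ∂(spectralMeasure T ψ) := by
  set Q : E → ℂ := fun v => ∫ x, g x ∂(spectralMeasure T v) with hQ
  have hC0 : 0 ≤ C := (norm_nonneg _).trans (hC 0)
  have hQb : ∀ v, ‖Q v‖ ≤ C * ‖v‖ ^ 2 := fun v => by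
    refine (norm_integral_le_of_norm_le_const (Filter.Eventually.of_forall hC)).trans ?_
    exact mul_le_mul_of_nonneg_left
      (ENNReal.toReal_le_of_le_ofReal (sq_nonneg _) (spectralMeasure_univ_le T v)) hC0
  have key : ∀ {n : ℕ} (c : Fin n → ℝ) (v : Fin n → E),
      (∀ A : E →L[ℂ] E, IsSelfAdjoint A → ∑ i, c i * (⟪v i, A (v i)⟫_ℂ).re = 0) →
      ∑ i, (c i : ℂ) * Q (v i) = 0 := fun c v h => spectral_combination T c v h hg hC
  have pol : ∀ A : E →L[ℂ] E, IsSelfAdjoint A → ∀ φ ψ : E,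
      (⟪φ + ψ, A (φ + ψ)⟫_ℂ).re =
        (⟪φ, A φ⟫_ℂ).re + (⟪ψ, A ψ⟫_ℂ).re + 2 * (⟪φ, A ψ⟫_ℂ).re := by
    intro A hA φ ψ
    have h : (⟪ψ, A φ⟫_ℂ).re = (⟪φ, A ψ⟫_ℂ).re := by
      have hs : ⟪A ψ, φ⟫_ℂ = ⟪ψ, A φ⟫_ℂ :=
        (ContinuousLinearMap.isSelfAdjoint_iff_isSymmetric.1 hA) ψ φ
      rw [← hs]
      exact inner_re_symm (𝕜 := ℂ) _ _
    rw [map_add, inner_add_left, inner_add_right, inner_add_right]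
    simp only [Complex.add_re, h]
    ring
  have pol' : ∀ A : E →L[ℂ] E, IsSelfAdjoint A → ∀ φ ψ : E,
      (⟪φ - ψ, A (φ - ψ)⟫_ℂ).re =
        (⟪φ, A φ⟫_ℂ).re + (⟪ψ, A ψ⟫_ℂ).re - 2 * (⟪φ, A ψ⟫_ℂ).re := by
    intro A hA φ ψ
    rw [sub_eq_add_neg, pol A hA]
    simp [map_neg, inner_neg_left, inner_neg_right]
    ring
  set R : E → E → ℂ := fun φ ψ => Q (φ + ψ) - Q (φ - ψ) with hR
  have R_add : ∀ φ ψ₁ ψ₂, R φ (ψ₁ + ψ₂) = R φ ψ₁ + R φ ψ₂ := fun φ ψ₁ ψ₂ => by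
    have := key ![1, -1, -1, 1, -1, 1]
      ![φ + (ψ₁ + ψ₂), φ - (ψ₁ + ψ₂), φ + ψ₁, φ - ψ₁, φ + ψ₂, φ - ψ₂] fun A hA => by
        have h₁ := pol A hA φ (ψ₁ + ψ₂)
        have h₂ := pol' A hA φ (ψ₁ + ψ₂)
        have h₃ := pol A hA φ ψ₁
        have h₄ := pol' A hA φ ψ₁
        have h₅ := pol A hA φ ψ₂
        have h₆ := pol' A hA φ ψ₂
        simp only [Fin.sum_univ_succ, Fin.sum_univ_zero, Matrix.cons_val_zero,
          Matrix.cons_val_succ, h₁, h₂, h₃, h₄, h₅, h₆]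
        have : (⟪φ, A (ψ₁ + ψ₂)⟫_ℂ).re = (⟪φ, A ψ₁⟫_ℂ).re + (⟪φ, A ψ₂⟫_ℂ).re := by
          rw [map_add, inner_add_right, Complex.add_re]
        rw [this]
        ring
    simp [Fin.sum_univ_succ] at this
    linear_combination this
  have R_smul : ∀ (c : ℝ) φ ψ, R φ ((c : ℂ) • ψ) = c * R φ ψ := fun c φ ψ => by
    have := key ![1, -1, -c, c] ![φ + (c : ℂ) • ψ, φ - (c : ℂ) • ψ, φ + ψ, φ - ψ] fun A hA => by
        simp only [Fin.sum_univ_succ, Fin.sum_univ_zero, Matrix.cons_val_zero,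
          Matrix.cons_val_succ, pol A hA, pol' A hA, map_smul, inner_smul_right,
          inner_smul_left, Complex.conj_ofReal, Complex.re_ofReal_mul]
        ring
    simp [Fin.sum_univ_succ] at this
    linear_combination this
  have R_symm : ∀ φ ψ, R φ ψ = R ψ φ := fun φ ψ => by
    have := key ![1, -1] ![φ - ψ, ψ - φ] fun A hA => by
        rw [← neg_sub φ ψ]
        simp only [Fin.sum_univ_succ, Fin.sum_univ_zero, Matrix.cons_val_zero,
          Matrix.cons_val_succ, map_neg, inner_neg_neg]
        ring
    simp [Fin.sum_univ_succ] at this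
    simp only [hR]
    rw [add_comm ψ φ]
    linear_combination -this
  have Q_I : ∀ φ, Q (Complex.I • φ) = Q φ := fun φ => by
    have := key ![1, -1] ![Complex.I • φ, φ] fun A hA => by
        simp [Fin.sum_univ_succ]
    simp [Fin.sum_univ_succ] at this
    linear_combination this
  have R_I : ∀ φ ψ, R (Complex.I • φ) (Complex.I • ψ) = R φ ψ := fun φ ψ => by
    simp only [hR]
    rw [← smul_add, ← smul_sub, Q_I, Q_I]
  have R_neg : ∀ φ ψ, R φ (-ψ) = - R φ ψ := fun φ ψ => by
    simp only [hR, sub_neg_eq_add, ← sub_eq_add_neg]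
    ring
  have hII : ∀ φ : E, Complex.I • Complex.I • φ = -φ := fun φ => by
    rw [smul_smul, Complex.I_mul_I, neg_one_smul]
  have R_I' : ∀ φ ψ, R (Complex.I • φ) ψ = - R φ (Complex.I • ψ) := fun φ ψ => by
    rw [← R_neg, ← R_I φ, smul_neg, hII, neg_neg]
  have R_self : ∀ φ, R φ φ = 4 * Q φ := fun φ => by
    have := key ![1, -1, -4] ![φ + φ, φ - φ, φ] fun A hA => by
        simp only [Fin.sum_univ_succ, Fin.sum_univ_zero, Matrix.cons_val_zero,
          Matrix.cons_val_succ, pol A hA, pol' A hA]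
        ring
    simp only [Fin.sum_univ_succ, Fin.sum_univ_zero, Matrix.cons_val_zero,
          Matrix.cons_val_succ] at this
    push_cast at this
    linear_combination this
  have R_self_I : ∀ φ, R φ (Complex.I • φ) = 0 := fun φ => by
    have h := R_I' φ φ
    rw [R_symm] at h
    linear_combination h / 2
  set B : E → E → ℂ := fun φ ψ => (R φ ψ - Complex.I * R φ (Complex.I • ψ)) / 4 with hB
  have B_add : ∀ φ ψ₁ ψ₂, B φ (ψ₁ + ψ₂) = B φ ψ₁ + B φ ψ₂ := fun φ ψ₁ ψ₂ => by
    simp only [hB, smul_add, R_add]; ring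
  have B_add' : ∀ φ₁ φ₂ ψ, B (φ₁ + φ₂) ψ = B φ₁ ψ + B φ₂ ψ := fun φ₁ φ₂ ψ => by
    simp only [hB]
    rw [R_symm (φ₁ + φ₂), R_symm (φ₁ + φ₂), R_add, R_add, R_symm φ₁, R_symm φ₁, R_symm φ₂,
      R_symm φ₂]
    ring
  have B_real : ∀ (c : ℝ) φ ψ, B φ ((c : ℂ) • ψ) = c * B φ ψ := fun c φ ψ => by
    simp only [hB]
    rw [smul_comm, R_smul, R_smul]; ring
  have B_real' : ∀ (c : ℝ) φ ψ, B ((c : ℂ) • φ) ψ = c * B φ ψ := fun c φ ψ => by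
    simp only [hB]
    rw [R_symm, R_symm _ (Complex.I • ψ), R_smul, R_smul, R_symm φ, R_symm φ]; ring
  have B_I : ∀ φ ψ, B φ (Complex.I • ψ) = Complex.I * B φ ψ := fun φ ψ => by
    simp only [hB, hII, R_neg]
    linear_combination ((1 / 4) * R φ (Complex.I • ψ)) * Complex.I_mul_I
  have B_I' : ∀ φ ψ, B (Complex.I • φ) ψ = - Complex.I * B φ ψ := fun φ ψ => by
    simp only [hB, R_I, R_I']
    linear_combination (-(1 / 4) * R φ (Complex.I • ψ)) * Complex.I_mul_I
  have dec : ∀ (c : ℂ) (φ : E),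
      c • φ = (c.re : ℂ) • φ + (c.im : ℂ) • Complex.I • φ := fun c φ => by
    rw [smul_smul, ← add_smul, Complex.re_add_im]
  let Bl : E →ₗ⋆[ℂ] E →ₗ[ℂ] ℂ := LinearMap.mk₂'ₛₗ (starRingEnd ℂ) (RingHom.id ℂ) B B_add'
    (fun c φ ψ => by
      conv_lhs => rw [dec c φ, B_add', B_real', B_real', B_I']
      have : (starRingEnd ℂ) c = c.re - c.im * Complex.I := by
        apply Complex.ext <;> simp
      rw [this, smul_eq_mul]; ring)
    B_add
    (fun c φ ψ => by
      conv_lhs => rw [dec c ψ, B_add, B_real, B_real, B_I]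
      conv_rhs => rw [RingHom.id_apply, smul_eq_mul, ← Complex.re_add_im c]
      ring)
  have B_bd : ∀ φ ψ, ‖B φ ψ‖ ≤ C * (‖φ‖ ^ 2 + ‖ψ‖ ^ 2) := fun φ ψ => by
    have hRb : ∀ φ ψ, ‖R φ ψ‖ ≤ 2 * C * (‖φ‖ ^ 2 + ‖ψ‖ ^ 2) := fun φ ψ => by
      have h := parallelogram_law_with_norm ℂ φ ψ
      have h1 := norm_sub_le (Q (φ + ψ)) (Q (φ - ψ))
      have h2 := hQb (φ + ψ)
      have h3 := hQb (φ - ψ)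
      simp only [hR]
      nlinarith
    have h1 := hRb φ ψ
    have h2 := hRb φ (Complex.I • ψ)
    rw [norm_smul, Complex.norm_I, one_mul] at h2
    simp only [hB]
    rw [norm_div]
    have h3 := norm_sub_le (R φ ψ) (Complex.I * R φ (Complex.I • ψ))
    rw [norm_mul, Complex.norm_I, one_mul] at h3
    have : ‖(4 : ℂ)‖ = 4 := by norm_num
    rw [this]
    linarith
  have B_bd' : ∀ φ ψ, ‖Bl φ ψ‖ ≤ 2 * C * ‖φ‖ * ‖ψ‖ := fun φ ψ => by
    change ‖B φ ψ‖ ≤ _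
    rcases eq_or_ne φ 0 with rfl | hφ
    · have : B 0 ψ = 0 := by simpa using B_real' 0 0 ψ
      simp [this]
    rcases eq_or_ne ψ 0 with rfl | hψ
    · have : B φ 0 = 0 := by simpa using B_real 0 φ 0
      simp [this]
    have hφ' := norm_pos_iff.2 hφ
    have hψ' := norm_pos_iff.2 hψ
    have h := B_bd (((‖φ‖⁻¹ : ℝ) : ℂ) • φ) (((‖ψ‖⁻¹ : ℝ) : ℂ) • ψ)
    rw [B_real, B_real', norm_mul, norm_mul, norm_smul, norm_smul] at h
    simp only [Complex.norm_real, norm_inv, norm_norm] at h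
    rw [inv_mul_cancel₀ hφ'.ne', inv_mul_cancel₀ hψ'.ne'] at h
    have h4 : ‖B φ ψ‖ = ‖φ‖ * ‖ψ‖ * (‖ψ‖⁻¹ * (‖φ‖⁻¹ * ‖B φ ψ‖)) := by
      field_simp
    rw [h4]
    have := mul_le_mul_of_nonneg_left h (mul_pos hφ' hψ').le
    linarith
  let Bc : E →L⋆[ℂ] E →L[ℂ] ℂ := LinearMap.mkContinuous₂ Bl (2 * C) B_bd'
  refine ⟨ContinuousLinearMap.adjoint (InnerProductSpace.continuousLinearMapOfBilin Bc), fun ψ => ?_⟩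
  rw [ContinuousLinearMap.adjoint_inner_right,
    InnerProductSpace.continuousLinearMapOfBilin_apply]
  change B ψ ψ = Q ψ
  simp only [hB, R_self, R_self_I]
  ring

open scoped Classical in
/-- The Borel functional calculus of a bounded self-adjoint operator: `g(T)` is the unique bounded
operator `S` with `⟨ψ, S ψ⟩ = ∫ g dμ_ψ` for all `ψ`. -/
def borelCalculus (T : E →L[ℂ] E) (g : ℝ → ℂ) : E →L[ℂ] E :=
  if h : ∃ S : E →L[ℂ] E, ∀ ψ, ⟪ψ, S ψ⟫_ℂ = ∫ x, g x ∂(spectralMeasure T ψ) then h.choose else 0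

/-- The defining property of `g(T)` holds for every bounded Borel function `g`. -/
theorem inner_borelCalculus (T : E →L[ℂ] E) {g : ℝ → ℂ} (hg : Measurable g) {C : ℝ}
    (hC : ∀ x, ‖g x‖ ≤ C) (ψ : E) :
    ⟪ψ, borelCalculus T g ψ⟫_ℂ = ∫ x, g x ∂(spectralMeasure T ψ) := by
  have h := exists_borelCalculus T hg hC
  rw [borelCalculus, dif_pos h]
  exact h.choose_spec ψ

/-- The absolutely continuous subspace of `T`: the vectors whose spectral measure is absolutely
continuous with respect to Lebesgue measure. -/
def acVectors (T : E →L[ℂ] E) : Set E :=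
  {ψ | spectralMeasure T ψ ≪ volume}

/-- The absolutely continuous spectrum `σ_ac(T)`: the spectrum of the restriction of `T` to its
absolutely continuous subspace, which is closed and invariant. By the bounded inverse theorem, `x` is
outside this spectrum if and only if `T - x` maps that subspace bijectively onto itself. -/
def acSpectrum (T : E →L[ℂ] E) : Set ℝ :=
  {x | ¬ Set.BijOn (fun φ => T φ - (x : ℂ) • φ) (acVectors T) (acVectors T)}

/-- `T` has purely absolutely continuous spectrum on `S`: `S` lies in the absolutely continuous spectrum
of `T`, and no vector has a spectral measure with a singular part on `S`. -/
def IsPurelyACOn (T : E →L[ℂ] E) (S : Set ℝ) : Prop :=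
  S ⊆ acSpectrum T ∧ ∀ ψ, (spectralMeasure T ψ).restrict S ≪ volume

/-- The time-averaged quantum return probability `(1/t) ∫₀ᵗ |⟨ψ, e^{-isT} ψ⟩|² ds`. -/
def returnAverage (T : E →L[ℂ] E) (ψ : E) (t : ℝ) : ℝ :=
  (1 / t) * ∫ s in (0 : ℝ)..t, ‖⟪ψ, NormedSpace.exp ((-(Complex.I * (s : ℂ))) • T) ψ⟫_ℂ‖ ^ 2

end Spectral

/-- `μ` is `α`-Hölder continuous: `μ(I) ≤ γ |I|^α` for all intervals `I` of length less than one. -/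
def IsHolderMeasure (α : ℝ) (μ : Measure ℝ) : Prop :=
  ∃ γ : ℝ, 0 < γ ∧ ∀ I : Set ℝ, I.OrdConnected → volume I < 1 →
    μ I ≤ ENNReal.ofReal γ * volume I ^ α

open scoped Classical in
/-- A continuous function on `[-2,2]`, extended by zero to a bounded Borel function on `ℝ`. -/
def extendByZero (f : C(Set.Icc (-2 : ℝ) 2, ℂ)) (x : ℝ) : ℂ :=
  if h : x ∈ Set.Icc (-2 : ℝ) 2 then f ⟨x, h⟩ else 0

theorem norm_extendByZero_le (f : C(Set.Icc (-2 : ℝ) 2, ℂ)) (x : ℝ) : ‖extendByZero f x‖ ≤ ‖f‖ := by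
  unfold extendByZero
  split_ifs
  · exact f.norm_coe_le_norm _
  · simp

theorem measurable_extendByZero (f : C(Set.Icc (-2 : ℝ) 2, ℂ)) : Measurable (extendByZero f) :=
  Measurable.dite f.continuous.measurable measurable_const measurableSet_Icc

/-- The Hilbert space `ℓ²(ℤ⁺)`. -/
abbrev HalfLineSpace : Type := lp (fun _ : ℕ+ => ℂ) 2

/-- The first vector of the canonical basis. -/
def delta1 : HalfLineSpace := lp.single 2 1 1

/-- The extension of `u : ℤ⁺ → ℂ` to `n = 0` that satisfies the boundary condition
`u(0) cos β + u(1) sin β = 0`, for `cos β ≠ 0`. -/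
def boundaryExtension (β : ℝ) (u : ℕ+ → ℂ) (n : ℕ) : ℂ :=
  if h : 0 < n then u ⟨n, h⟩ else -(Real.tan β : ℂ) * u 1

theorem boundaryExtension_condition {β : ℝ} (hβ : Real.cos β ≠ 0) (u : ℕ+ → ℂ) :
    boundaryExtension β u 0 * (Real.cos β : ℂ) + boundaryExtension β u 1 * (Real.sin β : ℂ) = 0 := by
  have h : (Real.cos β : ℂ) ≠ 0 := by exact_mod_cast hβ
  change -(Real.tan β : ℂ) * u 1 * (Real.cos β : ℂ) + u 1 * (Real.sin β : ℂ) = 0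
  rw [Real.tan_eq_sin_div_cos, Complex.ofReal_div, neg_mul, neg_mul, mul_right_comm,
    div_mul_cancel₀ _ h]
  ring

theorem boundaryExtension_add (β : ℝ) (u v : ℕ+ → ℂ) (n : ℕ) :
    boundaryExtension β (u + v) n =
      boundaryExtension β u n + boundaryExtension β v n := by
  unfold boundaryExtension
  split_ifs
  · rfl
  · rw [Pi.add_apply]; ring

theorem boundaryExtension_smul (β : ℝ) (c : ℂ) (u : ℕ+ → ℂ) (n : ℕ) :
    boundaryExtension β (c • u) n = c * boundaryExtension β u n := by
  unfold boundaryExtension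
  split_ifs
  · rfl
  · rw [Pi.smul_apply, smul_eq_mul]; ring

theorem summable_boundaryExtension (β : ℝ) (u : HalfLineSpace) :
    Summable fun n : ℕ => ‖boundaryExtension β u n‖ ^ (2 : ENNReal).toReal := by
  rw [← summable_nat_add_iff 1]
  have := (memℓp_gen_iff (by norm_num : 0 < (2 : ENNReal).toReal)).1 (lp.memℓp u)
  refine (Equiv.pnatEquivNat.symm.summable_iff.2 this).congr fun n => ?_
  simp [boundaryExtension, Nat.succPNat]

/-- `u(n+1) + u(n-1) + V(n) u(n)` for `n ≥ 1`, with `u(0)` given by the boundary condition. -/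
def halfLineAction (β : ℝ) (V : ℕ+ → ℝ) (u : ℕ+ → ℂ) (n : ℕ+) : ℂ :=
  boundaryExtension β u (n + 1) + boundaryExtension β u (n - 1) + (V n : ℂ) * u n

theorem memlp_halfLineAction (β : ℝ) (V : lp (fun _ : ℕ+ => ℝ) ⊤) (u : HalfLineSpace) :
    Memℓp (halfLineAction β V u) 2 := by
  have h2 : 0 < (2 : ENNReal).toReal := by norm_num
  have hcomp : ∀ e : ℕ+ → ℕ, Function.Injective e →
      Memℓp (fun n => boundaryExtension β u (e n)) 2 := fun e he =>
    memℓp_gen ((summable_boundaryExtension β u).comp_injective he)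
  refine Memℓp.add (Memℓp.add (hcomp (fun n => n + 1) ?_) (hcomp (fun n => n - 1) ?_)) ?_
  · exact fun m n h => PNat.coe_injective (by simpa using h)
  · intro m n h
    have := m.pos
    have := n.pos
    exact PNat.coe_injective (by simp only at h; omega)
  · refine (memℓp_gen_iff h2).2 (Summable.of_nonneg_of_le (fun n => by positivity) (fun n => ?_)
      (((memℓp_gen_iff h2).1 (lp.memℓp u)).mul_left (‖V‖ ^ (2 : ENNReal).toReal)))
    rw [norm_mul, ← Real.mul_rpow (norm_nonneg _) (norm_nonneg _), Complex.norm_real]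
    gcongr
    exact lp.norm_apply_le_norm ENNReal.top_ne_zero V n

/-- The half-line Schrödinger operator as a linear map. -/
def halfLineLinear (β : ℝ) (V : lp (fun _ : ℕ+ => ℝ) ⊤) : HalfLineSpace →ₗ[ℂ] HalfLineSpace where
  toFun u := ⟨halfLineAction β V u, memlp_halfLineAction β V u⟩
  map_add' u v := by
    ext n
    simp only [halfLineAction, lp.coeFn_add, boundaryExtension_add, Pi.add_apply]
    ring
  map_smul' c u := by
    ext n
    simp only [halfLineAction, boundaryExtension_smul, lp.coeFn_smul, Pi.smul_apply, smul_eq_mul,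
      RingHom.id_apply]
    ring

theorem continuous_halfLineLinear (β : ℝ) (V : lp (fun _ : ℕ+ => ℝ) ⊤) :
    Continuous (halfLineLinear β V) := by
  have hc : ∀ n : ℕ+, Continuous fun u : HalfLineSpace => u n := fun n =>
    (lp.evalCLM ℂ (fun _ : ℕ+ => ℂ) 2 n).continuous
  have hb : ∀ n : ℕ, Continuous fun u : HalfLineSpace => boundaryExtension β u n := fun n => by
    unfold boundaryExtension
    split_ifs
    · exact hc _
    · exact continuous_const.mul (hc 1)
  refine LinearMap.continuous_of_seq_closed_graph _ fun u x y hu hy => ?_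
  ext n
  refine tendsto_nhds_unique (((hc n).tendsto y).comp hy) ?_
  exact ((((hb _).add (hb _)).add (continuous_const.mul (hc n))).tendsto x).comp hu

/-- The half-line Schrödinger operator `Δ + V` on `ℓ²(ℤ⁺)` with the boundary condition
`u(0) cos β + u(1) sin β = 0`, where `-π/2 < β < π/2` and `V ∈ ℓ^∞(ℤ⁺, ℝ)`. The Dirichlet condition
`u(0) = 0` is `β = 0`. -/
def halfLineSchrodinger (β : ℝ) (V : lp (fun _ : ℕ+ => ℝ) ⊤) : HalfLineSpace →L[ℂ] HalfLineSpace :=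
  ⟨halfLineLinear β V, continuous_halfLineLinear β V⟩

theorem isSelfAdjoint_halfLineSchrodinger (β : ℝ) (V : lp (fun _ : ℕ+ => ℝ) ⊤) :
    IsSelfAdjoint (halfLineSchrodinger β V) := by
  rw [ContinuousLinearMap.isSelfAdjoint_iff_isSymmetric]
  intro u v
  let D : ℕ → ℂ := fun n =>
    (starRingEnd ℂ) (boundaryExtension β u (n + 1)) * boundaryExtension β v n -
      (starRingEnd ℂ) (boundaryExtension β u n) * boundaryExtension β v (n + 1)
  have hlim : ∀ w : HalfLineSpace, Filter.Tendsto (boundaryExtension β w) Filter.atTop (nhds 0) := by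
    intro w
    have h := (summable_boundaryExtension β w).tendsto_atTop_zero.sqrt
    rw [Real.sqrt_zero] at h
    rw [tendsto_zero_iff_norm_tendsto_zero]
    refine h.congr fun n => ?_
    rw [ENNReal.toReal_ofNat, Real.rpow_two, Real.sqrt_sq (norm_nonneg _)]
  have hlim' := fun w => (hlim w).comp (Filter.tendsto_add_atTop_nat 1)
  have hconj : ∀ w : ℕ → ℂ, Filter.Tendsto w Filter.atTop (nhds 0) →
      Filter.Tendsto (fun n => (starRingEnd ℂ) (w n)) Filter.atTop (nhds 0) := fun w hw => by
    have h := (Complex.continuous_conj.tendsto 0).comp hw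
    rwa [map_zero] at h
  have hD : Filter.Tendsto D Filter.atTop (nhds 0) := by
    simpa using ((hconj _ (hlim' u)).mul (hlim v)).sub ((hconj _ (hlim u)).mul (hlim' v))
  have hD0 : D 0 = 0 := by
    simp [D, boundaryExtension, -Complex.ofReal_tan]
    ring
  have hsum := Equiv.pnatEquivNat.symm.hasSum_iff.2
    ((lp.hasSum_inner (𝕜 := ℂ) (halfLineSchrodinger β V u) v).sub
      (lp.hasSum_inner (𝕜 := ℂ) u (halfLineSchrodinger β V v)))
  have hterm : ∀ k : ℕ, ⟪halfLineSchrodinger β V u k.succPNat, v k.succPNat⟫_ℂ -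
      ⟪u k.succPNat, halfLineSchrodinger β V v k.succPNat⟫_ℂ = D (k + 1) - D k := by
    intro k
    have e : ∀ w : HalfLineSpace, halfLineSchrodinger β V w k.succPNat =
      boundaryExtension β w (k + 1 + 1) + boundaryExtension β w k +
        (V k.succPNat : ℂ) * boundaryExtension β w (k + 1) := fun w => rfl
    have e' : ∀ w : HalfLineSpace, w k.succPNat = boundaryExtension β w (k + 1) := fun w => rfl
    rw [e, e, e', e', RCLike.inner_apply, RCLike.inner_apply]
    simp only [D, map_add, map_mul, Complex.conj_ofReal]
    ring
  have h1 := hsum.tendsto_sum_nat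
  have h3 := tendsto_nhds_unique (h1.congr fun N => (Finset.sum_congr rfl fun k _ => hterm k).trans
    ((Finset.sum_range_sub D N).trans (by rw [hD0, sub_zero]))) hD
  exact sub_eq_zero.1 h3

/-- The vector `f(H) δ₁` for `f ∈ C([-2,2])`. As `H` may have spectrum outside `[-2,2]`, the function
`f` is taken to be zero there. -/
def stateOf (H : HalfLineSpace →L[ℂ] HalfLineSpace) (f : C(Set.Icc (-2 : ℝ) 2, ℂ)) :
    HalfLineSpace :=
  borelCalculus H (extendByZero f) delta1

end HalfLine

end

/-!
Both halves of the theorem follow from an explicit formula for the spectral density of `δ₁`, which is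
cyclic, so that the operator is unitarily equivalent to the multiplication by `x` on `L²(μ)` with
`μ = μ_{δ₁}` (`exists_spectralRepresentation`).

Write the energy as `ζ + ζ⁻¹` with `|ζ| ≤ 1`. Since `∑ n |b(n)|` is finite, for small `κ` the Volterra
equation of the Jost solution `u(n) ∼ ζ ^ n` is solved by a contraction, continuously up to the unit
circle (`exists_isJostFamily`). For `|ζ| < 1` the vector `u` is square summable, and the resolvent maps
`δ₁` to `-u / F` with the Jost function `F = u(0) + tan β u(1)`; hence the Stieltjes transform of `μ` is
`-u(1) / F` (`integral_inv_sub_eq`). On the circle the Wronskian of `u` and its conjugate gives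
`Im (u(1) conj F) = Im ζ`. So `F` has no zeros there except possibly `±1`, the transform has continuous
boundary values, and Stieltjes inversion yields the density `√(4 - x²) / (2π |F|²)` on `(-2, 2)`. There
are no atoms at `±2`, as no solution decays at those energies (`exists_spectralDensity`).

The same Wronskian identity gives `|Im ζ| ≤ C |F|`, hence a density of at most a constant times
`(4 - x²)^(-1/2)` for every boundary condition. For the Dirichlet condition `F` is close to `1` and the
density is bounded. The density is positive, which gives the purely absolutely continuous spectrum
(`isPurelyACOn_of_density`). The spectral measure of `f(H) δ₁` is `|f|² μ` on `[-2, 2]`, so the Hölder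
bounds are integrals of the density. The return probabilities are Fourier transforms of the measure, and
their time averages are controlled by a Plancherel inequality
(`intervalIntegral_norm_measureFourier_sq_le`): directly if the density is bounded, and with a logarithm
from cutting off the inverse square root at distance `1 / t` from the edges otherwise
(`exists_integral_norm_measureFourier_sq_le_log`).
-/

namespace HalfLine

open Filter Topology
open scoped BoundedContinuousFunction

/-! ### Existence of Jost solutions -/

/-- The kernel `(1 - ζ ^ (2 k)) / (ζ - ζ⁻¹)` of the Volterra equation of the Jost solution, in the
polynomial form that is also valid at `ζ = 0` and `ζ = ±1`. -/
def jostKernel (ζ : ℂ) (k : ℕ) : ℂ := -ζ * ∑ j ∈ Finset.range k, (ζ ^ 2) ^ j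

theorem jostKernel_zero (ζ : ℂ) : jostKernel ζ 0 = 0 := by simp [jostKernel]

theorem jostKernel_one (ζ : ℂ) : jostKernel ζ 1 = -ζ := by simp [jostKernel]

theorem jostKernel_rec (ζ : ℂ) (k : ℕ) :
    ζ ^ 2 * (jostKernel ζ k - jostKernel ζ (k + 1)) +
      (jostKernel ζ (k + 2) - jostKernel ζ (k + 1)) = 0 := by
  simp only [jostKernel, Finset.sum_range_succ]
  ring

theorem norm_jostKernel_le {ζ : ℂ} (hζ : ‖ζ‖ ≤ 1) (k : ℕ) : ‖jostKernel ζ k‖ ≤ k := by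
  rw [jostKernel, norm_mul, norm_neg]
  have h1 : ‖∑ j ∈ Finset.range k, (ζ ^ 2) ^ j‖ ≤ k := by
    refine (norm_sum_le _ _).trans ?_
    refine (Finset.sum_le_card_nsmul _ _ 1 fun j _ => ?_).trans (by simp)
    rw [norm_pow, norm_pow]
    exact pow_le_one₀ (by positivity) (pow_le_one₀ (norm_nonneg _) hζ)
  calc ‖ζ‖ * _ ≤ 1 * (k : ℝ) := by gcongr
    _ = k := one_mul _

theorem norm_jostKernel_sub_le {ζ : ℂ} (hζ : ‖ζ‖ ≤ 1) (m n : ℕ) :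
    ‖jostKernel ζ (m - n)‖ ≤ m :=
  (norm_jostKernel_le hζ _).trans (by exact_mod_cast Nat.sub_le m n)

theorem continuous_jostKernel (k : ℕ) : Continuous fun ζ => jostKernel ζ k := by
  unfold jostKernel; fun_prop

section Volterra

variable {V : ℕ → ℝ}

theorem norm_jostKernel_mul_le {ζ : ℂ} (hζ : ‖ζ‖ ≤ 1) {C : ℝ} (m n : ℕ) {c : ℂ} (hc : ‖c‖ ≤ C) :
    ‖jostKernel ζ (m - n) * V m * c‖ ≤ m * |V m| * C := by
  rw [norm_mul, norm_mul, Complex.norm_real, Real.norm_eq_abs]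
  have := norm_jostKernel_sub_le hζ m n
  gcongr

/-- One step of the Volterra iteration for the Jost solution, as a map on bounded continuous functions
of the site `n` and the spectral parameter `ζ` in the closed unit disc. The truncated subtraction
restricts the sum to `m > n`. -/
noncomputable def jostStep (hV : Summable fun m : ℕ => (m : ℝ) * |V m|)
    (φ : BoundedContinuousFunction (ℕ × Metric.closedBall (0 : ℂ) 1) ℂ) :
    BoundedContinuousFunction (ℕ × Metric.closedBall (0 : ℂ) 1) ℂ :=
  BoundedContinuousFunction.ofNormedAddCommGroup
    (fun p => 1 + ∑' m : ℕ, jostKernel p.2 (m - p.1) * V m * φ (m, p.2))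
    (by
      rw [continuous_prod_of_discrete_left]
      intro n
      refine continuous_const.add (continuous_tsum (fun m => ?_) (hV.mul_right ‖φ‖) fun m ζ => ?_)
      · have h1 := (continuous_jostKernel (m - n)).comp
          (continuous_subtype_val (p := fun ζ : ℂ => ζ ∈ Metric.closedBall (0 : ℂ) 1))
        have h2 : Continuous fun ζ : Metric.closedBall (0 : ℂ) 1 => φ (m, ζ) := by fun_prop
        exact (h1.mul continuous_const).mul h2
      · exact norm_jostKernel_mul_le (mem_closedBall_zero_iff.1 ζ.2) m n (φ.norm_coe_le_norm _))
    (1 + (∑' m : ℕ, (m : ℝ) * |V m|) * ‖φ‖)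
    (fun p => by
      refine (norm_add_le _ _).trans ?_
      rw [norm_one, ← tsum_mul_right]
      gcongr
      exact tsum_of_norm_bounded (hV.mul_right ‖φ‖).hasSum fun m =>
        norm_jostKernel_mul_le (mem_closedBall_zero_iff.1 p.2.2) m p.1 (φ.norm_coe_le_norm _))

theorem jostStep_apply (hV : Summable fun m : ℕ => (m : ℝ) * |V m|)
    (φ : BoundedContinuousFunction (ℕ × Metric.closedBall (0 : ℂ) 1) ℂ) (p) :
    jostStep hV φ p = 1 + ∑' m : ℕ, jostKernel p.2 (m - p.1) * V m * φ (m, p.2) := rfl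

theorem summable_jostKernel_mul (hV : Summable fun m : ℕ => (m : ℝ) * |V m|) {ζ : ℂ} (hζ : ‖ζ‖ ≤ 1)
    (n : ℕ) {φ : ℕ → ℂ} {C : ℝ} (hφ : ∀ m, ‖φ m‖ ≤ C) :
    Summable fun m : ℕ => jostKernel ζ (m - n) * V m * φ m :=
  Summable.of_norm_bounded (hV.mul_right C) fun m => norm_jostKernel_mul_le hζ m n (hφ m)

theorem contracting_jostStep (hV : Summable fun m : ℕ => (m : ℝ) * |V m|)
    (hS : ∑' m : ℕ, (m : ℝ) * |V m| ≤ 1 / 4) : ContractingWith (1 / 4) (jostStep hV) := by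
  refine ⟨by rw [← NNReal.coe_lt_coe]; norm_num, LipschitzWith.of_dist_le_mul fun φ ψ => ?_⟩
  rw [BoundedContinuousFunction.dist_le (by positivity)]
  intro p
  have hp := mem_closedBall_zero_iff.1 p.2.2
  rw [dist_eq_norm, jostStep_apply, jostStep_apply, add_sub_add_left_eq_sub,
    ← (summable_jostKernel_mul hV hp p.1 fun m => φ.norm_coe_le_norm (m, p.2)).tsum_sub
      (summable_jostKernel_mul hV hp p.1 fun m => ψ.norm_coe_le_norm (m, p.2))]
  refine (tsum_of_norm_bounded (hV.mul_right (dist φ ψ)).hasSum fun m => ?_).trans ?_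
  · rw [← mul_sub]
    refine norm_jostKernel_mul_le hp m p.1 ?_
    rw [← dist_eq_norm]
    exact BoundedContinuousFunction.dist_coe_le_dist _
  · rw [tsum_mul_right]
    simp only [NNReal.coe_div, NNReal.coe_one, NNReal.coe_ofNat]
    gcongr

/-- `φ n ζ` is the Jost solution at the energy `ζ + ζ⁻¹` divided by `ζ ^ n`, for `ζ` in the closed unit
disc. In terms of `φ` the equation and the bounds have no singularity at `ζ = 0`. -/
structure IsJostFamily (V : ℕ → ℝ) (φ : ℕ → ℂ → ℂ) : Prop where
  continuousOn : ∀ n, ContinuousOn (φ n) (Metric.closedBall 0 1)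
  norm_sub_one_le : ∀ n ζ, ‖ζ‖ ≤ 1 → ‖φ n ζ - 1‖ ≤ 1 / 3
  tendsto_one : ∀ ζ, ‖ζ‖ ≤ 1 → Tendsto (fun n => φ n ζ) atTop (𝓝 1)
  recurrence : ∀ n ζ, ‖ζ‖ ≤ 1 → ζ ^ 2 * (φ (n + 2) ζ - φ (n + 1) ζ) + (φ n ζ - φ (n + 1) ζ) +
    ζ * V (n + 1) * φ (n + 1) ζ = 0

/-- The Jost solution of a small potential is the fixed point of the contraction `jostStep`. The
recurrence holds term by term in the Volterra series. -/
theorem exists_isJostFamily (hV : Summable fun m : ℕ => (m : ℝ) * |V m|)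
    (hS : ∑' m : ℕ, (m : ℝ) * |V m| ≤ 1 / 4) : ∃ φ, IsJostFamily V φ := by
  have hc := contracting_jostStep hV hS
  set Φ := hc.fixedPoint with hΦ
  have hfix : jostStep hV Φ = Φ := hc.fixedPoint_isFixedPt
  have heq : ∀ n (ζ : Metric.closedBall (0 : ℂ) 1),
      Φ (n, ζ) = 1 + ∑' m : ℕ, jostKernel ζ (m - n) * V m * Φ (m, ζ) := fun n ζ => by
    conv_lhs => rw [← hfix]
    rfl
  have hsub : ∀ p, ‖Φ p - 1‖ ≤ 1 / 4 * ‖Φ‖ := by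
    rintro ⟨n, ζ⟩
    rw [heq, add_sub_cancel_left]
    refine (tsum_of_norm_bounded (hV.mul_right ‖Φ‖).hasSum fun m => norm_jostKernel_mul_le
      (mem_closedBall_zero_iff.1 ζ.2) m n (Φ.norm_coe_le_norm _)).trans ?_
    rw [tsum_mul_right]
    gcongr
  have hnorm : ‖Φ‖ ≤ 4 / 3 := by
    have : ‖Φ‖ ≤ 1 + 1 / 4 * ‖Φ‖ := by
      refine (BoundedContinuousFunction.norm_le (by positivity)).2 fun p => ?_
      have h1 := norm_add_le (1 : ℂ) (Φ p - 1)
      rw [add_sub_cancel, norm_one] at h1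
      linarith [hsub p]
    linarith
  classical
  refine ⟨fun n ζ => if h : ζ ∈ Metric.closedBall (0 : ℂ) 1 then Φ (n, ⟨ζ, h⟩) else 0, ?_, ?_, ?_, ?_⟩
  · intro n
    rw [continuousOn_iff_continuous_domRestrict]
    have : Continuous fun ζ : Metric.closedBall (0 : ℂ) 1 => Φ (n, ζ) := by fun_prop
    refine this.congr fun ζ => ?_
    simp [mem_closedBall_zero_iff.1 ζ.2]
  · intro n ζ hζ
    simp only [mem_closedBall_zero_iff, hζ, dif_pos]
    linarith [hsub (n, ⟨ζ, mem_closedBall_zero_iff.2 hζ⟩)]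
  · intro ζ hζ
    simp only [mem_closedBall_zero_iff, hζ, dif_pos]
    have h0 : Tendsto (fun n : ℕ => ∑' m : ℕ, jostKernel ζ (m - n) * V m *
        Φ (m, ⟨ζ, mem_closedBall_zero_iff.2 hζ⟩)) atTop (𝓝 (∑' _ : ℕ, 0)) := by
      refine tendsto_tsum_of_dominated_convergence (hV.mul_right ‖Φ‖) (fun m => ?_)
        (Eventually.of_forall fun n m => norm_jostKernel_mul_le hζ m n (Φ.norm_coe_le_norm _))
      refine tendsto_const_nhds.congr' ?_
      filter_upwards [eventually_ge_atTop m] with n hn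
      rw [Nat.sub_eq_zero_of_le hn, jostKernel_zero, zero_mul, zero_mul]
    rw [tsum_zero] at h0
    have h1 := h0.const_add (1 : ℂ)
    rw [add_zero] at h1
    exact h1.congr fun n => (heq n _).symm
  · intro n ζ hζ
    simp only [mem_closedBall_zero_iff, hζ, dif_pos]
    set z : Metric.closedBall (0 : ℂ) 1 := ⟨ζ, mem_closedBall_zero_iff.2 hζ⟩
    have hs := fun k => (summable_jostKernel_mul hV hζ k fun m => Φ.norm_coe_le_norm (m, z)).hasSum
    have hsum := (((hs (n + 2)).sub (hs (n + 1))).mul_left (ζ ^ 2)).add ((hs n).sub (hs (n + 1)))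
    have hsingle : HasSum (fun m => if m = n + 1 then -(ζ * V (n + 1) * Φ (n + 1, z)) else 0)
        (-(ζ * V (n + 1) * Φ (n + 1, z))) := hasSum_ite_eq _ _
    have := hsum.unique (hsingle.congr_fun fun m => ?_)
    · rw [heq (n + 2), heq n]
      conv_lhs => enter [1]; rw [heq (n + 1)]
      linear_combination this
    · rcases lt_trichotomy m (n + 1) with h | rfl | h
      · rw [if_neg h.ne, Nat.sub_eq_zero_of_le (by omega : m ≤ n + 2),
          Nat.sub_eq_zero_of_le (by omega : m ≤ n + 1), Nat.sub_eq_zero_of_le (by omega : m ≤ n)]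
        simp [jostKernel_zero]
      · rw [if_pos rfl, Nat.sub_eq_zero_of_le (by omega : n + 1 ≤ n + 2), Nat.sub_self,
          Nat.add_sub_cancel_left, jostKernel_zero, jostKernel_one]
        ring
      · obtain ⟨k, rfl⟩ := Nat.exists_eq_add_of_lt h
        rw [if_neg h.ne', (by omega : n + 1 + k + 1 - (n + 2) = k),
          (by omega : n + 1 + k + 1 - (n + 1) = k + 1), (by omega : n + 1 + k + 1 - n = k + 2)]
        linear_combination (V (n + 1 + k + 1) * Φ (n + 1 + k + 1, z)) * jostKernel_rec ζ k

end Volterra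

/-! ### The Wronskian and bounds for the Jost function -/

/-- The Jost solution `u(n) = ζⁿ φ(n, ζ)`. -/
def jostSol (φ : ℕ → ℂ → ℂ) (n : ℕ) (ζ : ℂ) : ℂ := ζ ^ n * φ n ζ

/-- The Jost function `u(0) + t u(1)` of the boundary condition with `t = tan β`. It vanishes exactly
when the Jost solution satisfies the boundary condition. -/
def jostFun (φ : ℕ → ℂ → ℂ) (t : ℝ) (ζ : ℂ) : ℂ := jostSol φ 0 ζ + t * jostSol φ 1 ζ

namespace IsJostFamily

variable {V : ℕ → ℝ} {φ : ℕ → ℂ → ℂ} (h : IsJostFamily V φ)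
include h

theorem norm_le {n : ℕ} {ζ : ℂ} (hζ : ‖ζ‖ ≤ 1) : ‖φ n ζ‖ ≤ 4 / 3 := by
  have h1 := norm_add_le (1 : ℂ) (φ n ζ - 1)
  rw [add_sub_cancel, norm_one] at h1
  linarith [h.norm_sub_one_le n ζ hζ]

theorem norm_jostSol_le {n : ℕ} {ζ : ℂ} (hζ : ‖ζ‖ ≤ 1) : ‖jostSol φ n ζ‖ ≤ 4 / 3 * ‖ζ‖ ^ n := by
  rw [jostSol, norm_mul, norm_pow, mul_comm]
  gcongr
  exact h.norm_le hζ

theorem jostSol_recurrence {ζ : ℂ} (hζ : ‖ζ‖ ≤ 1) (hζ0 : ζ ≠ 0) (n : ℕ) :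
    jostSol φ (n + 2) ζ + jostSol φ n ζ + V (n + 1) * jostSol φ (n + 1) ζ =
      (ζ + ζ⁻¹) * jostSol φ (n + 1) ζ := by
  have := h.recurrence n ζ hζ
  simp only [jostSol, pow_succ]
  have h2 : ζ⁻¹ * ζ = 1 := inv_mul_cancel₀ hζ0
  linear_combination (ζ ^ n) * this - ζ ^ n * φ (n + 1) ζ * h2

theorem continuousOn_jostSol (n : ℕ) : ContinuousOn (jostSol φ n) (Metric.closedBall 0 1) :=
  (continuous_pow n).continuousOn.mul (h.continuousOn n)

theorem continuousOn_jostFun (t : ℝ) : ContinuousOn (jostFun φ t) (Metric.closedBall 0 1) :=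
  (h.continuousOn_jostSol 0).add (continuousOn_const.mul (h.continuousOn_jostSol 1))

/-- On the unit circle the energy is real, so the Wronskian of the Jost solution and its conjugate is
constant. Its value is found at infinity. -/
theorem im_jostSol_mul_conj {ζ : ℂ} (hζ : ‖ζ‖ = 1) (n : ℕ) :
    (jostSol φ (n + 1) ζ * starRingEnd ℂ (jostSol φ n ζ)).im = ζ.im := by
  have hζ0 : ζ ≠ 0 := by rintro rfl; simp at hζ
  have hinv : ζ⁻¹ = starRingEnd ℂ ζ := Complex.inv_eq_conj hζ
  have hstep : ∀ n, (jostSol φ (n + 1 + 1) ζ * starRingEnd ℂ (jostSol φ (n + 1) ζ)).im =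
      (jostSol φ (n + 1) ζ * starRingEnd ℂ (jostSol φ n ζ)).im := fun n => by
    have h1 := h.jostSol_recurrence hζ.le hζ0 n
    rw [hinv, Complex.add_conj] at h1
    have h2 : jostSol φ (n + 1 + 1) ζ = ((2 * ζ.re - V (n + 1) : ℝ) : ℂ) * jostSol φ (n + 1) ζ -
        jostSol φ n ζ := by push_cast at h1 ⊢; linear_combination h1
    rw [h2]
    simp only [Complex.mul_im, Complex.mul_re, Complex.sub_re, Complex.sub_im, Complex.conj_re,
      Complex.conj_im, Complex.ofReal_re, Complex.ofReal_im]
    ring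
  have hconst : ∀ n, (jostSol φ (n + 1) ζ * starRingEnd ℂ (jostSol φ n ζ)).im =
      (jostSol φ 1 ζ * starRingEnd ℂ (jostSol φ 0 ζ)).im := fun n => by
    induction n with
    | zero => rfl
    | succ k ih => rw [hstep, ih]
  have hform : ∀ n, jostSol φ (n + 1) ζ * starRingEnd ℂ (jostSol φ n ζ) =
      ζ * (φ (n + 1) ζ * starRingEnd ℂ (φ n ζ)) := fun n => by
    have h3 : ζ ^ n * starRingEnd ℂ ζ ^ n = 1 := by
      rw [← mul_pow, ← hinv, mul_inv_cancel₀ hζ0, one_pow]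
    simp only [jostSol, map_mul, map_pow, pow_succ]
    linear_combination (ζ * φ (n + 1) ζ * starRingEnd ℂ (φ n ζ)) * h3
  have ht := h.tendsto_one ζ hζ.le
  have hlim : Tendsto (fun n => (jostSol φ (n + 1) ζ * starRingEnd ℂ (jostSol φ n ζ)).im) atTop
      (𝓝 (ζ * (1 * starRingEnd ℂ 1)).im) := by
    simp only [hform]
    exact (Complex.continuous_im.tendsto _).comp (tendsto_const_nhds.mul
      ((ht.comp (tendsto_add_atTop_nat 1)).mul ((Complex.continuous_conj.tendsto 1).comp ht)))
  rw [map_one, mul_one, mul_one] at hlim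
  rw [hconst]
  exact tendsto_nhds_unique (tendsto_const_nhds.congr fun n => (hconst n).symm) hlim

theorem im_jostSol_mul_conj_jostFun {ζ : ℂ} (hζ : ‖ζ‖ = 1) (t : ℝ) :
    (jostSol φ 1 ζ * starRingEnd ℂ (jostFun φ t ζ)).im = ζ.im := by
  rw [← h.im_jostSol_mul_conj hζ 0, jostFun]
  simp only [zero_add, map_add, map_mul, Complex.conj_ofReal, mul_add, Complex.add_im]
  have : jostSol φ 1 ζ * (t * starRingEnd ℂ (jostSol φ 1 ζ)) =
      ((t * Complex.normSq (jostSol φ 1 ζ) : ℝ) : ℂ) := by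
    push_cast
    rw [← Complex.mul_conj]
    ring
  rw [this, Complex.ofReal_im, add_zero]

/-- The Wronskian identity bounds the Jost function from below by `|sin θ|` at `ζ = exp (iθ)`, so it has
at most simple zeros, and only at `ζ = ±1`. -/
theorem abs_im_le_norm_jostFun {ζ : ℂ} (hζ : ‖ζ‖ = 1) (t : ℝ) :
    |ζ.im| ≤ 4 / 3 * ‖jostFun φ t ζ‖ := by
  rw [← h.im_jostSol_mul_conj_jostFun hζ t]
  refine (Complex.abs_im_le_norm _).trans ?_
  rw [norm_mul, RCLike.norm_conj]
  gcongr
  simpa [hζ] using h.norm_jostSol_le (n := 1) hζ.le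

theorem jostFun_ne_zero {ζ : ℂ} (hζ : ‖ζ‖ = 1) (him : ζ.im ≠ 0) (t : ℝ) : jostFun φ t ζ ≠ 0 := by
  intro h0
  have := h.abs_im_le_norm_jostFun hζ t
  rw [h0, norm_zero, mul_zero] at this
  exact him (abs_nonpos_iff.1 this)

/-- For the Dirichlet condition the Jost function is close to `1`, up to the band edges. -/
theorem le_norm_jostFun_zero {ζ : ℂ} (hζ : ‖ζ‖ ≤ 1) : 2 / 3 ≤ ‖jostFun φ 0 ζ‖ := by
  have h1 := h.norm_sub_one_le 0 ζ hζ
  have h2 : jostFun φ 0 ζ = φ 0 ζ := by simp [jostFun, jostSol]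
  have h3 := norm_sub_norm_le (1 : ℂ) (φ 0 ζ)
  rw [norm_sub_rev, norm_one] at h3
  rw [h2]
  linarith

/-- The imaginary part of the boundary value of the Weyl function `-u(1) / (u(0) + t u(1))`. -/
theorem im_weyl {ζ : ℂ} (hζ : ‖ζ‖ = 1) (t : ℝ) :
    (-(jostSol φ 1 ζ / jostFun φ t ζ)).im = -ζ.im / ‖jostFun φ t ζ‖ ^ 2 := by
  rw [Complex.neg_im, div_eq_mul_inv, Complex.inv_def, ← mul_assoc, Complex.im_mul_ofReal,
    h.im_jostSol_mul_conj_jostFun hζ, Complex.normSq_eq_norm_sq, div_eq_mul_inv, neg_mul]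

/-- At an energy `ζ + ζ⁻¹` with `|ζ| = 1` no non-zero solution decays at infinity. -/
theorem eq_zero_of_tendsto_zero {ζ : ℂ} (hζ : ‖ζ‖ = 1) {v : ℕ → ℂ} (hv : Tendsto v atTop (𝓝 0))
    (hrec : ∀ n, v (n + 2) + v n + V (n + 1) * v (n + 1) = (ζ + ζ⁻¹) * v (n + 1)) (n : ℕ) :
    v n = 0 := by
  have hζ0 : ζ ≠ 0 := by rintro rfl; simp at hζ
  set u : ℕ → ℂ := fun n => jostSol φ n ζ
  have hu : ∀ n, u (n + 2) + u n + V (n + 1) * u (n + 1) = (ζ + ζ⁻¹) * u (n + 1) :=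
    h.jostSol_recurrence hζ.le hζ0
  have hunorm : ∀ n, ‖u n‖ = ‖φ n ζ‖ := fun n => by simp [u, jostSol, hζ]
  have hub : ∀ n, ‖u n‖ ≤ 4 / 3 := fun n => (hunorm n).le.trans (h.norm_le hζ.le)
  have hupos : ∀ n, 2 / 3 ≤ ‖u n‖ := fun n => by
    have h1 := h.norm_sub_one_le n ζ hζ.le
    have h3 := norm_sub_norm_le (1 : ℂ) (φ n ζ)
    rw [norm_sub_rev, norm_one] at h3
    rw [hunorm]
    linarith
  have hu0 : ∀ n, u n ≠ 0 := fun n h0 => by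
    have := hupos n
    rw [h0, norm_zero] at this
    norm_num at this
  -- The Wronskian of `u` and `v` is constant and tends to zero.
  have hW : ∀ n, v (n + 1) * u n - v n * u (n + 1) = v 1 * u 0 - v 0 * u 1 := fun n => by
    induction n with
    | zero => rfl
    | succ k ih =>
      rw [← ih]
      linear_combination u (k + 1) * hrec k - v (k + 1) * hu k
  have hz : ∀ w : ℕ → ℂ, Tendsto w atTop (𝓝 0) → ∀ k, Tendsto (fun n => w n * u (n + k)) atTop (𝓝 0) :=
    fun w hw k => hw.zero_mul_isBoundedUnder_le
      (isBoundedUnder_of ⟨4 / 3, fun n => hub (n + k)⟩)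
  have hW0 : v 1 * u 0 - v 0 * u 1 = 0 := by
    have h1 := (hz (fun n => v (n + 1)) (hv.comp (tendsto_add_atTop_nat 1)) 0).sub (hz v hv 1)
    rw [sub_zero] at h1
    exact tendsto_nhds_unique (tendsto_const_nhds.congr fun n => (hW n).symm) h1
  have hratio : ∀ n, v n / u n = v 0 / u 0 := fun n => by
    induction n with
    | zero => rfl
    | succ k ih =>
      rw [← ih, div_eq_div_iff (hu0 _) (hu0 _)]
      linear_combination (hW k).trans hW0
  have hlim : Tendsto (fun n => v n / u n) atTop (𝓝 0) := by
    simp only [div_eq_mul_inv]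
    refine hv.zero_mul_isBoundedUnder_le (isBoundedUnder_of ⟨(2 / 3)⁻¹, fun n => ?_⟩)
    simp only [Function.comp, norm_inv]
    exact inv_anti₀ (by norm_num) (hupos n)
  have h0 : v 0 / u 0 = 0 :=
    tendsto_nhds_unique (tendsto_const_nhds.congr fun n => (hratio n).symm) hlim
  have := (hratio n).trans h0
  rwa [div_eq_zero_iff, or_iff_left (hu0 n)] at this

end IsJostFamily

/-! ### The spectral representation of a cyclic self-adjoint operator -/

section Representation

variable {E : Type*} [NormedAddCommGroup E] [InnerProductSpace ℂ E] [CompleteSpace E]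

/-- `f(T)` for a complex-valued function `f` of a real variable and a self-adjoint operator `T`. -/
noncomputable def complexCalculus (T : E →L[ℂ] E) (f : ℝ → ℂ) : E →L[ℂ] E :=
  cfc (fun z : ℂ => f z.re) T

theorem exists_spectrum_bound (T : E →L[ℂ] E) : ∃ R, 0 < R ∧ ∀ z ∈ spectrum ℂ T, ‖z‖ ≤ R := by
  obtain ⟨R, hR, h⟩ := (spectrum.isBounded (𝕜 := ℂ) T).exists_pos_norm_le
  exact ⟨R, hR, h⟩

/-- The defining property of the spectral measure, extended from compactly supported functions to
bounded ones by cutoffs that are `1` on the spectrum. -/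
theorem integral_spectralMeasure_of_bounded (T : E →L[ℂ] E) (e : E)
    {g : ℝ → ℝ} (hg : Continuous g) {C : ℝ} (hC : ∀ x, |g x| ≤ C) :
    ∫ x, g x ∂(spectralMeasure T e) = (⟪e, cfc g T e⟫_ℂ).re := by
  obtain ⟨R, hR, hspec⟩ := exists_spectrum_bound T
  have hcut : ∀ k : ℕ, ∃ χ : C(ℝ, ℝ), HasCompactSupport χ ∧ Set.EqOn χ 1 (Set.Icc (-R - k) (R + k)) ∧
      ∀ x, χ x ∈ Set.Icc (0 : ℝ) 1 := fun k => by
    obtain ⟨χ, h1, -, h2, h3⟩ := exists_continuous_one_zero_of_isCompact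
      (isCompact_Icc (a := -R - (k : ℝ)) (b := R + k)) isClosed_empty (Set.disjoint_empty _)
    exact ⟨χ, h2, h1, h3⟩
  choose χ hχc hχ1 hχ using hcut
  let F : ℕ → C_c(ℝ, ℝ) := fun k => ⟨⟨fun x => χ k x * g x, (χ k).continuous.mul hg⟩, (hχc k).mul_right⟩
  have hF : ∀ k, ∫ x, χ k x * g x ∂(spectralMeasure T e) = (⟪e, cfc g T e⟫_ℂ).re := fun k => by
    refine (integral_spectralMeasure T e (F k)).trans ?_
    congr 3
    refine cfc_congr fun x hx => ?_
    have hx' : |x| ≤ R := by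
      have := hspec (algebraMap ℝ ℂ x) (by rwa [spectrum.algebraMap_mem_iff])
      simpa using this
    have h1 : χ k x = 1 := hχ1 k ⟨by have := (abs_le.1 hx').1; have := k.cast_nonneg (α := ℝ); linarith,
      by have := (abs_le.1 hx').2; have := k.cast_nonneg (α := ℝ); linarith⟩
    change χ k x * g x = g x
    rw [h1, one_mul]
  have hlim : Tendsto (fun k => ∫ x, χ k x * g x ∂(spectralMeasure T e)) atTop
      (𝓝 (∫ x, g x ∂(spectralMeasure T e))) := by
    refine tendsto_integral_of_dominated_convergence (fun _ => C)
      (fun k => ((χ k).continuous.mul hg).aestronglyMeasurable) (integrable_const C)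
      (fun k => Eventually.of_forall fun x => ?_) (Eventually.of_forall fun x => ?_)
    · rw [norm_mul, Real.norm_eq_abs, Real.norm_eq_abs, abs_of_nonneg (hχ k x).1]
      exact (mul_le_of_le_one_left (abs_nonneg _) (hχ k x).2).trans (hC x)
    · refine tendsto_const_nhds.congr' ?_
      obtain ⟨N, hN⟩ := exists_nat_gt |x|
      filter_upwards [eventually_ge_atTop N] with k hk
      have hk' : (N : ℝ) ≤ k := by exact_mod_cast hk
      have h1 : χ k x = 1 := hχ1 k ⟨by have := neg_abs_le x; linarith, by have := le_abs_self x; linarith⟩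
      rw [h1, one_mul]
  exact (tendsto_nhds_unique (tendsto_const_nhds.congr fun k => (hF k).symm) hlim).symm

theorem inner_cfc_eq_integral (T : E →L[ℂ] E) (e : E)
    {g : ℝ → ℝ} (hg : Continuous g) {C : ℝ} (hC : ∀ x, |g x| ≤ C) :
    ⟪e, cfc g T e⟫_ℂ = ((∫ x, g x ∂(spectralMeasure T e) : ℝ) : ℂ) := by
  rw [integral_spectralMeasure_of_bounded T e hg hC]
  have hsa : IsSelfAdjoint (cfc g T) := cfc_predicate g T
  have h := (ContinuousLinearMap.isSelfAdjoint_iff_isSymmetric.1 hsa).coe_re_inner_self_apply e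
  exact h.symm

theorem complexCalculus_eq_add {T : E →L[ℂ] E} (hT : IsSelfAdjoint T) {f : ℝ → ℂ}
    (hf : Continuous f) : complexCalculus T f =
      cfc (fun x => (f x).re) T + Complex.I • cfc (fun x => (f x).im) T := by
  rw [cfc_real_eq_complex (fun x => (f x).re) hT, cfc_real_eq_complex (fun x => (f x).im) hT,
    ← cfc_smul Complex.I (fun z : ℂ => ((f z.re).im : ℂ)) T (by fun_prop),
    ← cfc_add T _ (fun z : ℂ => Complex.I • ((f z.re).im : ℂ)) (by fun_prop) (by fun_prop),
    complexCalculus]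
  refine cfc_congr fun z _ => ?_
  rw [smul_eq_mul, mul_comm]
  exact (Complex.re_add_im _).symm

theorem inner_complexCalculus {T : E →L[ℂ] E} (hT : IsSelfAdjoint T) (e : E)
    {f : ℝ → ℂ} (hf : Continuous f) {C : ℝ} (hC : ∀ x, ‖f x‖ ≤ C) :
    ⟪e, complexCalculus T f e⟫_ℂ = ∫ x, f x ∂(spectralMeasure T e) := by
  have hint : Integrable f (spectralMeasure T e) :=
    Integrable.of_bound hf.aestronglyMeasurable C (Eventually.of_forall hC)
  rw [complexCalculus_eq_add hT hf, add_apply, smul_apply,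
    inner_add_right, inner_smul_right,
    inner_cfc_eq_integral T e (g := fun x => (f x).re) (by fun_prop)
      fun x => (Complex.abs_re_le_norm _).trans (hC x),
    inner_cfc_eq_integral T e (g := fun x => (f x).im) (by fun_prop)
      fun x => (Complex.abs_im_le_norm _).trans (hC x), mul_comm Complex.I]
  have := integral_re_add_im hint
  exact this

theorem complexCalculus_mul {T : E →L[ℂ] E} {f g : ℝ → ℂ}
    (hf : Continuous f) (hg : Continuous g) :
    complexCalculus T f * complexCalculus T g = complexCalculus T (fun x => f x * g x) :=
  (cfc_mul _ _ T (by fun_prop) (by fun_prop)).symm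

theorem inner_complexCalculus_complexCalculus {T : E →L[ℂ] E} (hT : IsSelfAdjoint T) (e : E)
    (f g : ℝ →ᵇ ℂ) : ⟪complexCalculus T f e, complexCalculus T g e⟫_ℂ =
      ∫ x, starRingEnd ℂ (f x) * g x ∂(spectralMeasure T e) := by
  have h1 : ContinuousLinearMap.adjoint (complexCalculus T f) =
      complexCalculus T fun x => starRingEnd ℂ (f x) := (cfc_star _ T).symm
  rw [← ContinuousLinearMap.adjoint_inner_right, h1, ← mul_apply_eq_comp,
    complexCalculus_mul (by fun_prop) (by fun_prop)]
  refine inner_complexCalculus hT e (by fun_prop) (C := ‖f‖ * ‖g‖) fun x => ?_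
  rw [norm_mul, RCLike.norm_conj]
  gcongr
  · exact f.norm_coe_le_norm x
  · exact g.norm_coe_le_norm x

/-- `f ↦ f(T) e` on bounded continuous functions. -/
noncomputable def calculusVector (T : E →L[ℂ] E) (e : E) : (ℝ →ᵇ ℂ) →ₗ[ℂ] E where
  toFun f := complexCalculus T f e
  map_add' f g := by
    rw [← add_apply]
    congr 1
    exact cfc_add _ _ _ (by fun_prop) (by fun_prop)
  map_smul' c f := by
    rw [RingHom.id_apply, ← smul_apply]
    congr 1
    exact cfc_smul c _ _ (by fun_prop)

theorem norm_calculusVector {T : E →L[ℂ] E} (hT : IsSelfAdjoint T) (e : E) (f : ℝ →ᵇ ℂ) :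
    ‖calculusVector T e f‖ =
      ‖BoundedContinuousFunction.toLp 2 (spectralMeasure T e) ℂ f‖ := by
  have h1 := inner_complexCalculus_complexCalculus hT e f f
  have h2 : ⟪BoundedContinuousFunction.toLp 2 (spectralMeasure T e) ℂ f,
      BoundedContinuousFunction.toLp 2 (spectralMeasure T e) ℂ f⟫_ℂ =
      ∫ x, starRingEnd ℂ (f x) * f x ∂(spectralMeasure T e) := by
    rw [L2.inner_def]
    refine integral_congr_ae ?_
    filter_upwards [BoundedContinuousFunction.coeFn_toLp 2 (spectralMeasure T e) ℂ f] with x hx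
    rw [hx, RCLike.inner_apply, mul_comm]
  rw [← h2, inner_self_eq_norm_sq_to_K, inner_self_eq_norm_sq_to_K] at h1
  have h3 : ‖complexCalculus T f e‖ ^ 2 =
    ‖BoundedContinuousFunction.toLp 2 (spectralMeasure T e) ℂ f‖ ^ 2 := by exact_mod_cast h1
  exact (sq_eq_sq₀ (norm_nonneg _) (norm_nonneg _)).1 h3

/-- A vector `e` is cyclic for `T` if no proper closed `T`-invariant subspace contains it. -/
def IsCyclicVector (T : E →L[ℂ] E) (e : E) : Prop :=
  ∀ p : Submodule ℂ E, IsClosed (p : Set E) → e ∈ p → (∀ x ∈ p, T x ∈ p) → p = ⊤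

/-- A bounded continuous function equal to the identity on `[-R, R]`. -/
noncomputable def clampFun (R : ℝ) (hR : 0 < R) : ℝ →ᵇ ℂ :=
  BoundedContinuousFunction.ofNormedAddCommGroup (fun x => ((max (-R) (min R x) : ℝ) : ℂ))
    (by fun_prop) R (fun x => by
      rw [Complex.norm_real, Real.norm_eq_abs, abs_le]
      exact ⟨le_max_left _ _, max_le (by linarith) (min_le_left _ _)⟩)

theorem clampFun_apply {R : ℝ} (hR : 0 < R) {x : ℝ} (hx : x ∈ Set.Icc (-R) R) :
    clampFun R hR x = x := by
  change ((max (-R) (min R x) : ℝ) : ℂ) = x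
  rw [min_eq_right hx.2, max_eq_right hx.1]

theorem complexCalculus_clampFun {T : E →L[ℂ] E} (hT : IsSelfAdjoint T) {R : ℝ} (hR : 0 < R)
    (h : ∀ z ∈ spectrum ℂ T, ‖z‖ ≤ R) : complexCalculus T (clampFun R hR) = T := by
  have := hT.isStarNormal
  conv_rhs => rw [← cfc_id ℂ T]
  refine cfc_congr fun z hz => ?_
  have h1 := abs_le.1 ((Complex.abs_re_le_norm z).trans (h z hz))
  change clampFun R hR z.re = z
  rw [clampFun_apply hR ⟨h1.1, h1.2⟩]
  exact (hT.mem_spectrum_eq_re hz).symm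

theorem complexCalculus_one {T : E →L[ℂ] E} (hT : IsSelfAdjoint T) :
    complexCalculus T (1 : ℝ →ᵇ ℂ) = 1 := by
  have := hT.isStarNormal
  exact cfc_const_one ℂ T

/-- The spectral measure lives on any interval `[-R, R]` that contains the spectrum. -/
theorem ae_abs_le_of_spectrum_bound {T : E →L[ℂ] E} (e : E) {R : ℝ}
    (hR : ∀ z ∈ spectrum ℂ T, ‖z‖ ≤ R) : ∀ᵐ x ∂(spectralMeasure T e), |x| ≤ R := by
  have hg : Continuous fun x : ℝ => min 1 (max (|x| - R) 0) := by fun_prop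
  have hb : ∀ x : ℝ, |min 1 (max (|x| - R) 0)| ≤ 1 := fun x => by
    rw [abs_of_nonneg (le_min zero_le_one (le_max_right _ _))]
    exact min_le_left _ _
  have hnn : (0 : ℝ → ℝ) ≤ fun x : ℝ => min 1 (max (|x| - R) 0) := fun x =>
    le_min zero_le_one (le_max_right _ _)
  have h := integral_spectralMeasure_of_bounded T e hg hb
  have h0 : cfc (fun x : ℝ => min 1 (max (|x| - R) 0)) T = 0 := by
    rw [← cfc_zero ℝ T]
    refine cfc_congr fun x hx => ?_
    have h1 := hR (algebraMap ℝ ℂ x) (by rwa [spectrum.algebraMap_mem_iff])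
    have hx' : |x| - R ≤ 0 := by simpa using h1
    change min 1 (max (|x| - R) 0) = 0
    rw [max_eq_right hx', min_eq_right zero_le_one]
  rw [h0, zero_apply, inner_zero_right, Complex.zero_re,
    integral_eq_zero_iff_of_nonneg hnn
      (Integrable.of_bound hg.aestronglyMeasurable 1 (Eventually.of_forall hb))] at h
  filter_upwards [h] with x hx
  by_contra! hlt
  have : 0 < min 1 (max (|x| - R) 0) := lt_min one_pos (lt_max_of_lt_left (by linarith))
  exact this.ne' hx

/-- The spectral theorem for a self-adjoint operator with a cyclic vector `e`: the map `f ↦ f(T) e`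
extends from bounded continuous functions to a unitary from `L²(μ_e)`. The lemmas below show that it
turns `T` into the multiplication by `x`. -/
theorem exists_spectralRepresentation {T : E →L[ℂ] E} (hT : IsSelfAdjoint T) {e : E}
    (he : IsCyclicVector T e) :
    ∃ U : Lp ℂ 2 (spectralMeasure T e) ≃ₗᵢ[ℂ] E, ∀ f : ℝ →ᵇ ℂ,
      U (BoundedContinuousFunction.toLp 2 (spectralMeasure T e) ℂ f) = complexCalculus T f e := by
  set ι : (ℝ →ᵇ ℂ) →L[ℂ] Lp ℂ 2 (spectralMeasure T e) :=
    BoundedContinuousFunction.toLp 2 (spectralMeasure T e) ℂ with hι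
  have hdense : DenseRange ι := BoundedContinuousFunction.toLp_denseRange ℂ _ ℂ (by simp)
  have hnorm : ∀ f, ‖calculusVector T e f‖ ≤ 1 * ‖ι f‖ := fun f => by
    rw [one_mul, norm_calculusVector hT]
  let U₀ : Lp ℂ 2 (spectralMeasure T e) →L[ℂ] E := (calculusVector T e).extendOfNorm ι.toLinearMap
  have hU₀ : ∀ f, U₀ (ι f) = calculusVector T e f := fun f =>
    LinearMap.extendOfNorm_eq (e := ι.toLinearMap) hdense ⟨1, hnorm⟩ f
  have hiso : ∀ g, ‖U₀ g‖ = ‖g‖ := fun g => by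
    refine hdense.induction (P := fun g => ‖U₀ g‖ = ‖g‖) ?_
      (isClosed_eq U₀.continuous.norm continuous_norm) g
    rintro _ ⟨f, rfl⟩
    rw [hU₀, norm_calculusVector hT]
  let U₁ : Lp ℂ 2 (spectralMeasure T e) →ₗᵢ[ℂ] E := ⟨U₀.toLinearMap, hiso⟩
  have hU₁ : ∀ f, U₁ (ι f) = complexCalculus T f e := hU₀
  have hclosed : IsClosed (Set.range U₁) := U₁.isometry.isClosedEmbedding.isClosed_range
  have htop : LinearMap.range U₁.toLinearMap = ⊤ := by
    refine he _ hclosed ⟨ι 1, ?_⟩ ?_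
    · refine (hU₁ 1).trans ?_
      rw [complexCalculus_one hT]
      rfl
    · rintro _ ⟨g, rfl⟩
      obtain ⟨R, hR, hspec⟩ := exists_spectrum_bound T
      refine hdense.induction (P := fun g => T (U₁ g) ∈ Set.range U₁) ?_
        (hclosed.preimage (T.continuous.comp U₁.continuous)) g
      rintro _ ⟨f, rfl⟩
      refine ⟨ι (clampFun R hR * f), ?_⟩
      have hmul : T (complexCalculus T f e) =
          (complexCalculus T (clampFun R hR) * complexCalculus T f) e := by
        rw [complexCalculus_clampFun hT hR hspec]
        rfl
      rw [hU₁, hU₁, hmul, complexCalculus_mul (by fun_prop) (by fun_prop)]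
      rfl
  refine ⟨LinearIsometryEquiv.ofSurjective U₁ (LinearMap.range_eq_top.1 htop), fun f => hU₁ f⟩

/-- Multiplication by an essentially bounded function on `L²(μ)`. -/
noncomputable def mulLp {μ : Measure ℝ} (F : Lp ℂ ⊤ μ) : Lp ℂ 2 μ →L[ℂ] Lp ℂ 2 μ :=
  (ContinuousLinearMap.mul ℂ ℂ).holderL μ ⊤ 2 2 F

theorem coeFn_mulLp {μ : Measure ℝ} {F : ℝ → ℂ} (hF : MemLp F ⊤ μ) (g : Lp ℂ 2 μ) :
    mulLp (hF.toLp F) g =ᵐ[μ] fun x => F x * g x := by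
  have h := (ContinuousLinearMap.mul ℂ ℂ).coeFn_holder (r := 2) (hF.toLp F) g
  filter_upwards [h, hF.coeFn_toLp] with x hx hx'
  exact hx.trans (by rw [hx']; rfl)

variable {T : E →L[ℂ] E} {e : E} {U : Lp ℂ 2 (spectralMeasure T e) ≃ₗᵢ[ℂ] E}

theorem memLp_top_boundedContinuous {μ : Measure ℝ} (f : ℝ →ᵇ ℂ) : MemLp f ⊤ μ :=
  memLp_top_of_bound f.continuous.aestronglyMeasurable ‖f‖ (Eventually.of_forall f.norm_coe_le_norm)

theorem complexCalculus_apply_representation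
    (hU : ∀ f : ℝ →ᵇ ℂ,
      U (BoundedContinuousFunction.toLp 2 (spectralMeasure T e) ℂ f) = complexCalculus T f e)
    (f : ℝ →ᵇ ℂ) (g : Lp ℂ 2 (spectralMeasure T e)) :
    complexCalculus T f (U g) = U (mulLp ((memLp_top_boundedContinuous f).toLp f) g) := by
  refine (BoundedContinuousFunction.toLp_denseRange (p := 2) ℂ (spectralMeasure T e) ℂ
    (by simp)).induction (P := fun g => complexCalculus T f (U g) =
      U (mulLp ((memLp_top_boundedContinuous f).toLp f) g)) ?_ ?_ g
  · rintro _ ⟨k, rfl⟩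
    rw [hU, ← mul_apply_eq_comp, complexCalculus_mul (by fun_prop) (by fun_prop)]
    refine (hU (f * k)).symm.trans (congrArg U (Lp.ext ?_))
    filter_upwards [BoundedContinuousFunction.coeFn_toLp 2 (spectralMeasure T e) ℂ (f * k),
      BoundedContinuousFunction.coeFn_toLp 2 (spectralMeasure T e) ℂ k,
      coeFn_mulLp (memLp_top_boundedContinuous f)
        (BoundedContinuousFunction.toLp 2 (spectralMeasure T e) ℂ k)] with x h1 h2 h3
    rw [h1, h3, h2]
    rfl
  · exact isClosed_eq (by fun_prop) (by fun_prop)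

theorem representation_symm_apply_operator (hT : IsSelfAdjoint T)
    (hU : ∀ f : ℝ →ᵇ ℂ,
      U (BoundedContinuousFunction.toLp 2 (spectralMeasure T e) ℂ f) = complexCalculus T f e)
    (φ : E) : U.symm (T φ) =ᵐ[spectralMeasure T e] fun x => (x : ℂ) * U.symm φ x := by
  obtain ⟨R, hR, hspec⟩ := exists_spectrum_bound T
  have h := complexCalculus_apply_representation hU (clampFun R hR) (U.symm φ)
  rw [complexCalculus_clampFun hT hR hspec, LinearIsometryEquiv.apply_symm_apply] at h
  rw [h, LinearIsometryEquiv.symm_apply_apply]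
  filter_upwards [coeFn_mulLp (memLp_top_boundedContinuous (clampFun R hR)) (U.symm φ),
    ae_abs_le_of_spectrum_bound e hspec] with x hx hx'
  rw [hx, clampFun_apply hR (abs_le.1 hx')]

theorem representation_symm_base (hT : IsSelfAdjoint T)
    (hU : ∀ f : ℝ →ᵇ ℂ,
      U (BoundedContinuousFunction.toLp 2 (spectralMeasure T e) ℂ f) = complexCalculus T f e) :
    U.symm e =ᵐ[spectralMeasure T e] fun _ => 1 := by
  have h := hU 1
  rw [complexCalculus_one hT, one_apply_eq_self] at h
  rw [LinearIsometryEquiv.symm_apply_eq _ |>.2 h.symm]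
  filter_upwards [BoundedContinuousFunction.coeFn_toLp 2 (spectralMeasure T e) ℂ (1 : ℝ →ᵇ ℂ)] with x hx
  rw [hx]
  rfl

theorem inner_base_eq_integral (hT : IsSelfAdjoint T)
    (hU : ∀ f : ℝ →ᵇ ℂ,
      U (BoundedContinuousFunction.toLp 2 (spectralMeasure T e) ℂ f) = complexCalculus T f e)
    (φ : E) : ⟪e, φ⟫_ℂ = ∫ x, U.symm φ x ∂(spectralMeasure T e) := by
  rw [← U.symm.inner_map_map, L2.inner_def]
  refine integral_congr_ae ?_
  filter_upwards [representation_symm_base hT hU] with x hx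
  rw [hx, RCLike.inner_apply, map_one, mul_one]

theorem lintegral_enorm_sq_lt_top {μ : Measure ℝ} (g : Lp ℂ 2 μ) : ∫⁻ x, ‖g x‖ₑ ^ 2 ∂μ < ⊤ := by
  have := lintegral_rpow_enorm_lt_top_of_eLpNorm_lt_top (by simp) (by simp) (Lp.memLp g).2
  simpa using this

theorem spectralMeasure_eq_withDensity (hT : IsSelfAdjoint T)
    (hU : ∀ f : ℝ →ᵇ ℂ,
      U (BoundedContinuousFunction.toLp 2 (spectralMeasure T e) ℂ f) = complexCalculus T f e)
    (φ : E) : spectralMeasure T φ =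
      (spectralMeasure T e).withDensity fun x => ‖U.symm φ x‖ₑ ^ 2 := by
  have hfin : IsFiniteMeasure ((spectralMeasure T e).withDensity fun x => ‖U.symm φ x‖ₑ ^ 2) :=
    isFiniteMeasure_withDensity (lintegral_enorm_sq_lt_top _).ne
  refine Measure.ext_of_integral_eq_on_compactlySupported fun f => ?_
  obtain ⟨C, hC⟩ := f.hasCompactSupport.exists_bound_of_continuous f.continuous
  let F : ℝ →ᵇ ℂ := BoundedContinuousFunction.ofNormedAddCommGroup (fun x => (f x : ℂ))
    (by fun_prop) C (fun x => by rw [Complex.norm_real]; exact hC x)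
  have hF : cfc (f : ℝ → ℝ) T = complexCalculus T F := cfc_real_eq_complex _ hT
  have h := complexCalculus_apply_representation hU F (U.symm φ)
  rw [LinearIsometryEquiv.apply_symm_apply] at h
  rw [integral_spectralMeasure, hF, h, ← U.symm.inner_map_map, LinearIsometryEquiv.symm_apply_apply,
    L2.inner_def, integral_withDensity_eq_integral_toReal_smul₀
      ((Lp.aestronglyMeasurable _).enorm.pow_const 2) (Eventually.of_forall fun x => by finiteness)]
  have : ∀ᵐ x ∂(spectralMeasure T e), ⟪U.symm φ x, mulLp
      ((memLp_top_boundedContinuous F).toLp F) (U.symm φ) x⟫_ℂ =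
      (((‖U.symm φ x‖ₑ ^ 2).toReal • f x : ℝ) : ℂ) := by
    filter_upwards [coeFn_mulLp (memLp_top_boundedContinuous F) (U.symm φ)] with x hx
    rw [hx, RCLike.inner_apply, mul_assoc, RCLike.mul_conj]
    simp [F, mul_comm]
  rw [integral_congr_ae this]
  exact (congrArg Complex.re integral_complex_ofReal).trans (Complex.ofReal_re _)

theorem representation_symm_borelCalculus (hT : IsSelfAdjoint T)
    (hU : ∀ f : ℝ →ᵇ ℂ,
      U (BoundedContinuousFunction.toLp 2 (spectralMeasure T e) ℂ f) = complexCalculus T f e)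
    {F : ℝ → ℂ} (hF : Measurable F) {C : ℝ} (hC : ∀ x, ‖F x‖ ≤ C) (φ : E) :
    U.symm (borelCalculus T F φ) =ᵐ[spectralMeasure T e] fun x => F x * U.symm φ x := by
  have hmem : MemLp F ⊤ (spectralMeasure T e) :=
    memLp_top_of_bound hF.aestronglyMeasurable C (Eventually.of_forall hC)
  let S : E →L[ℂ] E := (U : _ →L[ℂ] E) ∘L mulLp (hmem.toLp F) ∘L (U.symm : E →L[ℂ] _)
  have hS : ∀ φ, S φ = U (mulLp (hmem.toLp F) (U.symm φ)) := fun φ => rfl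
  have hSφ : ∀ ψ, ⟪ψ, S ψ⟫_ℂ = ∫ x, F x ∂(spectralMeasure T ψ) := fun ψ => by
    rw [hS, ← U.symm.inner_map_map, LinearIsometryEquiv.symm_apply_apply, L2.inner_def,
      spectralMeasure_eq_withDensity hT hU ψ, integral_withDensity_eq_integral_toReal_smul₀
      ((Lp.aestronglyMeasurable _).enorm.pow_const 2) (Eventually.of_forall fun x => by finiteness)]
    refine integral_congr_ae ?_
    filter_upwards [coeFn_mulLp hmem (U.symm ψ)] with x hx
    rw [hx, RCLike.inner_apply, mul_assoc, RCLike.mul_conj]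
    simp [mul_comm]
  have hzero : ((borelCalculus T F - S : E →L[ℂ] E) : E →ₗ[ℂ] E) = 0 := by
    rw [← inner_map_self_eq_zero]
    intro ψ
    rw [← inner_conj_symm]
    simp only [ContinuousLinearMap.coe_coe, sub_apply, inner_sub_right]
    rw [hSφ, inner_borelCalculus T hF hC, sub_self, map_zero]
  have heq : borelCalculus T F φ = S φ := by
    have := LinearMap.congr_fun hzero φ
    exact sub_eq_zero.1 this
  rw [heq, hS, LinearIsometryEquiv.symm_apply_apply]
  exact coeFn_mulLp hmem (U.symm φ)

end Representation

/-! ### A Plancherel inequality for measures with a square integrable density -/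

/-- The Fourier transform `∫ e^{-isx} dν(x)` of a finite measure. -/
noncomputable def measureFourier (ν : Measure ℝ) (s : ℝ) : ℂ :=
  ∫ x, Complex.exp (-(Complex.I * s) * x) ∂ν

theorem norm_exp_neg_I_mul (s x : ℝ) : ‖Complex.exp (-(Complex.I * s) * x)‖ = 1 := by
  rw [Complex.norm_exp]
  simp

theorem continuous_measureFourier (ν : Measure ℝ) [IsFiniteMeasure ν] :
    Continuous (measureFourier ν) := by
  refine continuous_of_dominated (F := fun (s x : ℝ) => Complex.exp (-(Complex.I * s) * x))
    (bound := fun _ => 1) (fun s => (by fun_prop : Continuous fun x : ℝ =>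
      Complex.exp (-(Complex.I * s) * x)).aestronglyMeasurable)
    (fun s => Eventually.of_forall fun x => (norm_exp_neg_I_mul s x).le) (integrable_const _)
    (Eventually.of_forall fun x => by fun_prop)

theorem norm_measureFourier_le (ν : Measure ℝ) [IsFiniteMeasure ν] (s : ℝ) :
    ‖measureFourier ν s‖ ≤ ν.real Set.univ := by
  refine (norm_integral_le_of_norm_le_const
    (Eventually.of_forall fun x => (norm_exp_neg_I_mul s x).le)).trans ?_
  rw [one_mul]

theorem norm_measureFourier_sq (ν : Measure ℝ) [IsFiniteMeasure ν] (s : ℝ) :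
    ‖measureFourier ν s‖ ^ 2 = ∫ p : ℝ × ℝ, Real.cos (s * (p.1 - p.2)) ∂(ν.prod ν) := by
  have hint : Integrable (fun x : ℝ => Complex.exp (-(Complex.I * s) * x)) ν :=
    Integrable.of_bound (by fun_prop) 1 (Eventually.of_forall fun x => (norm_exp_neg_I_mul s x).le)
  have hre : (measureFourier ν s).re = ∫ x, Real.cos (s * x) ∂ν := by
    refine (integral_re hint).symm.trans ?_
    refine integral_congr_ae (Eventually.of_forall fun x => ?_)
    simp [Complex.exp_re]
  have him : (measureFourier ν s).im = - ∫ x, Real.sin (s * x) ∂ν := by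
    rw [← integral_neg]
    refine (integral_im hint).symm.trans ?_
    refine integral_congr_ae (Eventually.of_forall fun x => ?_)
    simp [Complex.exp_im]
  have hc : Integrable (fun x : ℝ => Real.cos (s * x)) ν :=
    Integrable.of_bound (by fun_prop) 1 (Eventually.of_forall fun x => Real.abs_cos_le_one _)
  have hs : Integrable (fun x : ℝ => Real.sin (s * x)) ν :=
    Integrable.of_bound (by fun_prop) 1 (Eventually.of_forall fun x => Real.abs_sin_le_one _)
  simp only [mul_sub, Real.cos_sub]
  rw [integral_add (hc.mul_prod hc) (hs.mul_prod hs),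
    integral_prod_mul (fun x : ℝ => Real.cos (s * x)) fun x : ℝ => Real.cos (s * x),
    integral_prod_mul (fun x : ℝ => Real.sin (s * x)) fun x : ℝ => Real.sin (s * x),
    ← Complex.normSq_eq_norm_sq, Complex.normSq_apply, hre, him]
  ring

theorem integral_gaussian_mul_cos {b : ℝ} (hb : 0 < b) (w : ℝ) :
    ∫ s : ℝ, Real.exp (-b * s ^ 2) * Real.cos (s * w) =
      √(Real.pi / b) * Real.exp (-w ^ 2 / (4 * b)) := by
  have h := fourierIntegral_gaussian (b := (b : ℂ)) (by simpa using hb) w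
  have h1 : ((Real.pi : ℂ) / b) ^ (1 / 2 : ℂ) * Complex.exp (-(w : ℂ) ^ 2 / (4 * b)) =
      ((√(Real.pi / b) * Real.exp (-w ^ 2 / (4 * b)) : ℝ) : ℂ) := by
    push_cast
    rw [Real.sqrt_eq_rpow, Complex.ofReal_cpow (by positivity)]
    push_cast
    rfl
  rw [h1] at h
  have hint : Integrable (fun s : ℝ => Complex.exp (Complex.I * w * s) * Complex.exp (-b * s ^ 2)) := by
    have := (integrable_cexp_neg_mul_sq (b := (b : ℂ)) (by simpa using hb))
    refine this.bdd_mul (c := 1) (by fun_prop) (Eventually.of_forall fun s => ?_)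
    rw [Complex.norm_exp]
    simp
  have h2 := congrArg Complex.re h
  rw [Complex.ofReal_re] at h2
  rw [← h2]
  refine Eq.trans ?_ (integral_re hint)
  refine integral_congr_ae (Eventually.of_forall fun s => ?_)
  have h3 : Complex.exp (-b * (s : ℂ) ^ 2) = ((Real.exp (-b * s ^ 2) : ℝ) : ℂ) := by push_cast; rfl
  change _ = (Complex.exp (Complex.I * w * s) * Complex.exp (-b * (s : ℂ) ^ 2)).re
  rw [h3, Complex.re_mul_ofReal]
  simp [Complex.exp_re, mul_comm]

theorem integral_gaussian_mul_norm_measureFourier_sq (ν : Measure ℝ) [IsFiniteMeasure ν] {b : ℝ}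
    (hb : 0 < b) : ∫ s : ℝ, Real.exp (-b * s ^ 2) * ‖measureFourier ν s‖ ^ 2 =
      √(Real.pi / b) * ∫ p : ℝ × ℝ, Real.exp (-(p.1 - p.2) ^ 2 / (4 * b)) ∂(ν.prod ν) := by
  have hint : Integrable (fun q : ℝ × (ℝ × ℝ) =>
      Real.exp (-b * q.1 ^ 2) * Real.cos (q.1 * (q.2.1 - q.2.2))) (volume.prod (ν.prod ν)) := by
    have h1 : Integrable (fun q : ℝ × (ℝ × ℝ) => Real.exp (-b * q.1 ^ 2) * 1)
        (volume.prod (ν.prod ν)) :=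
      (integrable_exp_neg_mul_sq hb).mul_prod (integrable_const (1 : ℝ))
    refine h1.mono (by fun_prop) (Eventually.of_forall fun q => ?_)
    rw [norm_mul, norm_mul, norm_one]
    gcongr
    exact Real.abs_cos_le_one _
  calc ∫ s : ℝ, Real.exp (-b * s ^ 2) * ‖measureFourier ν s‖ ^ 2
      = ∫ s : ℝ, ∫ p : ℝ × ℝ, Real.exp (-b * s ^ 2) * Real.cos (s * (p.1 - p.2)) ∂(ν.prod ν) := by
        simp only [norm_measureFourier_sq, integral_const_mul]
    _ = ∫ p : ℝ × ℝ, (∫ s : ℝ, Real.exp (-b * s ^ 2) * Real.cos (s * (p.1 - p.2))) ∂(ν.prod ν) :=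
        integral_integral_swap hint
    _ = _ := by
        simp only [integral_gaussian_mul_cos hb, integral_const_mul]

theorem lintegral_gaussian_sub {b : ℝ} (hb : 0 < b) (x : ℝ) :
    ∫⁻ y : ℝ, ENNReal.ofReal (Real.exp (-(x - y) ^ 2 / (4 * b))) =
      ENNReal.ofReal √(4 * b * Real.pi) := by
  rw [lintegral_sub_left_eq_self (fun w : ℝ => ENNReal.ofReal (Real.exp (-w ^ 2 / (4 * b)))) x]
  have h1 : (fun w : ℝ => Real.exp (-w ^ 2 / (4 * b))) = fun w => Real.exp (-(1 / (4 * b)) * w ^ 2) := by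
    ext w; congr 1; ring
  rw [← ofReal_integral_eq_lintegral_ofReal _ (Eventually.of_forall fun w => (Real.exp_pos _).le),
    h1, integral_gaussian]
  · congr 2; field_simp
  · rw [h1]; exact integrable_exp_neg_mul_sq (by positivity)

/-- Schur's test for the Gaussian kernel, with `G x * G y ≤ G x ^ 2 + G y ^ 2`. -/
theorem lintegral_gaussian_prod_le {G : ℝ → ENNReal} (hG : Measurable G) {b : ℝ} (hb : 0 < b) :
    ∫⁻ p : ℝ × ℝ, ENNReal.ofReal (Real.exp (-(p.1 - p.2) ^ 2 / (4 * b)))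
      ∂((volume.withDensity G).prod (volume.withDensity G)) ≤
      2 * (ENNReal.ofReal √(4 * b * Real.pi) * ∫⁻ x, G x ^ 2) := by
  set k : ℝ → ℝ → ENNReal := fun x y => ENNReal.ofReal (Real.exp (-(x - y) ^ 2 / (4 * b))) with hk
  have hkm : Measurable (Function.uncurry k) := by fun_prop
  have hkx : ∀ x, Measurable (k x) := fun x => by fun_prop
  rw [prod_withDensity hG hG, lintegral_withDensity_eq_lintegral_mul _ (by fun_prop) (by fun_prop)]
  have hle : ∀ p : ℝ × ℝ, ((fun p : ℝ × ℝ => G p.1 * G p.2) * fun p : ℝ × ℝ => k p.1 p.2) p ≤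
      G p.1 ^ 2 * k p.1 p.2 + G p.2 ^ 2 * k p.1 p.2 := fun p => by
    simp only [Pi.mul_apply, ← add_mul]
    gcongr
    rcases le_total (G p.1) (G p.2) with h | h
    · exact le_add_left (by rw [sq]; gcongr)
    · exact le_add_right (by rw [sq]; gcongr)
  refine (lintegral_mono hle).trans ?_
  rw [lintegral_add_left (by fun_prop), two_mul]
  refine add_le_add (le_of_eq ?_) (le_of_eq ?_)
  · rw [lintegral_prod _ (by fun_prop)]
    simp only
    rw [← lintegral_const_mul _ (by fun_prop)]
    refine lintegral_congr fun x => ?_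
    rw [lintegral_const_mul _ (hkx x), hk]
    simp only
    rw [lintegral_gaussian_sub hb, mul_comm]
  · rw [lintegral_prod_symm _ (by fun_prop)]
    simp only
    rw [← lintegral_const_mul _ (by fun_prop)]
    refine lintegral_congr fun y => ?_
    rw [lintegral_const_mul _ (by fun_prop), mul_comm]
    congr 1
    rw [← lintegral_gaussian_sub hb y]
    refine lintegral_congr fun x => ?_
    simp only [hk]
    congr 3
    ring

/-- Half of Plancherel's theorem, with a constant that is not sharp: inserting a Gaussian of width `t`
turns the time average into a double integral against a Gaussian kernel of mass `2π`. -/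
theorem intervalIntegral_norm_measureFourier_sq_le {G : ℝ → ENNReal} (hG : Measurable G)
    [IsFiniteMeasure (volume.withDensity G)] (hG2 : ∫⁻ x, G x ^ 2 ≠ ⊤) {t : ℝ} (ht : 0 < t) :
    ∫ s in (0 : ℝ)..t, ‖measureFourier (volume.withDensity G) s‖ ^ 2 ≤
      4 * Real.pi * Real.exp 1 * (∫⁻ x, G x ^ 2).toReal := by
  set ν := volume.withDensity G
  set b : ℝ := (t ^ 2)⁻¹
  have hb : 0 < b := by positivity
  have hcont := (continuous_measureFourier ν).norm.pow 2
  have hint : Integrable fun s : ℝ => Real.exp (-b * s ^ 2) * ‖measureFourier ν s‖ ^ 2 :=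
    (integrable_exp_neg_mul_sq hb).mul_bdd (c := ν.real Set.univ ^ 2) hcont.aestronglyMeasurable
      (Eventually.of_forall fun s => by
        rw [Real.norm_of_nonneg (by positivity)]
        gcongr
        exact norm_measureFourier_le ν s)
  have h1 : ∫ s in (0 : ℝ)..t, ‖measureFourier ν s‖ ^ 2 ≤
      Real.exp 1 * ∫ s : ℝ, Real.exp (-b * s ^ 2) * ‖measureFourier ν s‖ ^ 2 := by
    rw [intervalIntegral.integral_of_le ht.le, ← integral_const_mul]
    refine le_trans (setIntegral_mono_on (hcont.integrableOn_Icc.mono_set Set.Ioc_subset_Icc_self)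
      (hint.const_mul _).integrableOn measurableSet_Ioc fun s hs => ?_)
      (setIntegral_le_integral (hint.const_mul _) (Eventually.of_forall fun s => by positivity))
    rw [← mul_assoc, ← Real.exp_add]
    refine le_mul_of_one_le_left (by positivity) (Real.one_le_exp ?_)
    have : b * s ^ 2 ≤ 1 := by
      rw [inv_mul_le_iff₀ (by positivity), mul_one]
      have := hs.1.le
      have := hs.2
      gcongr
    linarith
  have h2 : ∫ p : ℝ × ℝ, Real.exp (-(p.1 - p.2) ^ 2 / (4 * b)) ∂(ν.prod ν) ≤
      2 * (√(4 * b * Real.pi) * (∫⁻ x, G x ^ 2).toReal) := by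
    rw [integral_eq_lintegral_of_nonneg_ae (Eventually.of_forall fun p => (Real.exp_pos _).le)
      (by fun_prop)]
    refine (ENNReal.toReal_mono (by finiteness) (lintegral_gaussian_prod_le hG hb)).trans
      (le_of_eq ?_)
    rw [ENNReal.toReal_mul, ENNReal.toReal_mul, ENNReal.toReal_ofReal (Real.sqrt_nonneg _)]
    simp
  rw [integral_gaussian_mul_norm_measureFourier_sq ν hb] at h1
  refine h1.trans ?_
  have h3 : √(Real.pi / b) * √(4 * b * Real.pi) = 2 * Real.pi := by
    rw [← Real.sqrt_mul (by positivity)]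
    have : Real.pi / b * (4 * b * Real.pi) = (2 * Real.pi) ^ 2 := by field_simp; ring
    rw [this, Real.sqrt_sq (by positivity)]
  calc Real.exp 1 * (√(Real.pi / b) * _)
      ≤ Real.exp 1 * (√(Real.pi / b) * (2 * (√(4 * b * Real.pi) * (∫⁻ x, G x ^ 2).toReal))) := by
        gcongr
    _ = Real.exp 1 * 2 * (√(Real.pi / b) * √(4 * b * Real.pi)) * (∫⁻ x, G x ^ 2).toReal := by ring
    _ = _ := by rw [h3]; ring

/-! ### The inverse square root weight of the band edges -/

/-- The function `(4 - x²)^{-1/2}` on `(-2, 2)`, extended by zero. -/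
noncomputable def edgeWeight (x : ℝ) : ENNReal :=
  (Set.Ioo (-2 : ℝ) 2).indicator (fun x => ENNReal.ofReal (√(4 - x ^ 2))⁻¹) x

theorem measurable_edgeWeight : Measurable edgeWeight :=
  Measurable.indicator (by fun_prop) measurableSet_Ioo

/-- `x^{-1/2}` on the positive half-line, extended by zero. -/
noncomputable def invSqrt (x : ℝ) : ENNReal :=
  (Set.Ioi (0 : ℝ)).indicator (fun x => ENNReal.ofReal (√x)⁻¹) x

theorem measurable_invSqrt : Measurable invSqrt :=
  Measurable.indicator (by fun_prop) measurableSet_Ioi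

theorem edgeWeight_le (x : ℝ) : edgeWeight x ≤ invSqrt (2 - x) + invSqrt (2 + x) := by
  unfold edgeWeight
  by_cases hx : x ∈ Set.Ioo (-2 : ℝ) 2
  · have h1 : 0 < 2 - x := by linarith [hx.2]
    have h2 : 0 < 2 + x := by linarith [hx.1]
    have hprod : 4 - x ^ 2 = (2 - x) * (2 + x) := by ring
    rw [Set.indicator_of_mem hx, hprod]
    rcases le_total 0 x with h | h
    · refine le_add_right ?_
      rw [invSqrt, Set.indicator_of_mem (Set.mem_Ioi.2 h1)]
      refine ENNReal.ofReal_le_ofReal (inv_anti₀ (Real.sqrt_pos.2 h1) (Real.sqrt_le_sqrt ?_))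
      nlinarith
    · refine le_add_left ?_
      rw [invSqrt, Set.indicator_of_mem (Set.mem_Ioi.2 h2)]
      refine ENNReal.ofReal_le_ofReal (inv_anti₀ (Real.sqrt_pos.2 h2) (Real.sqrt_le_sqrt ?_))
      nlinarith
  · rw [Set.indicator_of_notMem hx]
    exact zero_le

theorem lintegral_invSqrt_Iio {δ : ℝ} (hδ : 0 < δ) :
    ∫⁻ x in Set.Iio δ, invSqrt x = ENNReal.ofReal (2 * √δ) := by
  have h1 : ∫⁻ x in Set.Iio δ, invSqrt x = ∫⁻ x in Set.Ioo 0 δ, ENNReal.ofReal (x ^ (-(1 / 2) : ℝ)) := by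
    have hset : Set.Ioi 0 ∩ Set.Iio δ = Set.Ioo 0 δ := rfl
    unfold invSqrt
    rw [setLIntegral_indicator measurableSet_Ioi, hset]
    refine setLIntegral_congr_fun measurableSet_Ioo fun x hx => ?_
    rw [Real.rpow_neg hx.1.le, Real.sqrt_eq_rpow]
  have hint : IntervalIntegrable (fun x : ℝ => x ^ (-(1 / 2) : ℝ)) volume 0 δ :=
    intervalIntegral.intervalIntegrable_rpow' (by norm_num)
  rw [h1, ← ofReal_integral_eq_lintegral_ofReal]
  · rw [← integral_Ioc_eq_integral_Ioo, ← intervalIntegral.integral_of_le hδ.le,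
      integral_rpow (Or.inl (by norm_num)), Real.sqrt_eq_rpow]
    congr 1
    have : (-(1 / 2) + 1 : ℝ) = 1 / 2 := by norm_num
    rw [this, Real.zero_rpow (by norm_num)]
    ring
  · exact ((intervalIntegrable_iff_integrableOn_Ioo_of_le hδ.le).1 hint)
  · exact (ae_restrict_mem measurableSet_Ioo).mono fun x hx => by
      have := hx.1.le
      simp only [Pi.zero_apply]
      positivity

/-- The integral of the inverse square root over a set of measure `δ` is largest for the interval
`(0, δ)` up to a constant. The proof splits the set there. -/
theorem setLIntegral_invSqrt_comp_le {θ : ℝ → ℝ} (hθ : MeasurePreserving θ) {A : Set ℝ}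
    (hA : volume A < 1) :
    ∫⁻ x in A, invSqrt (θ x) ≤ 3 * volume A ^ (1 / 2 : ℝ) := by
  rcases eq_or_ne (volume A) 0 with h0 | h0
  · rw [setLIntegral_measure_zero _ _ h0]
    exact zero_le
  have hfin : volume A ≠ ⊤ := (hA.trans ENNReal.one_lt_top).ne
  set δ := (volume A).toReal with hδdef
  have hδ : 0 < δ := ENNReal.toReal_pos h0 hfin
  have hvol : volume A = ENNReal.ofReal δ := (ENNReal.ofReal_toReal hfin).symm
  have hle : ∀ x, invSqrt (θ x) ≤ (θ ⁻¹' Set.Iio δ).indicator (fun x => invSqrt (θ x)) x +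
      ENNReal.ofReal (√δ)⁻¹ := fun x => by
    by_cases hx : θ x < δ
    · rw [Set.indicator_of_mem (by exact hx)]
      exact le_self_add
    · refine le_add_left ?_
      rw [not_lt] at hx
      rw [invSqrt, Set.indicator_of_mem (Set.mem_Ioi.2 (hδ.trans_le hx))]
      exact ENNReal.ofReal_le_ofReal (inv_anti₀ (Real.sqrt_pos.2 hδ) (Real.sqrt_le_sqrt hx))
  have hm := measurable_invSqrt.comp hθ.measurable
  calc ∫⁻ x in A, invSqrt (θ x)
      ≤ ∫⁻ x in A, ((θ ⁻¹' Set.Iio δ).indicator (fun x => invSqrt (θ x)) x + ENNReal.ofReal (√δ)⁻¹) :=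
        lintegral_mono hle
    _ = (∫⁻ x in A, (θ ⁻¹' Set.Iio δ).indicator (fun x => invSqrt (θ x)) x) +
          ENNReal.ofReal (√δ)⁻¹ * volume A := by
        rw [lintegral_add_right _ measurable_const, setLIntegral_const]
    _ ≤ ENNReal.ofReal (2 * √δ) + ENNReal.ofReal (√δ)⁻¹ * volume A := by
        gcongr
        refine (setLIntegral_le_lintegral _ _).trans ?_
        rw [lintegral_indicator (hθ.measurable measurableSet_Iio),
          hθ.setLIntegral_comp_preimage measurableSet_Iio measurable_invSqrt,
          lintegral_invSqrt_Iio hδ]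
    _ = 3 * volume A ^ (1 / 2 : ℝ) := by
        rw [hvol, ENNReal.ofReal_rpow_of_pos hδ, ← Real.sqrt_eq_rpow,
          ← ENNReal.ofReal_mul (by positivity), ← ENNReal.ofReal_add (by positivity) (by positivity),
          ← ENNReal.ofReal_ofNat 3, ← ENNReal.ofReal_mul (by positivity)]
        congr 1
        have := Real.mul_self_sqrt hδ.le
        have h2 : 0 < √δ := Real.sqrt_pos.2 hδ
        field_simp
        rw [Real.sq_sqrt hδ.le]
        ring

theorem setLIntegral_edgeWeight_le {A : Set ℝ} (hA : volume A < 1) :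
    ∫⁻ x in A, edgeWeight x ≤ 6 * volume A ^ (1 / 2 : ℝ) := by
  refine (lintegral_mono edgeWeight_le).trans ?_
  rw [lintegral_add_left (f := fun x => invSqrt (2 - x)) (measurable_invSqrt.comp (by fun_prop)),
    (by norm_num : (6 : ENNReal) = 3 + 3), add_mul]
  exact add_le_add
    (setLIntegral_invSqrt_comp_le (Measure.measurePreserving_sub_left volume 2) hA)
    (setLIntegral_invSqrt_comp_le (measurePreserving_add_left volume 2) hA)

theorem setLIntegral_edgeWeight_sq_le {t : ℝ} (ht : 2 < t) :
    ∫⁻ x in Set.Ioo (-2 + 1 / t) (2 - 1 / t), edgeWeight x ^ 2 ≤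
      ENNReal.ofReal (3 * Real.log t) := by
  have htinv : 0 < 1 / t := by positivity
  have htlt : 1 / t < 1 / 2 := one_div_lt_one_div_of_lt (by norm_num) ht
  set a := -2 + 1 / t
  set c := 2 - 1 / t
  have hac : a ≤ c := by simp only [a, c]; linarith
  set g : ℝ → ℝ := fun x => (1 / 4) * ((2 - x)⁻¹ + (2 + x)⁻¹)
  have hcg : ContinuousOn g (Set.Icc a c) := by
    refine continuousOn_const.mul (ContinuousOn.add (ContinuousOn.inv₀ (by fun_prop) fun x hx => ?_)
      (ContinuousOn.inv₀ (by fun_prop) fun x hx => ?_))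
    · have := hx.2; simp only [c] at this; linarith
    · have := hx.1; simp only [a] at this; linarith
  have hle : ∀ x ∈ Set.Ioo a c, edgeWeight x ^ 2 ≤ ENNReal.ofReal (g x) := fun x hx => by
    have h1 : 0 < 2 - x := by have := hx.2; simp only [c] at this; linarith
    have h2 : 0 < 2 + x := by have := hx.1; simp only [a] at this; linarith
    rw [edgeWeight, Set.indicator_of_mem (Set.mem_Ioo.2 ⟨by linarith, by linarith⟩),
      ← ENNReal.ofReal_pow (by positivity), inv_pow, Real.sq_sqrt (by nlinarith)]
    refine ENNReal.ofReal_le_ofReal (le_of_eq ?_)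
    have : 4 - x ^ 2 = (2 - x) * (2 + x) := by ring
    rw [this]
    simp only [g]
    field_simp
    ring
  refine (setLIntegral_mono' measurableSet_Ioo hle).trans ?_
  rw [← ofReal_integral_eq_lintegral_ofReal
    ((hcg.integrableOn_Icc).mono_set Set.Ioo_subset_Icc_self)
    ((ae_restrict_mem measurableSet_Ioo).mono fun x hx => ?_)]
  · refine ENNReal.ofReal_le_ofReal ?_
    rw [← integral_Ioc_eq_integral_Ioo, ← intervalIntegral.integral_of_le hac]
    have hi1 : IntervalIntegrable (fun x : ℝ => (2 - x)⁻¹) volume a c := by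
      refine ContinuousOn.intervalIntegrable_of_Icc hac (ContinuousOn.inv₀ (by fun_prop) fun x hx => ?_)
      have := hx.2; simp only [c] at this; linarith
    have hi2 : IntervalIntegrable (fun x : ℝ => (2 + x)⁻¹) volume a c := by
      refine ContinuousOn.intervalIntegrable_of_Icc hac (ContinuousOn.inv₀ (by fun_prop) fun x hx => ?_)
      have := hx.1; simp only [a] at this; linarith
    simp only [g]
    rw [intervalIntegral.integral_const_mul, intervalIntegral.integral_add hi1 hi2,
      intervalIntegral.integral_comp_sub_left (fun x => x⁻¹) 2,
      intervalIntegral.integral_comp_add_left (fun x => x⁻¹) 2]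
    have e1 : 2 - c = 1 / t := by simp only [c]; ring
    have e2 : 2 - a = 4 - 1 / t := by simp only [a]; ring
    have e3 : 2 + a = 1 / t := by simp only [a]; ring
    have e4 : 2 + c = 4 - 1 / t := by simp only [c]; ring
    rw [e1, e2, e3, e4, integral_inv_of_pos htinv (by linarith)]
    have h3 : (4 - 1 / t) / (1 / t) ≤ t ^ 3 := by
      rw [div_le_iff₀ htinv]
      have : t ^ 3 * (1 / t) = t ^ 2 := by field_simp
      rw [this]
      nlinarith
    have h4 := Real.log_le_log (div_pos (by linarith) htinv) h3
    rw [Real.log_pow] at h4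
    push_cast at h4
    have := Real.log_pos (by linarith : 1 < t)
    linarith
  · have h1 : 0 < 2 - x := by have := hx.2; simp only [c] at this; linarith
    have h2 : 0 < 2 + x := by have := hx.1; simp only [a] at this; linarith
    simp only [g, Pi.zero_apply]
    positivity

/-! ### Stieltjes inversion -/

theorem integral_mul_poissonKernel (f : ℝ → ℝ) {y : ℝ} (hy : 0 < y) (l : ℝ) :
    ∫ x, f x * (y / ((l - x) ^ 2 + y ^ 2)) = ∫ s, f (l + y * s) * (1 + s ^ 2)⁻¹ := by
  have h1 := integral_add_left_eq_self (μ := volume)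
    (fun x => f x * (y / ((l - x) ^ 2 + y ^ 2))) l
  have h2 := Measure.integral_comp_mul_left (fun x => f (l + x) * (y / ((l - (l + x)) ^ 2 + y ^ 2))) y
  rw [← h1]
  rw [abs_of_pos (inv_pos.2 hy), smul_eq_mul, eq_inv_mul_iff_mul_eq₀ hy.ne', ← integral_const_mul] at h2
  rw [← h2]
  refine integral_congr_ae (Eventually.of_forall fun s => ?_)
  simp only
  have h3 : 0 < 1 + s ^ 2 := by positivity
  have h4 : (l - (l + y * s)) ^ 2 + y ^ 2 = y ^ 2 * (1 + s ^ 2) := by ring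
  rw [h4]
  field_simp

theorem tendsto_integral_mul_poissonKernel {f : ℝ → ℝ} (hf : Continuous f) {C : ℝ}
    (hC : ∀ x, |f x| ≤ C) (l : ℝ) :
    Tendsto (fun y => ∫ x, f x * (y / ((l - x) ^ 2 + y ^ 2))) (𝓝[>] 0) (𝓝 (Real.pi * f l)) := by
  have h0 : Real.pi * f l = ∫ s : ℝ, f l * (1 + s ^ 2)⁻¹ := by
    rw [integral_const_mul, integral_univ_inv_one_add_sq, mul_comm]
  rw [h0]
  refine Tendsto.congr' (f₁ := fun y => ∫ s, f (l + y * s) * (1 + s ^ 2)⁻¹) ?_ ?_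
  · filter_upwards [self_mem_nhdsWithin] with y hy
    exact (integral_mul_poissonKernel f hy l).symm
  · refine tendsto_integral_filter_of_dominated_convergence (fun s => C * (1 + s ^ 2)⁻¹)
      (Eventually.of_forall fun y => Measurable.aestronglyMeasurable (by fun_prop))
      (Eventually.of_forall fun y => Eventually.of_forall fun s => ?_)
      (integrable_inv_one_add_sq.const_mul C) (Eventually.of_forall fun s => ?_)
    · rw [norm_mul, Real.norm_of_nonneg (by positivity : 0 ≤ (1 + s ^ 2)⁻¹)]
      gcongr
      exact hC _
    · refine Tendsto.mul_const _ (Tendsto.mono_left ?_ nhdsWithin_le_nhds)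
      have : Continuous fun y : ℝ => f (l + y * s) := by fun_prop
      simpa using this.tendsto 0

theorem poissonKernel_nonneg {y : ℝ} (hy : 0 < y) (l x : ℝ) : 0 ≤ y / ((l - x) ^ 2 + y ^ 2) := by
  positivity

theorem poissonKernel_le {y : ℝ} (hy : 0 < y) (l x : ℝ) : y / ((l - x) ^ 2 + y ^ 2) ≤ y⁻¹ := by
  rw [div_le_iff₀ (by positivity)]
  have : y⁻¹ * y ^ 2 = y := by field_simp
  have h2 : 0 ≤ y⁻¹ * (l - x) ^ 2 := by positivity
  nlinarith

/-- Stieltjes inversion: the Poisson transform of a finite measure converges weakly to `π` times the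
measure. -/
theorem tendsto_integral_mul_poissonTransform (μ : Measure ℝ) [IsFiniteMeasure μ] {f : ℝ → ℝ}
    (hf : Continuous f) (hfc : HasCompactSupport f) :
    Tendsto (fun y => ∫ x, f x * ∫ l, y / ((l - x) ^ 2 + y ^ 2) ∂μ) (𝓝[>] 0)
      (𝓝 (Real.pi * ∫ x, f x ∂μ)) := by
  obtain ⟨C, hC⟩ := hfc.exists_bound_of_continuous hf
  have hC' : ∀ x, |f x| ≤ C := hC
  refine Tendsto.congr' (f₁ := fun y => ∫ l, (∫ x, f x * (y / ((l - x) ^ 2 + y ^ 2))) ∂μ) ?_ ?_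
  · filter_upwards [self_mem_nhdsWithin] with y hy
    have hy : 0 < y := hy
    simp only [← integral_const_mul]
    refine (integral_integral_swap ?_).symm
    have h1 : Integrable (fun p : ℝ × ℝ => f p.1 * y⁻¹) (volume.prod μ) :=
      (hf.integrable_of_hasCompactSupport hfc).mul_prod (integrable_const _)
    refine h1.mono (Measurable.aestronglyMeasurable (by fun_prop)) (Eventually.of_forall fun p => ?_)
    simp only [Function.uncurry, norm_mul]
    gcongr
    rw [Real.norm_of_nonneg (poissonKernel_nonneg hy _ _), Real.norm_of_nonneg (by positivity)]
    exact poissonKernel_le hy _ _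
  · rw [← integral_const_mul]
    refine tendsto_integral_filter_of_dominated_convergence (fun _ => C * Real.pi)
      ?_ ?_ (integrable_const _)
      (Eventually.of_forall fun l => tendsto_integral_mul_poissonKernel hf hC' l)
    · refine Eventually.of_forall fun y => StronglyMeasurable.aestronglyMeasurable ?_
      refine StronglyMeasurable.integral_prod_right (f := fun l x =>
        f x * (y / ((l - x) ^ 2 + y ^ 2))) (Measurable.stronglyMeasurable ?_)
      unfold Function.uncurry
      fun_prop
    · filter_upwards [self_mem_nhdsWithin] with y hy
      refine Eventually.of_forall fun l => ?_
      rw [integral_mul_poissonKernel f hy l, ← integral_univ_inv_one_add_sq, ← integral_const_mul]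
      refine norm_integral_le_of_norm_le (integrable_inv_one_add_sq.const_mul C)
        (Eventually.of_forall fun s => ?_)
      rw [norm_mul, Real.norm_of_nonneg (by positivity : 0 ≤ (1 + s ^ 2)⁻¹)]
      gcongr
      exact hC _

/-- Two measures that agree after multiplication by `χ` agree where `χ` does not vanish. -/
theorem restrict_eq_of_integral_eq {μ ν : Measure ℝ} [IsFiniteMeasure μ] [IsFiniteMeasure ν]
    {χ : ℝ → ℝ} (hχ : Continuous χ) (hχ0 : ∀ x, 0 ≤ χ x) (hχc : HasCompactSupport χ)
    (h : ∀ f : ℝ → ℝ, Continuous f → HasCompactSupport f →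
      ∫ x, χ x * f x ∂μ = ∫ x, χ x * f x ∂ν) :
    μ.restrict {x | χ x ≠ 0} = ν.restrict {x | χ x ≠ 0} := by
  have hm : Measurable fun x => ENNReal.ofReal (χ x) := by fun_prop
  have hset : MeasurableSet {x | χ x ≠ 0} := (isOpen_ne_fun hχ continuous_const).measurableSet
  obtain ⟨C, hC⟩ := hχc.exists_bound_of_continuous hχ
  have hfin : ∀ μ : Measure ℝ, IsFiniteMeasure μ →
      IsFiniteMeasure (μ.withDensity fun x => ENNReal.ofReal (χ x)) := fun μ _ =>
    isFiniteMeasure_withDensity_ofReal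
      (Integrable.of_bound hχ.aestronglyMeasurable C (Eventually.of_forall hC)).2
  have hμ := hfin μ inferInstance
  have hν := hfin ν inferInstance
  have heq : μ.withDensity (fun x => ENNReal.ofReal (χ x)) =
      ν.withDensity fun x => ENNReal.ofReal (χ x) := by
    refine Measure.ext_of_integral_eq_on_compactlySupported fun f => ?_
    rw [integral_withDensity_eq_integral_toReal_smul hm (Eventually.of_forall fun _ => by finiteness),
      integral_withDensity_eq_integral_toReal_smul hm (Eventually.of_forall fun _ => by finiteness)]
    simp only [ENNReal.toReal_ofReal (hχ0 _), smul_eq_mul]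
    exact h f f.continuous f.hasCompactSupport
  have hinv : ∀ μ : Measure ℝ, ((μ.withDensity fun x => ENNReal.ofReal (χ x)).restrict
      {x | χ x ≠ 0}).withDensity (fun x => ENNReal.ofReal (χ x))⁻¹ = μ.restrict {x | χ x ≠ 0} :=
    fun μ => by
    rw [restrict_withDensity hset]
    refine withDensity_inv_same hm ((ae_restrict_mem hset).mono fun x hx => ?_)
      (Eventually.of_forall fun _ => by finiteness)
    exact (ENNReal.ofReal_pos.2 ((hχ0 x).lt_of_ne' hx)).ne'
  rw [← hinv μ, heq, hinv ν]

/-- If the Poisson transform of `μ` extends continuously up to the real interval `(-2, 2)`, then on that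
interval `μ` has the boundary values divided by `π` as density. -/
theorem restrict_eq_withDensity_of_poissonTransform (μ : Measure ℝ) [IsFiniteMeasure μ]
    {M : ℝ × ℝ → ℝ} (hM : ContinuousOn M (Set.Ioo (-2 : ℝ) 2 ×ˢ Set.Ici 0))
    (hM0 : ∀ x ∈ Set.Ioo (-2 : ℝ) 2, 0 ≤ M (x, 0))
    (hP : ∀ x ∈ Set.Ioo (-2 : ℝ) 2, ∀ y > 0, ∫ l, y / ((l - x) ^ 2 + y ^ 2) ∂μ = M (x, y)) :
    μ.restrict (Set.Ioo (-2) 2) = volume.withDensity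
      ((Set.Ioo (-2 : ℝ) 2).indicator fun x => ENNReal.ofReal (M (x, 0) / Real.pi)) := by
  rw [withDensity_indicator measurableSet_Ioo, ← restrict_withDensity measurableSet_Ioo]
  have hcont0 : ContinuousOn (fun x => M (x, 0)) (Set.Ioo (-2 : ℝ) 2) :=
    hM.comp (by fun_prop) fun x hx => ⟨hx, Set.self_mem_Ici⟩
  have hunion : Set.Ioo (-2 : ℝ) 2 = ⋃ n : ℕ, Set.Ioo (-(2 - 1 / ((n : ℝ) + 1))) (2 - 1 / ((n : ℝ) + 1)) := by
    ext x
    simp only [Set.mem_iUnion, Set.mem_Ioo, ← abs_lt]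
    constructor
    · intro hx
      obtain ⟨n, hn⟩ := exists_nat_one_div_lt (sub_pos.2 hx)
      exact ⟨n, by linarith⟩
    · rintro ⟨n, hn⟩
      have : 0 < 1 / ((n : ℝ) + 1) := by positivity
      linarith
  -- The boundary values may blow up at `±2`, so the inversion is done on the intervals `(-r, r)`.
  rw [hunion, Measure.restrict_iUnion_congr]
  intro n
  have hr0 : 0 < 1 / ((n : ℝ) + 1) := by positivity
  have hr1 : 1 / ((n : ℝ) + 1) ≤ 1 := by
    rw [div_le_one (by positivity)]
    have := n.cast_nonneg (α := ℝ)
    linarith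
  set r : ℝ := 2 - 1 / ((n : ℝ) + 1)
  have hr : 0 < r := by simp only [r]; linarith
  have hr2 : r < 2 := by simp only [r]; linarith
  have hsub : Set.Icc (-r) r ⊆ Set.Ioo (-2) 2 := fun x hx => ⟨by linarith [hx.1], by linarith [hx.2]⟩
  set χ : ℝ → ℝ := fun x => max 0 (r - |x|)
  have hχ : Continuous χ := by fun_prop
  have hχs : ∀ x, x ∉ Set.Icc (-r) r → χ x = 0 := fun x hx => by
    rw [Set.mem_Icc, ← abs_le, not_le] at hx
    exact max_eq_left (by linarith)
  have hset : {x | χ x ≠ 0} = Set.Ioo (-r) r := by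
    ext x
    rw [Set.mem_Ioo, ← abs_lt, Set.mem_ofPred_eq]
    constructor
    · intro h
      by_contra! hx
      exact h (max_eq_left (by linarith))
    · intro h
      exact (lt_max_of_lt_right (by linarith)).ne'
  set D : ℝ → ENNReal := fun x => ENNReal.ofReal (M (x, 0) / Real.pi)
  have hint0 : IntegrableOn (fun x => M (x, 0) / Real.pi) (Set.Icc (-r) r) :=
    ((hcont0.mono hsub).div_const _).integrableOn_Icc
  set ν : Measure ℝ := (volume.restrict (Set.Icc (-r) r)).withDensity D with hν
  have hfin : IsFiniteMeasure ν := isFiniteMeasure_withDensity_ofReal hint0.2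
  have key := restrict_eq_of_integral_eq (μ := μ) (ν := ν) hχ (fun x => le_max_left _ _)
    (HasCompactSupport.intro isCompact_Icc hχs) ?_
  · rw [hset] at key
    have hres : ∀ m : Measure ℝ, (m.restrict (Set.Icc (-r) r)).restrict (Set.Ioo (-r) r) =
        m.restrict (Set.Ioo (-r) r) := fun m =>
      Measure.restrict_restrict_of_subset Set.Ioo_subset_Icc_self
    rw [key, hν, restrict_withDensity measurableSet_Ioo, hres,
      restrict_withDensity measurableSet_Ioo]
  · intro f hf hfc
    have hcc : HasCompactSupport fun x => χ x * f x := hfc.mul_left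
    have h1 := tendsto_integral_mul_poissonTransform μ (hχ.mul hf) hcc
    have h2 : Tendsto (fun y => ∫ x, χ x * f x * ∫ l, y / ((l - x) ^ 2 + y ^ 2) ∂μ) (𝓝[>] 0)
        (𝓝 (∫ x in Set.Icc (-r) r, χ x * f x * M (x, 0))) := by
      refine Tendsto.congr' (f₁ := fun y => ∫ x in Set.Icc (-r) r, χ x * f x * M (x, y)) ?_ ?_
      · filter_upwards [self_mem_nhdsWithin] with y hy
        refine Eq.trans (setIntegral_congr_fun measurableSet_Icc fun x hx => ?_)
          (setIntegral_eq_integral_of_forall_compl_eq_zero (s := Set.Icc (-r) r)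
            (f := fun x => χ x * f x * ∫ l, y / ((l - x) ^ 2 + y ^ 2) ∂μ) fun x hx => ?_)
        · rw [hP x (hsub hx) y hy]
        · rw [hχs x hx, zero_mul, zero_mul]
      · have hcomp : IsCompact (Set.Icc (-r) r ×ˢ Set.Icc (0 : ℝ) 1) := isCompact_Icc.prod isCompact_Icc
        have hMc : ContinuousOn M (Set.Icc (-r) r ×ˢ Set.Icc (0 : ℝ) 1) :=
          hM.mono (Set.prod_mono hsub Set.Icc_subset_Ici_self)
        obtain ⟨B, hB⟩ := hcomp.exists_bound_of_continuousOn hMc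
        obtain ⟨C, hC⟩ := hcc.exists_bound_of_continuous (hχ.mul hf)
        have hev : ∀ᶠ y : ℝ in 𝓝[>] 0, y ∈ Set.Icc (0 : ℝ) 1 := by
          filter_upwards [Ioo_mem_nhdsGT (zero_lt_one' ℝ)] with y hy using ⟨hy.1.le, hy.2.le⟩
        refine tendsto_integral_filter_of_dominated_convergence (fun _ => C * B) ?_ ?_
          (integrable_const _) ?_
        · filter_upwards [hev] with y hy
          refine ContinuousOn.aestronglyMeasurable ?_ measurableSet_Icc
          refine (hχ.mul hf).continuousOn.mul (hMc.comp (by fun_prop) fun x hx => ⟨hx, hy⟩)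
        · filter_upwards [hev] with y hy
          refine (ae_restrict_mem measurableSet_Icc).mono fun x hx => ?_
          rw [norm_mul]
          have h3 := hC x
          have h4 := hB (x, y) ⟨hx, hy⟩
          have h5 : 0 ≤ C := (norm_nonneg _).trans h3
          gcongr
        · refine (ae_restrict_mem measurableSet_Icc).mono fun x hx => Tendsto.const_mul _ ?_
          have h3 := hM (x, 0) ⟨hsub hx, Set.self_mem_Ici⟩
          refine h3.tendsto.comp (tendsto_nhdsWithin_iff.2 ⟨?_, ?_⟩)
          · refine Tendsto.mono_left ?_ nhdsWithin_le_nhds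
            exact (by fun_prop : Continuous fun y : ℝ => (x, y)).tendsto 0
          · filter_upwards [self_mem_nhdsWithin] with y hy using ⟨hsub hx, Set.mem_Ici.2 (le_of_lt hy)⟩
    have h3 := tendsto_nhds_unique h1 h2
    have hm : AEMeasurable D (volume.restrict (Set.Icc (-r) r)) :=
      hint0.aemeasurable.ennreal_ofReal
    rw [hν, integral_withDensity_eq_integral_toReal_smul₀ hm
      (Eventually.of_forall fun _ => by finiteness), ← mul_right_inj' Real.pi_ne_zero]
    refine h3.trans ?_
    rw [← integral_const_mul]
    refine (setIntegral_congr_fun measurableSet_Icc fun x hx => ?_)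
    have h4 := hM0 x (hsub hx)
    simp only [D, smul_eq_mul]
    rw [ENNReal.toReal_ofReal (by positivity)]
    field_simp

/-! ### The half-line operator and its Weyl function -/

/-- The potential as a function on `ℕ`, with value `0` at `0`. -/
def extendPotential (V : ℕ+ → ℝ) (n : ℕ) : ℝ := if h : 0 < n then V ⟨n, h⟩ else 0

section HalfLineOperator

variable {β : ℝ} {V : lp (fun _ : ℕ+ => ℝ) ⊤}

theorem halfLineSchrodinger_apply (φ : HalfLineSpace) (k : ℕ) :
    halfLineSchrodinger β V φ k.succPNat = boundaryExtension β φ (k + 2) +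
      boundaryExtension β φ k + extendPotential V (k + 1) * boundaryExtension β φ (k + 1) := rfl

theorem boundaryExtension_succ (φ : ℕ+ → ℂ) (k : ℕ) :
    boundaryExtension β φ (k + 1) = φ k.succPNat := rfl

theorem boundaryExtension_zero (φ : ℕ+ → ℂ) :
    boundaryExtension β φ 0 = -(Real.tan β : ℂ) * φ 1 := rfl

theorem halfLineSpace_ext {φ ψ : HalfLineSpace} (h : ∀ k : ℕ, φ k.succPNat = ψ k.succPNat) : φ = ψ := by
  ext n
  have := h (n.natPred)
  rwa [PNat.succPNat_natPred] at this

theorem inner_delta1 (φ : HalfLineSpace) : ⟪delta1, φ⟫_ℂ = φ 1 := by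
  rw [delta1, lp.inner_single_left]
  simp

/-- A vector orthogonal to the cyclic subspace of `δ₁` vanishes at `1`, as do its images under the
operator, so that the recurrence determines it to be zero. -/
theorem isCyclicVector_delta1 : IsCyclicVector (halfLineSchrodinger β V) delta1 := by
  intro p hclosed hmem hinv
  have hsymm := ContinuousLinearMap.isSelfAdjoint_iff_isSymmetric.1
    (isSelfAdjoint_halfLineSchrodinger β V)
  have hp : IsComplete (p : Set HalfLineSpace) := hclosed.isComplete
  have : CompleteSpace p := completeSpace_coe_iff_isComplete.2 hp
  rw [← Submodule.orthogonal_eq_bot_iff, Submodule.eq_bot_iff]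
  have hinv' : ∀ φ ∈ pᗮ, halfLineSchrodinger β V φ ∈ pᗮ := fun φ hφ => by
    rw [Submodule.mem_orthogonal] at hφ ⊢
    intro u hu
    exact (hsymm u φ).symm.trans (hφ _ (hinv u hu))
  have hone : ∀ φ ∈ pᗮ, φ 1 = 0 := fun φ hφ => by
    rw [← inner_delta1]
    exact (Submodule.mem_orthogonal _ _).1 hφ _ hmem
  have hall : ∀ k : ℕ, ∀ φ ∈ pᗮ, boundaryExtension β φ k = 0 ∧ boundaryExtension β φ (k + 1) = 0 := by
    intro k
    induction k with
    | zero =>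
      intro φ hφ
      have := hone φ hφ
      exact ⟨by rw [boundaryExtension_zero, this, mul_zero], this⟩
    | succ k ih =>
      intro φ hφ
      refine ⟨(ih φ hφ).2, ?_⟩
      have h1 := (ih _ (hinv' φ hφ)).2
      rw [boundaryExtension_succ, halfLineSchrodinger_apply, (ih φ hφ).1, (ih φ hφ).2] at h1
      simpa using h1
  exact fun φ hφ => halfLineSpace_ext fun k => (hall k φ hφ).2

theorem tendsto_boundaryExtension (φ : HalfLineSpace) :
    Tendsto (boundaryExtension β φ) atTop (𝓝 0) := by
  have h := (summable_boundaryExtension β φ).tendsto_atTop_zero.sqrt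
  rw [Real.sqrt_zero] at h
  rw [tendsto_zero_iff_norm_tendsto_zero]
  refine h.congr fun n => ?_
  rw [ENNReal.toReal_ofNat, Real.rpow_two, Real.sqrt_sq (norm_nonneg _)]

variable {φ : ℕ → ℂ → ℂ} (h : IsJostFamily (extendPotential V) φ)
include h

theorem eigenvector_apply_one_eq_zero {ζ : ℂ} (hζ : ‖ζ‖ = 1) {ψ : HalfLineSpace}
    (hψ : halfLineSchrodinger β V ψ = (ζ + ζ⁻¹) • ψ) : ψ 1 = 0 := by
  refine h.eq_zero_of_tendsto_zero hζ (tendsto_boundaryExtension (β := β) ψ) (fun n => ?_) 1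
  rw [← halfLineSchrodinger_apply, hψ]
  rfl

theorem memlp_jostSol {ζ : ℂ} (hζ : ‖ζ‖ < 1) :
    Memℓp (fun n : ℕ+ => jostSol φ n ζ) 2 := by
  refine memℓp_gen ?_
  refine (Equiv.pnatEquivNat.symm.summable_iff.1 ?_)
  have hgeom : Summable fun k : ℕ => (4 / 3) ^ 2 * (‖ζ‖ ^ 2) ^ k :=
    (summable_geometric_of_lt_one (by positivity) (by nlinarith [norm_nonneg ζ])).mul_left _
  refine Summable.of_nonneg_of_le (fun k => Real.rpow_nonneg (norm_nonneg _) _) (fun k => ?_) hgeom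
  have h1 := h.norm_jostSol_le (n := k + 1) hζ.le
  have h2 : ‖ζ‖ ^ (k + 1) ≤ ‖ζ‖ ^ k := pow_le_pow_of_le_one (norm_nonneg _) hζ.le (Nat.le_succ k)
  have h3 : ((Equiv.pnatEquivNat.symm k : ℕ+) : ℕ) = k + 1 := by simp
  simp only [Function.comp, h3]
  rw [ENNReal.toReal_ofNat, Real.rpow_two, ← pow_mul, mul_comm 2 k, pow_mul, ← mul_pow]
  gcongr
  exact h1.trans (by gcongr)

/-- Inside the disc the Jost solution is square summable, and the operator maps it to a multiple of
itself up to the failure of the boundary condition, which is measured by the Jost function. -/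
theorem exists_jostVector {ζ : ℂ} (hζ : ‖ζ‖ < 1) (hζ0 : ζ ≠ 0) :
    ∃ u : HalfLineSpace, u 1 = jostSol φ 1 ζ ∧ u ≠ 0 ∧
      halfLineSchrodinger β V u = (ζ + ζ⁻¹) • u - jostFun φ (Real.tan β) ζ • delta1 := by
  set u : HalfLineSpace := ⟨fun n : ℕ+ => jostSol φ n ζ, memlp_jostSol h hζ⟩
  have hu : ∀ k, boundaryExtension β u (k + 1) = jostSol φ (k + 1) ζ := fun k => rfl
  have hu' : ∀ k : ℕ, u k.succPNat = jostSol φ (k + 1) ζ := fun k => rfl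
  have hu0 : boundaryExtension β u 0 = jostSol φ 0 ζ - jostFun φ (Real.tan β) ζ := by
    rw [boundaryExtension_zero, jostFun]
    change -(Real.tan β : ℂ) * jostSol φ 1 ζ = _
    ring
  refine ⟨u, rfl, fun h0 => ?_, halfLineSpace_ext fun k => ?_⟩
  · have h1 : jostSol φ 1 ζ = 0 := by
      have := hu' 0
      rw [h0] at this
      exact this.symm
    rw [jostSol, mul_eq_zero, or_iff_right (pow_ne_zero _ hζ0)] at h1
    have h2 := h.norm_sub_one_le 1 ζ hζ.le
    rw [h1, zero_sub, norm_neg, norm_one] at h2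
    norm_num at h2
  · have hrec := h.jostSol_recurrence hζ.le hζ0 k
    have hd : ∀ k : ℕ, delta1 k.succPNat = if k = 0 then 1 else 0 := fun k => by
      rw [delta1, lp.single_apply]
      rcases k with _ | k
      · exact Pi.single_eq_same _ _
      · rw [if_neg (Nat.succ_ne_zero k), Pi.single_apply, if_neg]
        intro h3
        have := congrArg PNat.val h3
        simp at this
    rw [halfLineSchrodinger_apply, hu (k + 1), lp.coeFn_sub, lp.coeFn_smul, lp.coeFn_smul, Pi.sub_apply,
      Pi.smul_apply, Pi.smul_apply, hu', hd, smul_eq_mul, smul_eq_mul, ← hrec]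
    rcases k with _ | k
    · rw [hu0, hu 0, if_pos rfl]
      ring
    · rw [hu k, hu (k + 1), if_neg (Nat.succ_ne_zero k)]
      ring

/-- A zero of the Jost function would be a non-real eigenvalue of a self-adjoint operator. -/
theorem jostFun_ne_zero_of_im_ne_zero {ζ : ℂ} (hζ : ‖ζ‖ < 1) (hζ0 : ζ ≠ 0) (him : (ζ + ζ⁻¹).im ≠ 0) :
    jostFun φ (Real.tan β) ζ ≠ 0 := by
  intro h0
  obtain ⟨u, -, hu0, hu⟩ := exists_jostVector (β := β) h hζ hζ0
  rw [h0, zero_smul, sub_zero] at hu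
  have hsymm := ContinuousLinearMap.isSelfAdjoint_iff_isSymmetric.1
    (isSelfAdjoint_halfLineSchrodinger β V)
  have hev : Module.End.HasEigenvalue (halfLineSchrodinger β V : HalfLineSpace →ₗ[ℂ] HalfLineSpace)
      (ζ + ζ⁻¹) :=
    Module.End.hasEigenvalue_of_hasEigenvector ⟨Module.End.mem_eigenspace_iff.2 hu, hu0⟩
  exact him (Complex.conj_eq_iff_im.1 (hsymm.conj_eigenvalue_eq_self hev))

/-- The Weyl function: the Stieltjes transform of the spectral measure of `δ₁` is `-u(1)/F`. -/
theorem integral_inv_sub_eq {ζ : ℂ} (hζ : ‖ζ‖ < 1) (hζ0 : ζ ≠ 0) (him : (ζ + ζ⁻¹).im ≠ 0) :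
    ∫ x : ℝ, ((x : ℂ) - (ζ + ζ⁻¹))⁻¹ ∂(spectralMeasure (halfLineSchrodinger β V) delta1) =
      -(jostSol φ 1 ζ / jostFun φ (Real.tan β) ζ) := by
  have hH := isSelfAdjoint_halfLineSchrodinger β V
  obtain ⟨U, hU⟩ := exists_spectralRepresentation hH (isCyclicVector_delta1 (β := β) (V := V))
  obtain ⟨u, hu1, -, hu⟩ := exists_jostVector (β := β) h hζ hζ0
  have hF := jostFun_ne_zero_of_im_ne_zero (β := β) h hζ hζ0 him
  set F := jostFun φ (Real.tan β) ζ
  have h1 := representation_symm_apply_operator hH hU u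
  rw [hu, map_sub, map_smul, map_smul] at h1
  have h2 : U.symm u =ᵐ[spectralMeasure (halfLineSchrodinger β V) delta1]
      fun x => -F * ((x : ℂ) - (ζ + ζ⁻¹))⁻¹ := by
    filter_upwards [h1, Lp.coeFn_sub ((ζ + ζ⁻¹) • U.symm u) (F • U.symm delta1),
      Lp.coeFn_smul (ζ + ζ⁻¹) (U.symm u), Lp.coeFn_smul F (U.symm delta1),
      representation_symm_base hH hU] with x e1 e2 e3 e4 e5
    rw [e2, Pi.sub_apply, e3, e4, Pi.smul_apply, Pi.smul_apply, e5, smul_eq_mul, smul_eq_mul] at e1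
    have hne : (x : ℂ) - (ζ + ζ⁻¹) ≠ 0 := fun h0 => him (by
      rw [← sub_eq_zero.1 h0, Complex.ofReal_im])
    rw [← div_eq_mul_inv, eq_div_iff hne]
    linear_combination -e1
  have h3 := inner_base_eq_integral hH hU u
  rw [inner_delta1, hu1, integral_congr_ae h2, integral_const_mul] at h3
  rw [h3, neg_mul, neg_div, neg_neg, mul_div_cancel_left₀ _ hF]

theorem poissonTransform_spectralMeasure {ζ : ℂ} (hζ : ‖ζ‖ < 1) (hζ0 : ζ ≠ 0) {x y : ℝ} (hy : 0 < y)
    (hz : ζ + ζ⁻¹ = x + y * Complex.I) :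
    ∫ l, y / ((l - x) ^ 2 + y ^ 2) ∂(spectralMeasure (halfLineSchrodinger β V) delta1) =
      (-(jostSol φ 1 ζ / jostFun φ (Real.tan β) ζ)).im := by
  have him : (ζ + ζ⁻¹).im ≠ 0 := by rw [hz]; simpa using hy.ne'
  rw [← integral_inv_sub_eq h hζ hζ0 him]
  have hne : ∀ l : ℝ, (l : ℂ) - (x + y * Complex.I) ≠ 0 := fun l h0 => by
    have := congrArg Complex.im h0
    simp at this
    exact hy.ne' this
  have hform : ∀ l : ℝ, y / ((l - x) ^ 2 + y ^ 2) =
      RCLike.im (((l : ℂ) - (ζ + ζ⁻¹))⁻¹) := fun l => by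
    rw [hz]
    change _ = (((l : ℂ) - (x + y * Complex.I))⁻¹).im
    rw [Complex.inv_im, Complex.normSq_apply]
    simp
    ring
  have hint : Integrable (fun l : ℝ => ((l : ℂ) - (ζ + ζ⁻¹))⁻¹)
      (spectralMeasure (halfLineSchrodinger β V) delta1) := by
    refine Integrable.of_bound (Continuous.aestronglyMeasurable ?_) y⁻¹ (Eventually.of_forall fun l => ?_)
    · rw [hz]
      exact Continuous.inv₀ (by fun_prop) hne
    · rw [hz, norm_inv]
      refine inv_anti₀ hy ?_
      refine le_trans ?_ (Complex.abs_im_le_norm _)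
      simp [abs_of_pos hy]
  simp only [hform]
  exact integral_im hint

end HalfLineOperator

/-! ### Boundary values of the Weyl function and the spectral density -/

/-- The root `ζ` of `ζ + ζ⁻¹ = z` in the closed unit disc, for `z` in the closed upper half-plane with
real part in `(-2, 2)`. There `4 - z ^ 2` has positive real part, away from the branch cut of the
square root. -/
noncomputable def joukowskyRoot (z : ℂ) : ℂ := (z - Complex.I * Complex.sqrt (4 - z ^ 2)) / 2

theorem complex_sqrt_sq (w : ℂ) : Complex.sqrt w ^ 2 = w := by
  simp [Complex.sqrt]

theorem joukowskyRoot_mul (z : ℂ) :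
    joukowskyRoot z * ((z + Complex.I * Complex.sqrt (4 - z ^ 2)) / 2) = 1 := by
  rw [joukowskyRoot]
  linear_combination (1 / 4) * complex_sqrt_sq (4 - z ^ 2) -
    (1 / 4) * Complex.sqrt (4 - z ^ 2) ^ 2 * Complex.I_sq

theorem joukowskyRoot_ne_zero (z : ℂ) : joukowskyRoot z ≠ 0 :=
  left_ne_zero_of_mul_eq_one (joukowskyRoot_mul z)

theorem joukowskyRoot_add_inv (z : ℂ) : joukowskyRoot z + (joukowskyRoot z)⁻¹ = z := by
  rw [inv_eq_of_mul_eq_one_right (joukowskyRoot_mul z), joukowskyRoot]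
  ring

theorem re_four_sub_sq {x : ℝ} (hx : x ∈ Set.Ioo (-2 : ℝ) 2) (y : ℝ) :
    0 < (4 - ((x : ℂ) + y * Complex.I) ^ 2).re := by
  have h : (4 - ((x : ℂ) + y * Complex.I) ^ 2).re = 4 - x ^ 2 + y ^ 2 := by
    simp [sq]
    ring
  rw [h]
  nlinarith [hx.1, hx.2, sq_nonneg y]

theorem re_sqrt_pos {w : ℂ} (hw : 0 < w.re) : 0 < (Complex.sqrt w).re := by
  rw [Complex.sqrt, Complex.cpow_inv_two_re]
  have := norm_nonneg w
  positivity

/-- The two roots of `ζ + ζ⁻¹ = z` have product one. This identity decides which of them lies in the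
disc. -/
theorem normSq_inv_sub_normSq_joukowskyRoot (z : ℂ) :
    Complex.normSq ((z + Complex.I * Complex.sqrt (4 - z ^ 2)) / 2) - Complex.normSq (joukowskyRoot z) =
      z.im * (Complex.sqrt (4 - z ^ 2)).re - z.re * (Complex.sqrt (4 - z ^ 2)).im := by
  rw [joukowskyRoot, Complex.normSq_div, Complex.normSq_div]
  simp only [Complex.normSq_apply, Complex.add_re, Complex.add_im, Complex.sub_re, Complex.sub_im,
    Complex.mul_re, Complex.mul_im, Complex.I_re, Complex.I_im, Complex.re_ofNat, Complex.im_ofNat]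
  ring

theorem re_mul_im_sqrt (z : ℂ) :
    (Complex.sqrt (4 - z ^ 2)).re * (Complex.sqrt (4 - z ^ 2)).im = -(z.re * z.im) := by
  have h := congrArg Complex.im (complex_sqrt_sq (4 - z ^ 2))
  have h2 : (4 - z ^ 2).im = -(2 * (z.re * z.im)) := by
    simp [sq]
    ring
  rw [h2, pow_two (Complex.sqrt (4 - z ^ 2)), Complex.mul_im] at h
  linarith

theorem norm_joukowskyRoot_lt_one {x y : ℝ} (hx : x ∈ Set.Ioo (-2 : ℝ) 2) (hy : 0 < y) :
    ‖joukowskyRoot (x + y * Complex.I)‖ < 1 := by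
  set z : ℂ := x + y * Complex.I with hz
  have hre : z.re = x := by simp [hz]
  have him : z.im = y := by simp [hz]
  have hp := re_sqrt_pos (re_four_sub_sq hx y)
  rw [← hz] at hp
  have h1 := normSq_inv_sub_normSq_joukowskyRoot z
  have h2 := re_mul_im_sqrt z
  have h3 := congrArg Complex.normSq (joukowskyRoot_mul z)
  rw [Complex.normSq_mul, map_one] at h3
  rw [hre, him] at h1 h2
  set p := (Complex.sqrt (4 - z ^ 2)).re
  set q := (Complex.sqrt (4 - z ^ 2)).im
  have h4 : 0 < y * p - x * q := by
    have : 0 < p * (y * p - x * q) := by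
      have : p * (y * p - x * q) = y * p ^ 2 + x ^ 2 * y := by linear_combination -x * h2
      rw [this]
      positivity
    exact pos_of_mul_pos_right this hp.le
  rw [← h1] at h4
  have h5 := Complex.normSq_nonneg (joukowskyRoot z)
  have h6 : Complex.normSq (joukowskyRoot z) < 1 := by nlinarith
  rw [Complex.normSq_eq_norm_sq] at h6
  exact (sq_lt_one_iff₀ (norm_nonneg _)).1 h6

theorem joukowskyRoot_ofReal {x : ℝ} (hx : x ∈ Set.Ioo (-2 : ℝ) 2) :
    ‖joukowskyRoot x‖ = 1 ∧ (joukowskyRoot x).im = -(√(4 - x ^ 2) / 2) := by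
  have hpos : 0 < 4 - x ^ 2 := by nlinarith [hx.1, hx.2]
  have hs : Complex.sqrt (4 - (x : ℂ) ^ 2) = (√(4 - x ^ 2) : ℝ) := by
    have h1 : (4 : ℂ) - (x : ℂ) ^ 2 = ((4 - x ^ 2 : ℝ) : ℂ) := by push_cast; rfl
    rw [h1]
    exact Complex.sqrt_of_nonneg (by exact_mod_cast hpos.le)
  have h1 := normSq_inv_sub_normSq_joukowskyRoot x
  rw [hs, Complex.ofReal_im, Complex.ofReal_im, mul_zero, zero_mul, sub_zero, sub_eq_zero] at h1
  have h3 := congrArg Complex.normSq (joukowskyRoot_mul x)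
  rw [Complex.normSq_mul, map_one, hs, h1, ← sq] at h3
  constructor
  · rw [Complex.normSq_eq_norm_sq, ← pow_mul] at h3
    exact (pow_eq_one_iff_of_nonneg (norm_nonneg _) (by norm_num)).1 h3
  · rw [joukowskyRoot, hs]
    simp
    ring

theorem continuousOn_joukowskyRoot :
    ContinuousOn (fun p : ℝ × ℝ => joukowskyRoot (p.1 + p.2 * Complex.I))
      (Set.Ioo (-2 : ℝ) 2 ×ˢ Set.Ici 0) := by
  intro p hp
  refine ContinuousAt.continuousWithinAt ?_
  unfold joukowskyRoot Complex.sqrt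
  refine ContinuousAt.div_const (ContinuousAt.sub (by fun_prop) (continuousAt_const.mul ?_)) _
  exact ContinuousAt.cpow (by fun_prop) continuousAt_const (Or.inl (re_four_sub_sq hp.1 p.2))

theorem norm_joukowskyRoot_le_one {p : ℝ × ℝ} (hp : p ∈ Set.Ioo (-2 : ℝ) 2 ×ˢ Set.Ici (0 : ℝ)) :
    ‖joukowskyRoot (p.1 + p.2 * Complex.I)‖ ≤ 1 := by
  rcases (Set.mem_Ici.1 hp.2).eq_or_lt with h | h
  · rw [← h]
    simpa using (joukowskyRoot_ofReal hp.1).1.le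
  · exact (norm_joukowskyRoot_lt_one hp.1 h).le

section SpectralDensity

variable {β : ℝ} {V : lp (fun _ : ℕ+ => ℝ) ⊤} {φ : ℕ → ℂ → ℂ}

theorem jostFun_joukowskyRoot_ne_zero (h : IsJostFamily (extendPotential V) φ) {p : ℝ × ℝ}
    (hp : p ∈ Set.Ioo (-2 : ℝ) 2 ×ˢ Set.Ici (0 : ℝ)) :
    jostFun φ (Real.tan β) (joukowskyRoot (p.1 + p.2 * Complex.I)) ≠ 0 := by
  rcases (Set.mem_Ici.1 hp.2).eq_or_lt with h0 | h0
  · rw [← h0, Complex.ofReal_zero, zero_mul, add_zero]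
    obtain ⟨h1, h2⟩ := joukowskyRoot_ofReal hp.1
    refine h.jostFun_ne_zero h1 ?_ _
    rw [h2]
    have : 0 < 4 - p.1 ^ 2 := by nlinarith [hp.1.1, hp.1.2]
    have := Real.sqrt_pos.2 this
    linarith
  · refine jostFun_ne_zero_of_im_ne_zero h (norm_joukowskyRoot_lt_one hp.1 h0)
      (joukowskyRoot_ne_zero _) ?_
    rw [joukowskyRoot_add_inv]
    simpa using h0.ne'

/-- An atom of the spectral measure is an eigenvalue, and there is none at `ζ + ζ⁻¹` for `|ζ| = 1`. -/
theorem spectralMeasure_singleton_eq_zero (h : IsJostFamily (extendPotential V) φ) {ζ : ℂ}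
    (hζ : ‖ζ‖ = 1) {E : ℝ} (hE : (E : ℂ) = ζ + ζ⁻¹) :
    spectralMeasure (halfLineSchrodinger β V) delta1 {E} = 0 := by
  have hH := isSelfAdjoint_halfLineSchrodinger β V
  obtain ⟨U, hU⟩ := exists_spectralRepresentation hH (isCyclicVector_delta1 (β := β) (V := V))
  set g : Lp ℂ 2 (spectralMeasure (halfLineSchrodinger β V) delta1) :=
    indicatorConstLp 2 (measurableSet_singleton E) (measure_ne_top _ _) 1
  have hg : g =ᵐ[spectralMeasure (halfLineSchrodinger β V) delta1] ({E} : Set ℝ).indicator fun _ => 1 := indicatorConstLp_coeFn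
  have heig : halfLineSchrodinger β V (U g) = (ζ + ζ⁻¹) • U g := by
    have hx := representation_symm_apply_operator hH hU (U g)
    rw [LinearIsometryEquiv.symm_apply_apply] at hx
    have hsymm : U.symm (halfLineSchrodinger β V (U g)) = (ζ + ζ⁻¹) • g := Lp.ext (by
      filter_upwards [hx, hg, Lp.coeFn_smul (ζ + ζ⁻¹) g] with x e1 e2 e3
      rw [e1, e3, Pi.smul_apply, e2, smul_eq_mul, ← hE]
      by_cases hxE : x = E
      · rw [hxE]
      · rw [Set.indicator_of_notMem (by simpa using hxE), mul_zero, mul_zero])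
    rw [← map_smul, ← hsymm, LinearIsometryEquiv.apply_symm_apply]
  have h1 := eigenvector_apply_one_eq_zero h hζ heig
  rw [← inner_delta1, inner_base_eq_integral hH hU, LinearIsometryEquiv.symm_apply_apply,
    integral_congr_ae hg, integral_indicator_const _ (measurableSet_singleton E)] at h1
  simpa [Measure.real, ENNReal.toReal_eq_zero_iff] using h1

/-- The spectral measure of `δ₁` on `[-2, 2]` has the density `√(4 - x²) / (2π |F|²)`, where `F` is the
Jost function. The Wronskian bound for `F` costs an inverse square root at the edges, which the
Dirichlet condition avoids. -/
theorem exists_spectralDensity (h : IsJostFamily (extendPotential V) φ) :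
    ∃ ρ : ℝ → ℝ, Measurable ρ ∧ (∀ x ∈ Set.Ioo (-2 : ℝ) 2, 0 < ρ x) ∧
      (∀ x, ENNReal.ofReal (ρ x) ≤ 2 * edgeWeight x) ∧ (Real.tan β = 0 → ∀ x, ρ x ≤ 1) ∧
      (spectralMeasure (halfLineSchrodinger β V) delta1).restrict (Set.Icc (-2) 2) =
        volume.withDensity fun x => ENNReal.ofReal (ρ x) := by
  set μ := spectralMeasure (halfLineSchrodinger β V) delta1
  set Z : ℝ × ℝ → ℂ := fun p => joukowskyRoot (p.1 + p.2 * Complex.I)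
  set M : ℝ × ℝ → ℝ := fun p => (-(jostSol φ 1 (Z p) / jostFun φ (Real.tan β) (Z p))).im
  have hMc : ContinuousOn M (Set.Ioo (-2 : ℝ) 2 ×ˢ Set.Ici 0) := by
    have hmap : Set.MapsTo Z (Set.Ioo (-2 : ℝ) 2 ×ˢ Set.Ici 0) (Metric.closedBall 0 1) := fun p hp =>
      mem_closedBall_zero_iff.2 (norm_joukowskyRoot_le_one hp)
    refine Complex.continuous_im.comp_continuousOn (ContinuousOn.neg (ContinuousOn.div
      ((h.continuousOn_jostSol 1).comp continuousOn_joukowskyRoot hmap)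
      ((h.continuousOn_jostFun _).comp continuousOn_joukowskyRoot hmap)
      fun p hp => jostFun_joukowskyRoot_ne_zero h hp))
  have hZ0 : ∀ x : ℝ, Z (x, 0) = joukowskyRoot x := fun x => by simp [Z]
  have hM0 : ∀ x ∈ Set.Ioo (-2 : ℝ) 2, M (x, 0) =
      √(4 - x ^ 2) / 2 / ‖jostFun φ (Real.tan β) (joukowskyRoot x)‖ ^ 2 := fun x hx => by
    obtain ⟨h1, h2⟩ := joukowskyRoot_ofReal hx
    simp only [M, hZ0]
    rw [h.im_weyl h1, h2, neg_neg]
  have hS : ∀ x ∈ Set.Ioo (-2 : ℝ) 2, 0 < √(4 - x ^ 2) := fun x hx =>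
    Real.sqrt_pos.2 (by nlinarith [hx.1, hx.2])
  have hF : ∀ x ∈ Set.Ioo (-2 : ℝ) 2,
      √(4 - x ^ 2) / 2 ≤ 4 / 3 * ‖jostFun φ (Real.tan β) (joukowskyRoot x)‖ := fun x hx => by
    obtain ⟨h1, h2⟩ := joukowskyRoot_ofReal hx
    have h3 := h.abs_im_le_norm_jostFun h1 (Real.tan β)
    rwa [h2, abs_neg, abs_of_pos (half_pos (hS x hx))] at h3
  have hMpos : ∀ x ∈ Set.Ioo (-2 : ℝ) 2, 0 < M (x, 0) := fun x hx => by
    have h1 := hS x hx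
    have h2 := hF x hx
    have h3 : 0 < ‖jostFun φ (Real.tan β) (joukowskyRoot x)‖ := by linarith
    rw [hM0 x hx]
    positivity
  have hrestr := restrict_eq_withDensity_of_poissonTransform μ hMc (fun x hx => (hMpos x hx).le)
    fun x hx y hy => poissonTransform_spectralMeasure h (norm_joukowskyRoot_lt_one hx hy)
      (joukowskyRoot_ne_zero _) hy (joukowskyRoot_add_inv _)
  have hcont0 : ContinuousOn (fun x => M (x, 0) / Real.pi) (Set.Ioo (-2 : ℝ) 2) :=
    (hMc.comp (by fun_prop) fun x hx => ⟨hx, Set.self_mem_Ici⟩).div_const _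
  refine ⟨(Set.Ioo (-2 : ℝ) 2).indicator fun x => M (x, 0) / Real.pi, ?_, fun x hx => ?_,
    fun x => ?_, fun htan x => ?_, ?_⟩
  · classical
    rw [← Set.piecewise_eq_indicator]
    exact hcont0.measurable_piecewise continuousOn_const measurableSet_Ioo
  · rw [Set.indicator_of_mem hx]
    exact div_pos (hMpos x hx) Real.pi_pos
  · by_cases hx : x ∈ Set.Ioo (-2 : ℝ) 2
    · rw [Set.indicator_of_mem hx, edgeWeight, Set.indicator_of_mem hx, ← ENNReal.ofReal_ofNat 2,
        ← ENNReal.ofReal_mul (by norm_num), hM0 x hx]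
      refine ENNReal.ofReal_le_ofReal ?_
      have h1 := hS x hx
      have h2 := hF x hx
      have h3 : 0 < ‖jostFun φ (Real.tan β) (joukowskyRoot x)‖ := by linarith
      have h4 := Real.pi_gt_three
      set S := √(4 - x ^ 2)
      set N := ‖jostFun φ (Real.tan β) (joukowskyRoot x)‖
      rw [div_div, div_le_iff₀ (by positivity), ← div_eq_mul_inv, div_mul_eq_mul_div,
        le_div_iff₀ h1]
      have h5 : S ^ 2 ≤ (8 / 3 * N) ^ 2 := by gcongr; linarith
      nlinarith [sq_nonneg N]
    · rw [Set.indicator_of_notMem hx, ENNReal.ofReal_zero]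
      exact zero_le
  · by_cases hx : x ∈ Set.Ioo (-2 : ℝ) 2
    · rw [Set.indicator_of_mem hx, hM0 x hx, htan]
      have h1 := hS x hx
      have h2 := h.le_norm_jostFun_zero (joukowskyRoot_ofReal hx).1.le
      have h4 := Real.pi_gt_three
      have h5 : √(4 - x ^ 2) ≤ 2 := by
        rw [Real.sqrt_le_left (by norm_num)]
        nlinarith [sq_nonneg x]
      rw [div_div, div_le_one (by positivity)]
      have h6 : (2 / 3) ^ 2 ≤ ‖jostFun φ 0 (joukowskyRoot x)‖ ^ 2 := by gcongr
      nlinarith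
    · rw [Set.indicator_of_notMem hx]
      exact zero_le_one
  · have hae : Set.Icc (-2 : ℝ) 2 =ᵐ[μ] Set.Ioo (-2 : ℝ) 2 := by
      refine (Ioo_ae_eq_Icc' ?_ ?_).symm
      · exact spectralMeasure_singleton_eq_zero h (ζ := -1) (by simp) (by push_cast; norm_num)
      · exact spectralMeasure_singleton_eq_zero h (ζ := 1) (by simp) (by push_cast; norm_num)
    rw [Measure.restrict_congr_set hae, hrestr]
    congr 1
    ext x
    by_cases hx : x ∈ Set.Ioo (-2 : ℝ) 2
    · rw [Set.indicator_of_mem hx, Set.indicator_of_mem hx]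
    · rw [Set.indicator_of_notMem hx, Set.indicator_of_notMem hx, ENNReal.ofReal_zero]

end SpectralDensity

/-! ### Consequences of the spectral density -/

section Density

variable {E : Type*} [NormedAddCommGroup E] [InnerProductSpace ℂ E] [CompleteSpace E]
  {T : E →L[ℂ] E} {e : E}

theorem exp_smul_eq_complexCalculus (hT : IsSelfAdjoint T) (s : ℝ) :
    NormedSpace.exp ((-(Complex.I * (s : ℂ))) • T) =
      complexCalculus T fun x => Complex.exp (-(Complex.I * s) * x) := by
  have hn : IsStarNormal T := hT.isStarNormal
  have hn' : IsStarNormal ((-(Complex.I * (s : ℂ))) • T) := by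
    rw [isStarNormal_iff, star_smul, hT.star_eq]
    exact ((Commute.refl T).smul_left _).smul_right _
  rw [← CFC.exp_eq_normedSpace_exp (𝕜 := ℂ) (a := (-(Complex.I * (s : ℂ))) • T) hn',
    ← Complex.exp_eq_exp_ℂ, ← cfc_comp_const_mul (-(Complex.I * (s : ℂ))) Complex.exp T (by fun_prop) hn]
  refine cfc_congr fun z hz => ?_
  simp only
  rw [hT.mem_spectrum_eq_re hz, Complex.ofReal_re]

theorem returnAverage_eq (hT : IsSelfAdjoint T) (ψ : E) (t : ℝ) :
    returnAverage T ψ t =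
      1 / t * ∫ s in (0 : ℝ)..t, ‖measureFourier (spectralMeasure T ψ) s‖ ^ 2 := by
  unfold returnAverage
  congr 1
  refine intervalIntegral.integral_congr fun s _ => ?_
  rw [exp_smul_eq_complexCalculus hT, inner_complexCalculus hT ψ (by fun_prop) (C := 1)
    fun x => (norm_exp_neg_I_mul s x).le, measureFourier]

/-- A positive density on `(-2, 2)` makes the spectrum purely absolutely continuous. A point `x₀` of
`[-2, 2]` is in the absolutely continuous spectrum because division by `x - x₀` leads out of `L²`. -/
theorem isPurelyACOn_of_density (hT : IsSelfAdjoint T) (he : IsCyclicVector T e) {ρ : ℝ → ℝ}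
    (hρ : Measurable ρ) (hpos : ∀ x ∈ Set.Ioo (-2 : ℝ) 2, 0 < ρ x)
    (hμ : (spectralMeasure T e).restrict (Set.Icc (-2) 2) =
      volume.withDensity fun x => ENNReal.ofReal (ρ x)) :
    IsPurelyACOn T (Set.Icc (-2) 2) := by
  obtain ⟨U, hU⟩ := exists_spectralRepresentation hT he
  have hac : (spectralMeasure T e).restrict (Set.Icc (-2) 2) ≪ volume := by
    rw [hμ]
    exact withDensity_absolutelyContinuous _ _
  refine ⟨fun x₀ hx₀ hbij => ?_, fun ψ => ?_⟩
  swap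
  · rw [spectralMeasure_eq_withDensity hT hU ψ]
    exact ((withDensity_absolutelyContinuous _ _).restrict _).trans hac
  -- The vector represented by `ρ^{-1/2}` on `(-2, 2)` has Lebesgue measure there as spectral measure.
  set g : ℝ → ℂ := (Set.Ioo (-2 : ℝ) 2).indicator fun x => ((√(ρ x))⁻¹ : ℝ) with hg
  have hgm : Measurable g := Measurable.indicator (by fun_prop) measurableSet_Ioo
  have hgρ : ∀ x ∈ Set.Ioo (-2 : ℝ) 2, ENNReal.ofReal (ρ x) * ‖g x‖ₑ ^ 2 = 1 := fun x hx => by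
    have h1 := hpos x hx
    have h2 := Real.sqrt_pos.2 h1
    rw [hg, Set.indicator_of_mem hx, ← ofReal_norm, Complex.norm_real, Real.norm_of_nonneg
      (by positivity), ← ENNReal.ofReal_pow (by positivity), ← ENNReal.ofReal_mul h1.le, inv_pow,
      Real.sq_sqrt h1.le, mul_inv_cancel₀ h1.ne', ENNReal.ofReal_one]
  have hg0 : ∀ x ∉ Set.Ioo (-2 : ℝ) 2, ‖g x‖ₑ ^ 2 = 0 := fun x hx => by
    rw [hg, Set.indicator_of_notMem hx]
    simp
  have hgI : (fun x => ‖g x‖ₑ ^ 2) = (Set.Icc (-2 : ℝ) 2).indicator fun x => ‖g x‖ₑ ^ 2 := by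
    ext x
    by_cases hx : x ∈ Set.Icc (-2 : ℝ) 2
    · rw [Set.indicator_of_mem hx]
    · rw [Set.indicator_of_notMem hx, hg0 x fun h => hx (Set.Ioo_subset_Icc_self h)]
  have hmem : MemLp g 2 (spectralMeasure T e) := by
    refine ⟨hgm.aestronglyMeasurable, ?_⟩
    rw [eLpNorm_lt_top_iff_lintegral_rpow_enorm_lt_top (by simp) (by simp)]
    simp only [ENNReal.toReal_ofNat, ENNReal.rpow_ofNat]
    rw [hgI, lintegral_indicator measurableSet_Icc, hμ,
      lintegral_withDensity_eq_lintegral_mul _ (by fun_prop) (by fun_prop)]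
    refine lt_of_le_of_lt (lintegral_mono (g := (Set.Ioo (-2 : ℝ) 2).indicator fun _ => 1) fun x => ?_) ?_
    · by_cases hx : x ∈ Set.Ioo (-2 : ℝ) 2
      · rw [Set.indicator_of_mem hx]
        exact (hgρ x hx).le
      · rw [Pi.mul_apply, hg0 x hx, mul_zero]
        exact zero_le
    · rw [lintegral_indicator measurableSet_Ioo, setLIntegral_const, Real.volume_Ioo]
      finiteness
  set ψ := U (hmem.toLp g) with hψ
  have hψac : ψ ∈ acVectors T := by
    change spectralMeasure T ψ ≪ volume
    have hae : (fun x => ‖U.symm ψ x‖ₑ ^ 2) =ᵐ[spectralMeasure T e] fun x => ‖g x‖ₑ ^ 2 := by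
      rw [hψ, LinearIsometryEquiv.symm_apply_apply]
      filter_upwards [hmem.coeFn_toLp] with x hx
      rw [hx]
    rw [spectralMeasure_eq_withDensity hT hU ψ, withDensity_congr_ae hae, hgI,
      withDensity_indicator measurableSet_Icc]
    exact (withDensity_absolutelyContinuous _ _).trans hac
  obtain ⟨φ, -, hφ⟩ := hbij.surjOn hψac
  set k : ℝ → ℂ := fun x => U.symm φ x
  have hk : ∀ᵐ x : ℝ ∂(spectralMeasure T e), ((x : ℂ) - x₀) * k x = g x := by
    have h1 : U.symm (T φ) - (x₀ : ℂ) • U.symm φ = hmem.toLp g := by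
      rw [← map_smul, ← map_sub, LinearIsometryEquiv.symm_apply_eq]
      exact hφ
    filter_upwards [representation_symm_apply_operator hT hU φ, hmem.coeFn_toLp,
      Lp.coeFn_sub (U.symm (T φ)) ((x₀ : ℂ) • U.symm φ), Lp.coeFn_smul (x₀ : ℂ) (U.symm φ)]
      with x e1 e2 e3 e4
    rw [h1, e2, Pi.sub_apply, e1, e4, Pi.smul_apply, smul_eq_mul] at e3
    rw [e3, sub_mul]
  have hkvol : ∀ᵐ x : ℝ, 0 < ρ x → ((x : ℂ) - x₀) * k x = g x := by
    have h1 := ae_restrict_of_ae (s := Set.Icc (-2 : ℝ) 2) hk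
    rw [hμ, ae_withDensity_iff (by fun_prop)] at h1
    filter_upwards [h1] with x hx hx2
    exact hx (ENNReal.ofReal_pos.2 hx2).ne'
  have hfin : ∫⁻ x in Set.Ioo (-2 : ℝ) 2, ‖(x - x₀)⁻¹‖ₑ ^ 2 < ⊤ := by
    have h1 : ∫⁻ x in Set.Icc (-2 : ℝ) 2, ‖k x‖ₑ ^ 2 ∂(spectralMeasure T e) < ⊤ :=
      (setLIntegral_le_lintegral _ _).trans_lt (lintegral_enorm_sq_lt_top (U.symm φ))
    have hkm : AEMeasurable (fun x => ‖k x‖ₑ ^ 2)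
        (volume.withDensity fun x => ENNReal.ofReal (ρ x)) := by
      rw [← hμ]
      exact ((Lp.aestronglyMeasurable (U.symm φ)).enorm.pow_const 2).restrict
    rw [hμ, lintegral_withDensity_eq_lintegral_mul₀' (by fun_prop) hkm] at h1
    refine lt_of_le_of_lt ?_ h1
    refine le_trans (lintegral_mono_ae ?_) (setLIntegral_le_lintegral (Set.Ioo (-2 : ℝ) 2) _)
    have hne : ∀ᵐ x : ℝ, x ≠ x₀ := by simp [ae_iff]
    filter_upwards [ae_restrict_of_ae hkvol, ae_restrict_of_ae hne, ae_restrict_mem measurableSet_Ioo]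
      with x e1 e2 e3
    have e4 := hpos x e3
    have e5 := e1 e4
    have e6 : (x : ℂ) - x₀ ≠ 0 := by
      rw [← Complex.ofReal_sub, Complex.ofReal_ne_zero]
      exact sub_ne_zero.2 e2
    have e7 : k x = (((x - x₀)⁻¹ : ℝ) : ℂ) * g x := by
      rw [← e5]
      push_cast
      field_simp
    rw [Pi.mul_apply, e7, enorm_mul, mul_pow, mul_left_comm, hgρ x e3, mul_one,
      ← ofReal_norm, ← ofReal_norm, Complex.norm_real]
  -- `(x - x₀)⁻¹` would then be integrable on `(-2, 2)`.
  have hL2 : MemLp (fun x => (x - x₀)⁻¹) 2 (volume.restrict (Set.Ioo (-2 : ℝ) 2)) := by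
    refine ⟨Measurable.aestronglyMeasurable (by fun_prop), ?_⟩
    rw [eLpNorm_lt_top_iff_lintegral_rpow_enorm_lt_top (by simp) (by simp)]
    simpa using hfin
  have hL1 : IntegrableOn (fun x => (x - x₀)⁻¹) (Set.Ioo (-2 : ℝ) 2) :=
    memLp_one_iff_integrable.1 (hL2.mono_exponent (by norm_num))
  have hint := (intervalIntegrable_iff_integrableOn_Ioo_of_le (by norm_num : (-2 : ℝ) ≤ 2)).2 hL1
  rw [intervalIntegrable_sub_inv_iff, Set.uIcc_of_le (by norm_num)] at hint
  rcases hint with h | h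
  · norm_num at h
  · exact h hx₀

theorem isHolderMeasure_of_le {G : ℝ → ENNReal} {α c : ℝ} (hc : 0 ≤ c)
    (h : ∀ A : Set ℝ, volume A < 1 → ∫⁻ x in A, G x ≤ ENNReal.ofReal c * volume A ^ α) :
    IsHolderMeasure α (volume.withDensity G) := by
  refine ⟨c + 1, by linarith, fun I hI hvol => ?_⟩
  rw [withDensity_apply _ hI.measurableSet]
  refine (h I hvol).trans ?_
  gcongr
  linarith

theorem isHolderMeasure_half {G : ℝ → ENNReal} {c : ℝ} (hc : 0 ≤ c)
    (hG : ∀ x, G x ≤ ENNReal.ofReal c * edgeWeight x) :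
    IsHolderMeasure (1 / 2) (volume.withDensity G) := by
  refine isHolderMeasure_of_le (c := c * 6) (by positivity) fun A hA => ?_
  refine (lintegral_mono hG).trans ?_
  rw [lintegral_const_mul _ measurable_edgeWeight, ENNReal.ofReal_mul hc, mul_assoc]
  gcongr
  simpa using setLIntegral_edgeWeight_le hA

theorem isHolderMeasure_one {G : ℝ → ENNReal} {c : ℝ} (hc : 0 ≤ c)
    (hG : ∀ x, G x ≤ ENNReal.ofReal c) : IsHolderMeasure 1 (volume.withDensity G) := by
  refine isHolderMeasure_of_le hc fun A _ => ?_
  refine (lintegral_mono hG).trans ?_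
  rw [lintegral_const, Measure.restrict_apply_univ, ENNReal.rpow_one]

theorem exists_integral_norm_measureFourier_sq_le {G : ℝ → ENNReal} (hG : Measurable G)
    [IsFiniteMeasure (volume.withDensity G)] {c : ℝ} (hc : ∀ x, G x ≤ ENNReal.ofReal c) :
    ∃ η > (0 : ℝ), ∀ t : ℝ, 0 < t →
      ∫ s in (0 : ℝ)..t, ‖measureFourier (volume.withDensity G) s‖ ^ 2 ≤ η := by
  have hfin : ∫⁻ x, G x ≠ ⊤ := by
    have := measure_ne_top (volume.withDensity G) Set.univ
    rwa [withDensity_apply _ MeasurableSet.univ, Measure.restrict_univ] at this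
  have h2 : ∫⁻ x, G x ^ 2 ≠ ⊤ := by
    refine ne_top_of_le_ne_top (b := ENNReal.ofReal c * ∫⁻ x, G x) (by finiteness) ?_
    rw [← lintegral_const_mul _ hG]
    refine lintegral_mono fun x => ?_
    rw [sq]
    gcongr
    exact hc x
  refine ⟨4 * Real.pi * Real.exp 1 * (∫⁻ x, G x ^ 2).toReal + 1, by positivity, fun t ht => ?_⟩
  linarith [intervalIntegral_norm_measureFourier_sq_le hG h2 ht]

/-- With an inverse square root singularity the density just fails to be square integrable. The intervals
of length `1 / t` at the edges carry a mass of order `t ^ (-1/2)`, and the rest has a squared `L²` norm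
of order `log t`. -/
theorem exists_integral_norm_measureFourier_sq_le_log {G : ℝ → ENNReal} (hG : Measurable G)
    [IsFiniteMeasure (volume.withDensity G)] {c : ℝ} (hc : 0 ≤ c)
    (hGc : ∀ x, G x ≤ ENNReal.ofReal c * edgeWeight x) :
    ∃ γ > (0 : ℝ), ∀ t : ℝ, 2 < t →
      ∫ s in (0 : ℝ)..t, ‖measureFourier (volume.withDensity G) s‖ ^ 2 ≤ γ * Real.log t := by
  refine ⟨24 * Real.pi * Real.exp 1 * c ^ 2 + 288 * c ^ 2 + 1, by positivity, fun t ht => ?_⟩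
  have ht0 : 0 < t := by linarith
  have htinv : 0 < 1 / t := by positivity
  have htlt : 1 / t < 1 / 2 := one_div_lt_one_div_of_lt (by norm_num) ht
  set J : Set ℝ := Set.Ioo (-2 + 1 / t) (2 - 1 / t)
  have hJ : MeasurableSet J := measurableSet_Ioo
  have hsum : volume.withDensity G = volume.withDensity (J.indicator G) +
      volume.withDensity (Jᶜ.indicator G) := by
    rw [← withDensity_add_left (hG.indicator hJ), Set.indicator_self_add_compl]
  have hf1 : IsFiniteMeasure (volume.withDensity (J.indicator G)) :=
    isFiniteMeasure_of_le (volume.withDensity G) (by rw [hsum]; exact Measure.le_add_right le_rfl)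
  have hf2 : IsFiniteMeasure (volume.withDensity (Jᶜ.indicator G)) :=
    isFiniteMeasure_of_le (volume.withDensity G) (by rw [hsum]; exact Measure.le_add_left le_rfl)
  have hadd : ∀ s, measureFourier (volume.withDensity G) s =
      measureFourier (volume.withDensity (J.indicator G)) s +
        measureFourier (volume.withDensity (Jᶜ.indicator G)) s := fun s => by
    rw [hsum]
    have hb : ∀ m : Measure ℝ, IsFiniteMeasure m →
        Integrable (fun x : ℝ => Complex.exp (-(Complex.I * s) * x)) m := fun m _ =>
      Integrable.of_bound (by fun_prop) 1 (Eventually.of_forall fun x => (norm_exp_neg_I_mul s x).le)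
    exact integral_add_measure (hb _ hf1) (hb _ hf2)
  -- The bulk part is square integrable, with a logarithmically growing norm.
  have hbulk : ∫⁻ x, J.indicator G x ^ 2 ≤ ENNReal.ofReal (c ^ 2 * (3 * Real.log t)) := by
    have h1 : (fun x => J.indicator G x ^ 2) = J.indicator fun x => G x ^ 2 := by
      ext x
      by_cases hx : x ∈ J
      · rw [Set.indicator_of_mem hx, Set.indicator_of_mem hx]
      · rw [Set.indicator_of_notMem hx, Set.indicator_of_notMem hx, zero_pow two_ne_zero]
    rw [h1, lintegral_indicator hJ, ENNReal.ofReal_mul (by positivity), ENNReal.ofReal_pow hc]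
    refine le_trans (lintegral_mono (g := fun x => ENNReal.ofReal c ^ 2 * edgeWeight x ^ 2) fun x => ?_) ?_
    · change G x ^ 2 ≤ ENNReal.ofReal c ^ 2 * edgeWeight x ^ 2
      rw [← mul_pow]
      gcongr
      exact hGc x
    · rw [lintegral_const_mul _ (measurable_edgeWeight.pow_const 2)]
      gcongr
      exact setLIntegral_edgeWeight_sq_le ht
  have hlog : 1 / 2 ≤ Real.log t := by
    have := Real.log_le_log (by norm_num) ht.le
    linarith [Real.log_two_gt_d9]
  have h1 : ∫ s in (0 : ℝ)..t, ‖measureFourier (volume.withDensity (J.indicator G)) s‖ ^ 2 ≤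
      4 * Real.pi * Real.exp 1 * (c ^ 2 * (3 * Real.log t)) := by
    refine (intervalIntegral_norm_measureFourier_sq_le (hG.indicator hJ)
      (ne_top_of_le_ne_top ENNReal.ofReal_ne_top hbulk) ht0).trans ?_
    gcongr
    exact ENNReal.toReal_le_of_le_ofReal (by positivity) hbulk
  -- The part near the edges has mass of order `t^{-1/2}`.
  have hmass : (volume.withDensity (Jᶜ.indicator G)).real Set.univ ≤ c * (6 * √(2 / t)) := by
    refine ENNReal.toReal_le_of_le_ofReal (by positivity) ?_
    rw [withDensity_apply _ MeasurableSet.univ, Measure.restrict_univ, lintegral_indicator hJ.compl]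
    refine (lintegral_mono hGc).trans ?_
    rw [lintegral_const_mul _ measurable_edgeWeight, ENNReal.ofReal_mul hc]
    gcongr
    set K : Set ℝ := Set.Icc (-2) (-2 + 1 / t) ∪ Set.Icc (2 - 1 / t) 2
    have hKvol : volume K ≤ ENNReal.ofReal (2 / t) := by
      refine (measure_union_le _ _).trans (le_of_eq ?_)
      rw [Real.volume_Icc, Real.volume_Icc, ← ENNReal.ofReal_add (by linarith) (by linarith)]
      congr 1
      ring
    have hKlt : volume K < 1 := by
      refine hKvol.trans_lt ?_
      rw [← ENNReal.ofReal_one]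
      refine (ENNReal.ofReal_lt_ofReal_iff one_pos).2 ?_
      rw [div_lt_one ht0]
      exact ht
    have hsub : ∫⁻ x in Jᶜ, edgeWeight x ≤ ∫⁻ x in K, edgeWeight x := by
      have hKm : MeasurableSet K := measurableSet_Icc.union measurableSet_Icc
      rw [← lintegral_indicator hJ.compl, ← lintegral_indicator hKm]
      refine lintegral_mono fun x => ?_
      by_cases hx : x ∈ Jᶜ
      · rw [Set.indicator_of_mem hx]
        by_cases hxI : x ∈ Set.Ioo (-2 : ℝ) 2
        · rw [Set.indicator_of_mem]
          by_contra hxK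
          refine hx ⟨?_, ?_⟩
          · by_contra! hlt
            exact hxK (Or.inl ⟨hxI.1.le, hlt⟩)
          · by_contra! hlt
            exact hxK (Or.inr ⟨hlt, hxI.2.le⟩)
        · rw [edgeWeight, Set.indicator_of_notMem hxI]
          exact zero_le
      · rw [Set.indicator_of_notMem hx]
        exact zero_le
    refine hsub.trans ((setLIntegral_edgeWeight_le hKlt).trans ?_)
    rw [ENNReal.ofReal_mul (by norm_num), ENNReal.ofReal_ofNat, Real.sqrt_eq_rpow,
      ← ENNReal.ofReal_rpow_of_pos (by positivity)]
    gcongr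
  have h2 : ∫ s in (0 : ℝ)..t, ‖measureFourier (volume.withDensity (Jᶜ.indicator G)) s‖ ^ 2 ≤
      72 * c ^ 2 := by
    have hle : ∀ s ∈ Set.uIoc 0 t,
        ‖‖measureFourier (volume.withDensity (Jᶜ.indicator G)) s‖ ^ 2‖ ≤ 72 * c ^ 2 / t := by
      intro s _
      rw [Real.norm_of_nonneg (by positivity)]
      calc ‖measureFourier (volume.withDensity (Jᶜ.indicator G)) s‖ ^ 2
          ≤ (c * (6 * √(2 / t))) ^ 2 := by
            gcongr
            exact (norm_measureFourier_le _ s).trans hmass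
        _ = 72 * c ^ 2 / t := by
            rw [mul_pow, mul_pow, Real.sq_sqrt (by positivity)]
            ring
    have h3 := intervalIntegral.norm_integral_le_of_norm_le_const hle
    rw [sub_zero, abs_of_pos ht0, div_mul_cancel₀ _ ht0.ne'] at h3
    exact (Real.le_norm_self _).trans h3
  have hc1 : Continuous fun s => ‖measureFourier (volume.withDensity (J.indicator G)) s‖ ^ 2 :=
    (continuous_measureFourier (volume.withDensity (J.indicator G))).norm.pow 2
  have hc2 : Continuous fun s => ‖measureFourier (volume.withDensity (Jᶜ.indicator G)) s‖ ^ 2 :=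
    (continuous_measureFourier (volume.withDensity (Jᶜ.indicator G))).norm.pow 2
  have hc0 : Continuous fun s => ‖measureFourier (volume.withDensity G) s‖ ^ 2 :=
    (continuous_measureFourier (volume.withDensity G)).norm.pow 2
  have h3 : ∫ s in (0 : ℝ)..t, ‖measureFourier (volume.withDensity G) s‖ ^ 2 ≤
      ∫ s in (0 : ℝ)..t, (2 * ‖measureFourier (volume.withDensity (J.indicator G)) s‖ ^ 2 +
        2 * ‖measureFourier (volume.withDensity (Jᶜ.indicator G)) s‖ ^ 2) := by
    refine intervalIntegral.integral_mono_on ht0.le (hc0.intervalIntegrable _ _)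
      (((hc1.const_mul 2).add (hc2.const_mul 2)).intervalIntegrable _ _) fun s _ => ?_
    rw [hadd]
    have h4 := norm_add_le (measureFourier (volume.withDensity (J.indicator G)) s)
      (measureFourier (volume.withDensity (Jᶜ.indicator G)) s)
    have h5 := norm_nonneg (measureFourier (volume.withDensity (J.indicator G)) s +
      measureFourier (volume.withDensity (Jᶜ.indicator G)) s)
    nlinarith [sq_nonneg (‖measureFourier (volume.withDensity (J.indicator G)) s‖ -
      ‖measureFourier (volume.withDensity (Jᶜ.indicator G)) s‖)]
  rw [intervalIntegral.integral_add ((hc1.const_mul 2).intervalIntegrable _ _)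
    ((hc2.const_mul 2).intervalIntegrable _ _), intervalIntegral.integral_const_mul,
    intervalIntegral.integral_const_mul] at h3
  nlinarith [sq_nonneg c]

end Density

/-- The spectral measure of `f(H) δ₁` is `|f|²` times that of `δ₁`, and only its part on `[-2, 2]` counts
as `f` is extended by zero. -/
theorem exists_density_stateOf {H : HalfLineSpace →L[ℂ] HalfLineSpace} (hH : IsSelfAdjoint H)
    (hcyc : IsCyclicVector H delta1) {ρ : ℝ → ℝ} (hρ : Measurable ρ)
    (hμ : (spectralMeasure H delta1).restrict (Set.Icc (-2) 2) =
      volume.withDensity fun x => ENNReal.ofReal (ρ x)) (f : C(Set.Icc (-2 : ℝ) 2, ℂ)) :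
    ∃ G : ℝ → ENNReal, Measurable G ∧
      (∀ x, G x ≤ ENNReal.ofReal (‖f‖ ^ 2) * ENNReal.ofReal (ρ x)) ∧
      spectralMeasure H (stateOf H f) = volume.withDensity G := by
  obtain ⟨U, hU⟩ := exists_spectralRepresentation hH hcyc
  have hfm := measurable_extendByZero f
  have hae : (fun x => ‖U.symm (stateOf H f) x‖ₑ ^ 2) =ᵐ[spectralMeasure H delta1]
      fun x => ‖extendByZero f x‖ₑ ^ 2 := by
    filter_upwards [representation_symm_borelCalculus hH hU hfm (norm_extendByZero_le f) delta1,
      representation_symm_base hH hU] with x e1 e2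
    rw [stateOf, e1, e2, mul_one]
  have hI : (fun x => ‖extendByZero f x‖ₑ ^ 2) =
      (Set.Icc (-2 : ℝ) 2).indicator fun x => ‖extendByZero f x‖ₑ ^ 2 := by
    ext x
    by_cases hx : x ∈ Set.Icc (-2 : ℝ) 2
    · rw [Set.indicator_of_mem hx]
    · rw [Set.indicator_of_notMem hx, extendByZero, dif_neg hx]
      simp
  refine ⟨(fun x => ENNReal.ofReal (ρ x)) * fun x => ‖extendByZero f x‖ₑ ^ 2, by fun_prop,
    fun x => ?_, ?_⟩
  · rw [Pi.mul_apply, mul_comm, ENNReal.ofReal_pow (norm_nonneg f)]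
    gcongr
    rw [← ofReal_norm]
    exact ENNReal.ofReal_le_ofReal (norm_extendByZero_le f x)
  · rw [spectralMeasure_eq_withDensity hH hU, withDensity_congr_ae hae]
    conv_lhs => rw [hI]
    rw [withDensity_indicator measurableSet_Icc, hμ, ← withDensity_mul _ (by fun_prop) (by fun_prop)]

theorem summable_extendPotential {b : ℕ+ → ℝ} {γ a τ : ℝ} (ha : 3 < a) (hτ : 4 < τ)
    (hb : ∀ n : ℕ+, |b n| ≤ γ * a ^ (-τ * (n : ℝ))) :
    Summable fun m : ℕ => (m : ℝ) * |extendPotential b m| := by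
  have ha0 : 0 < a := by linarith
  have hq0 : 0 < a ^ (-τ) := Real.rpow_pos_of_pos ha0 _
  have hq1 : a ^ (-τ) < 1 := Real.rpow_lt_one_of_one_lt_of_neg (by linarith) (by linarith)
  have hgeom : Summable fun m : ℕ => γ * ((m : ℝ) ^ 1 * (a ^ (-τ)) ^ m) :=
    (summable_pow_mul_geometric_of_norm_lt_one 1
      (by rwa [Real.norm_of_nonneg hq0.le])).mul_left γ
  refine Summable.of_nonneg_of_le (fun m => by positivity) (fun m => ?_) hgeom
  rcases Nat.eq_zero_or_pos m with rfl | hm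
  · simp
  · have h1 := hb ⟨m, hm⟩
    rw [extendPotential, dif_pos hm]
    rw [PNat.mk_coe, Real.rpow_mul ha0.le, Real.rpow_natCast] at h1
    calc (m : ℝ) * |b ⟨m, hm⟩| ≤ m * (γ * (a ^ (-τ)) ^ m) := by gcongr
      _ = _ := by ring

end HalfLine

theorem theorem1p1 (b : lp (fun _ : ℕ+ => ℝ) ⊤)
    (hb : ∃ γ > (0 : ℝ), ∃ a > (3 : ℝ), ∃ τ > (4 : ℝ),
      ∀ n : ℕ+, |b n| ≤ γ * a ^ (-τ * (n : ℝ))) :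
    ∃ ε > (0 : ℝ), ∀ κ : ℝ, |κ| < ε →
      (∀ H : HalfLine.HalfLineSpace →L[ℂ] HalfLine.HalfLineSpace,
        H = HalfLine.halfLineSchrodinger (Real.pi / 4) (κ • b) →
        HalfLine.IsPurelyACOn H (Set.Icc (-2) 2) ∧
        ∀ f : C(Set.Icc (-2 : ℝ) 2, ℂ),
          HalfLine.IsHolderMeasure (1 / 2)
            (HalfLine.spectralMeasure H (HalfLine.stateOf H f)) ∧
          ∃ γ' > (0 : ℝ), ∀ t : ℝ, 2 < t →
            HalfLine.returnAverage H (HalfLine.stateOf H f) t ≤ γ' * (Real.log t / t)) ∧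
      (∀ H : HalfLine.HalfLineSpace →L[ℂ] HalfLine.HalfLineSpace,
        H = HalfLine.halfLineSchrodinger 0 (κ • b) →
        HalfLine.IsPurelyACOn H (Set.Icc (-2) 2) ∧
        ∀ f : C(Set.Icc (-2 : ℝ) 2, ℂ),
          HalfLine.IsHolderMeasure 1
            (HalfLine.spectralMeasure H (HalfLine.stateOf H f)) ∧
          ∃ η > (0 : ℝ), ∀ t : ℝ, 0 < t →
            HalfLine.returnAverage H (HalfLine.stateOf H f) t ≤ η * (1 / t)) := by
  obtain ⟨γ, -, a, ha, τ, hτ, hb⟩ := hb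
  have hsum := HalfLine.summable_extendPotential ha hτ hb
  set S : ℝ := ∑' m : ℕ, (m : ℝ) * |HalfLine.extendPotential b m| with hS
  have hS0 : 0 ≤ S := tsum_nonneg fun m => by positivity
  -- The smallness makes the Volterra iteration for the Jost solution of `κ b` a contraction.
  refine ⟨1 / (4 * (S + 1)), by positivity, fun κ hκ => ?_⟩
  set V : lp (fun _ : ℕ+ => ℝ) ⊤ := κ • b with hV
  have hext : ∀ m : ℕ, (m : ℝ) * |HalfLine.extendPotential V m| =
      |κ| * (m * |HalfLine.extendPotential b m|) := fun m => by
    have : HalfLine.extendPotential V m = κ * HalfLine.extendPotential b m := by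
      unfold HalfLine.extendPotential
      split_ifs
      · rfl
      · rw [mul_zero]
    rw [this, abs_mul]
    ring
  obtain ⟨φ, hφ⟩ : ∃ φ, HalfLine.IsJostFamily (HalfLine.extendPotential V) φ := by
    refine HalfLine.exists_isJostFamily ?_ ?_
    · simp only [hext]
      exact hsum.mul_left _
    · simp only [hext]
      rw [tsum_mul_left, ← hS]
      rw [lt_div_iff₀ (by positivity)] at hκ
      nlinarith [abs_nonneg κ]
  have hfin : ∀ (H : HalfLine.HalfLineSpace →L[ℂ] HalfLine.HalfLineSpace) ψ G,
      HalfLine.spectralMeasure H ψ = MeasureTheory.volume.withDensity G →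
      MeasureTheory.IsFiniteMeasure (MeasureTheory.volume.withDensity G) := fun H ψ G h => by
    rw [← h]
    infer_instance
  refine ⟨?_, ?_⟩
  · rintro H rfl
    have hH := HalfLine.isSelfAdjoint_halfLineSchrodinger (Real.pi / 4) V
    have hcyc := HalfLine.isCyclicVector_delta1 (β := Real.pi / 4) (V := V)
    obtain ⟨ρ, hρm, hρpos, hρle, -, hρ⟩ := HalfLine.exists_spectralDensity (β := Real.pi / 4) hφ
    refine ⟨HalfLine.isPurelyACOn_of_density hH hcyc hρm hρpos hρ, fun f => ?_⟩
    obtain ⟨G, hGm, hGle, hG⟩ := HalfLine.exists_density_stateOf hH hcyc hρm hρ f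
    have hGedge : ∀ x, G x ≤ ENNReal.ofReal (‖f‖ ^ 2 * 2) * HalfLine.edgeWeight x := fun x => by
      refine (hGle x).trans ?_
      rw [ENNReal.ofReal_mul (by positivity), mul_assoc, ENNReal.ofReal_ofNat]
      gcongr
      exact hρle x
    have := hfin _ _ _ hG
    refine ⟨hG ▸ HalfLine.isHolderMeasure_half (by positivity) hGedge, ?_⟩
    obtain ⟨γ', hγ', h⟩ := HalfLine.exists_integral_norm_measureFourier_sq_le_log hGm (by positivity) hGedge
    refine ⟨γ', hγ', fun t ht => ?_⟩
    rw [HalfLine.returnAverage_eq hH, hG, ← mul_div_assoc, one_div_mul_eq_div]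
    have := h t ht
    gcongr
  · rintro H rfl
    have hH := HalfLine.isSelfAdjoint_halfLineSchrodinger 0 V
    have hcyc := HalfLine.isCyclicVector_delta1 (β := 0) (V := V)
    obtain ⟨ρ, hρm, hρpos, -, hρle, hρ⟩ := HalfLine.exists_spectralDensity (β := 0) hφ
    refine ⟨HalfLine.isPurelyACOn_of_density hH hcyc hρm hρpos hρ, fun f => ?_⟩
    obtain ⟨G, hGm, hGle, hG⟩ := HalfLine.exists_density_stateOf hH hcyc hρm hρ f
    have hGbd : ∀ x, G x ≤ ENNReal.ofReal (‖f‖ ^ 2) := fun x => by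
      refine (hGle x).trans (mul_le_of_le_one_right' ?_)
      rw [← ENNReal.ofReal_one]
      exact ENNReal.ofReal_le_ofReal (hρle Real.tan_zero x)
    have := hfin _ _ _ hG
    refine ⟨hG ▸ HalfLine.isHolderMeasure_one (by positivity) hGbd, ?_⟩
    obtain ⟨η, hη, h⟩ := HalfLine.exists_integral_norm_measureFourier_sq_le hGm hGbd
    refine ⟨η, hη, fun t ht => ?_⟩
    rw [HalfLine.returnAverage_eq hH, hG, mul_comm]
    have := h t ht
    gcongr
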